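/- Let $\mathcal G=(V,E)$ be a connected finite directed metric graph (loops and multiple edges allowed): each edge $e$ is an interval $I_e$ that is either a bounded interval $[a_e,b_e]$ with $a_e<b_e$, or a closed half-line $[a_e,+\infty)$ or $(-\infty,b_e]$, and a vertex at infinity has degree one. Let $d\in\mathbb N$, let $N_a$ (resp. $N_b$) be $d$ times the number of finite left (resp. right) endpoints, and let $L^2(\mathcal G)=\bigoplus_{e}L^2(I_e;\mathbb R^d)$. On each edge let real $d\times d$ matrix functions on $I_e$ be given: $P$ of class $C^1$, symmetric and positive definite, $Q$ of class $C^1$, and $R$ continuous and symmetric. Consider $$\ell x=-\bigl(Px'+Qx\bigr)'+Q^{T}x'+Rx .$$ Let $L$ be the minimal operator, i.e. the closure in $L^2(\mathcal G)$ of $\ell$ on families of smooth functions compactly supported in the interiors of the edges, and let $L^*$ be its adjoint (the maximal operator). Put $\omega(f,g)=\langle f,L^*g\rangle-\langle L^*f,g\rangle$ on $\operatorname{dom}L^*$. Assume that $L$ is a Fredholm operator, and let $U$ be a subspace with $\operatorname{dom}L^*=\operatorname{dom}L\oplus U$. If some edge is a half-line, assume moreover that $\dim U=2(N_a+N_b)$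 (no boundary contribution at infinity). Let $\rho=\omega|_U$ and let $p:\operatorname{dom}L^*\to U$ be the projection along $\operatorname{dom}L$. For a subspace $\Lambda\subset U$ let $L_\Lambda$ be the restriction of $L^*$ to $\operatorname{dom}L\oplus\Lambda$, and let $\Lambda_D$ be the Dirichlet subspace of all $u\in U$ that vanish at every finite endpoint of every edge (when $L$ is bounded below, $L_{\Lambda_D}$ is the Friedrichs extension of $L$). The Morse index $\operatorname{i}_{\mathrm{Mor}}(A)\in\mathbb N\cup\{\infty\}$ of an operator $A$ is the supremum of the dimensions of the subspaces of $\operatorname{dom}A$ on which $x\mapsto\langle Ax,x\rangle$ is negative definite. For Lagrangian subspaces $\alpha,\beta,\gamma$ of $(U,\rho)$ the triple index is $$\iota(\alpha,\beta,\gamma)=n_+\,Q(\alpha,\beta;\gamma)+\dim(\alpha\cap\gamma)-\dim(\alpha\cap\beta\cap\gamma),$$ where $n_+$ is the positive index of inertia of the quadratic form $Q(\alpha,\beta;\gamma)$ on $\alpha\cap(\beta+\gamma)$ given by $Q(\alpha,\beta;\gamma)[u]=\rho(u,v)$ for any $v\in\beta$ with $u+v\in\gamma$. Then, for every Lagrangian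 subspace $\Lambda$ of $(U,\rho)$, $\operatorname{i}_{\mathrm{Mor}}(L_\Lambda)$ is finite if and only if $\operatorname{i}_{\mathrm{Mor}}(L_{\Lambda_D})$ is finite, and in that case $$\operatorname{i}_{\mathrm{Mor}}(L_\Lambda)-\operatorname{i}_{\mathrm{Mor}}(L_{\Lambda_D})=\iota\bigl(p(\ker L^*),\Lambda,\Lambda_D\bigr).$$ -/

import Mathlib

open MeasureTheory Set Topology
open scoped InnerProductSpace ContDiff

noncomputable section

/-! ### Indices of quadratic forms, Lagrangian subspaces, triple index -/

section LinearAlgebra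

variable {X : Type*} [AddCommGroup X] [Module ℝ X]

/-- Positive index of inertia of the form `q` on the subspace `S`: the supremum of the dimensions
of the subspaces of `S` on which `q` is positive definite. -/
def posIndex (q : X → ℝ) (S : Submodule ℝ X) : ℕ∞ :=
  ⨆ W : {W : Submodule ℝ X // W ≤ S ∧ ∀ w ∈ W, w ≠ 0 → 0 < q w},
    Cardinal.toENat (Module.rank ℝ W.1)

/-- Negative index of inertia (Morse index) of the form `q` on the subspace `S`. -/
def negIndex (q : X → ℝ) (S : Submodule ℝ X) : ℕ∞ := posIndex (fun x => -q x) S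

/-- `Λ` is Lagrangian: it equals its own annihilator with respect to `Ω`. -/
def IsLagrangian (Ω : LinearMap.BilinForm ℝ X) (Λ : Submodule ℝ X) : Prop :=
  ∀ x, x ∈ Λ ↔ ∀ y ∈ Λ, Ω x y = 0

open Classical in
/-- The quadratic form `Q(α, β; γ)[u] = Ω(u, C u)`, where `C u ∈ β` and `u + C u ∈ γ`.
Such a `C u` exists exactly when `u ∈ β + γ`, and for Lagrangian `α, β, γ` and
`u ∈ α ∩ (β + γ)` the value does not depend on which one is taken. -/
def tripleForm (Ω : LinearMap.BilinForm ℝ X) (β γ : Submodule ℝ X) (u : X) : ℝ :=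
  if h : ∃ v ∈ β, u + v ∈ γ then Ω u h.choose else 0

/-- The triple index
`ι(α, β, γ) = n₊ Q(α, β; γ) + dim (α ∩ γ) - dim (α ∩ β ∩ γ)`,
with `Q(α, β; γ)` on `α ∩ (β + γ)`. -/
def tripleIndex (Ω : LinearMap.BilinForm ℝ X) (α β γ : Submodule ℝ X) : ℤ :=
  ((posIndex (tripleForm Ω β γ) (α ⊓ (β ⊔ γ))).toNat : ℤ)
    + (Module.finrank ℝ ↥(α ⊓ γ) : ℤ) - (Module.finrank ℝ ↥(α ⊓ β ⊓ γ) : ℤ)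

end LinearAlgebra

/-! ### Unbounded operators -/

section Operators

variable {H : Type*} [NormedAddCommGroup H] [InnerProductSpace ℝ H]

/-- Morse index of an operator `T`: the supremum of the dimensions of the subspaces of `dom T` on
which `x ↦ ⟪T x, x⟫` is negative definite. -/
def morseIndex (T : H →ₗ.[ℝ] H) : ℕ∞ := negIndex (fun x : T.domain => ⟪T x, (x : H)⟫_ℝ) ⊤

/-- Closed, densely defined Fredholm operators. -/
structure IsFredholmPMap (T : H →ₗ.[ℝ] H) : Prop where
  isClosed : T.IsClosed
  dense_domain : Dense (T.domain : Set H)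
  finite_ker : FiniteDimensional ℝ (LinearMap.ker T.toFun)
  isClosed_range : _root_.IsClosed (LinearMap.range T.toFun : Set H)
  finite_coker : FiniteDimensional ℝ (H ⧸ LinearMap.range T.toFun)

end Operators

/-! ### Metric graphs -/

/-- A connected directed metric graph. The edge `e` joins the vertex `(ends e).1`, which
corresponds to the left end `lo e`, to the vertex `(ends e).2`, which corresponds to the right end
`hi e`; it is a bounded interval or a half-line. A vertex at an infinite end has degree one. -/
structure MetricGraph (V E : Type*) where
  ends : E → V × V
  lo : E → EReal
  hi : E → EReal
  lo_lt_hi : ∀ e, lo e < hi e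
  ne_line : ∀ e, lo e ≠ ⊥ ∨ hi e ≠ ⊤
  connected : ∀ v w, Relation.EqvGen (fun v w => ∃ e, ends e = (v, w)) v w
  degree_lo : ∀ e, lo e = ⊥ →
    Nat.card {f // (ends f).1 = (ends e).1} + Nat.card {f // (ends f).2 = (ends e).1} = 1
  degree_hi : ∀ e, hi e = ⊤ →
    Nat.card {f // (ends f).1 = (ends e).2} + Nat.card {f // (ends f).2 = (ends e).2} = 1

namespace MetricGraph

variable {V E : Type*} (G : MetricGraph V E)

/-- The closed interval of the edge `e`. -/
def edge (e : E) : Set ℝ := {t | G.lo e ≤ (t : EReal) ∧ (t : EReal) ≤ G.hi e}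

/-- The open interval of the edge `e`. -/
def openEdge (e : E) : Set ℝ := {t | G.lo e < (t : EReal) ∧ (t : EReal) < G.hi e}

/-- Some edge is a half-line. -/
def IsNoncompact : Prop := ∃ e, G.lo e = ⊥ ∨ G.hi e = ⊤

/-- `N_a`: `d` times the number of finite left endpoints. -/
def Na (d : ℕ) : ℕ := Nat.card {e // G.lo e ≠ ⊥} * d

/-- `N_b`: `d` times the number of finite right endpoints. -/
def Nb (d : ℕ) : ℕ := Nat.card {e // G.hi e ≠ ⊤} * d

/-- `L²(G) = ⨁ₑ L²(Iₑ; ℝᵈ)`. -/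
abbrev L2 [Fintype E] (d : ℕ) : Type _ :=
  PiLp 2 fun e => Lp (EuclideanSpace ℝ (Fin d)) 2 (volume.restrict (G.edge e))

theorem isOpen_openEdge (e : E) : IsOpen (G.openEdge e) :=
  (isOpen_lt continuous_const continuous_coe_real_ereal).inter
    (isOpen_lt continuous_coe_real_ereal continuous_const)

theorem openEdge_subset (e : E) : G.openEdge e ⊆ G.edge e := fun _ h => ⟨h.1.le, h.2.le⟩

/-- Families of smooth functions with compact support in the open edges. -/
def testSpace (d : ℕ) : Submodule ℝ (E → ℝ → EuclideanSpace ℝ (Fin d)) where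
  carrier := {φ | ∀ e, ContDiff ℝ ∞ (φ e) ∧ HasCompactSupport (φ e) ∧
    tsupport (φ e) ⊆ G.openEdge e}
  add_mem' {φ ψ} hφ hψ e := ⟨(hφ e).1.add (hψ e).1, (hφ e).2.1.add (hψ e).2.1,
    (tsupport_add (φ e) (ψ e)).trans (union_subset (hφ e).2.2 (hψ e).2.2)⟩
  zero_mem' e := by
    refine ⟨contDiff_const, HasCompactSupport.zero, ?_⟩
    simp
  smul_mem' c φ hφ e := ⟨(hφ e).1.const_smul c,
    (hφ e).2.1.smul_left (f := fun _ => c),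
    (tsupport_smul_subset_right (fun _ => c) (φ e)).trans (hφ e).2.2⟩

end MetricGraph

/-! ### Sturm–Liouville operators -/

/-- Coefficients of `ℓ = -(d/dt)(P d/dt + Q) + Qᵀ d/dt + R` on the edges: `P` is `C¹`, symmetric
and positive definite (so that `P⁻¹` is `C¹` too), `Q` is `C¹`, and `R` is continuous and
symmetric. Real `d × d` matrices are regarded as linear maps of `ℝᵈ`. -/
structure SLCoeff {V E : Type*} (G : MetricGraph V E) (d : ℕ) where
  P : E → ℝ → EuclideanSpace ℝ (Fin d) →L[ℝ] EuclideanSpace ℝ (Fin d)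
  Q : E → ℝ → EuclideanSpace ℝ (Fin d) →L[ℝ] EuclideanSpace ℝ (Fin d)
  R : E → ℝ → EuclideanSpace ℝ (Fin d) →L[ℝ] EuclideanSpace ℝ (Fin d)
  contDiffOn_P : ∀ e, ContDiffOn ℝ 1 (P e) (G.edge e)
  contDiffOn_Q : ∀ e, ContDiffOn ℝ 1 (Q e) (G.edge e)
  continuousOn_R : ∀ e, ContinuousOn (R e) (G.edge e)
  symm_P : ∀ e, ∀ t ∈ G.edge e, ∀ v w, ⟪P e t v, w⟫_ℝ = ⟪v, P e t w⟫_ℝ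
  pos_P : ∀ e, ∀ t ∈ G.edge e, ∀ v, v ≠ 0 → 0 < ⟪P e t v, v⟫_ℝ
  symm_R : ∀ e, ∀ t ∈ G.edge e, ∀ v w, ⟪R e t v, w⟫_ℝ = ⟪v, R e t w⟫_ℝ

namespace SLCoeff

variable {V E : Type*} {G : MetricGraph V E} {d : ℕ} (c : SLCoeff G d)

/-- The quasi-derivative `x^{[1]} = P x' + Q x`. -/
def quasiDeriv (x : E → ℝ → EuclideanSpace ℝ (Fin d)) (e : E) (t : ℝ) :
    EuclideanSpace ℝ (Fin d) :=
  c.P e t (deriv (x e) t) + c.Q e t (x e t)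

/-- The differential expression `ℓ x = -(P x' + Q x)' + Qᵀ x' + R x`. -/
def expr (x : E → ℝ → EuclideanSpace ℝ (Fin d)) (e : E) (t : ℝ) :
    EuclideanSpace ℝ (Fin d) :=
  -deriv (c.quasiDeriv x e) t + ContinuousLinearMap.adjoint (c.Q e t) (deriv (x e) t)
    + c.R e t (x e t)

section Aux

variable {φ ψ : E → ℝ → EuclideanSpace ℝ (Fin d)}

theorem contDiff_quasiDeriv (hφ : φ ∈ G.testSpace d) (e : E) :
    ContDiff ℝ 1 (c.quasiDeriv φ e) := by
  obtain ⟨h1, h2, h3⟩ := hφ e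
  have hd : ContDiff ℝ 1 (deriv (φ e)) := by
    have h1' : ContDiff ℝ (1 + 1) (φ e) := by
      simpa [one_add_one_eq_two] using contDiff_infty.1 h1 2
    exact (contDiff_succ_iff_deriv.1 h1').2.2
  rw [contDiff_iff_contDiffAt]
  intro t
  by_cases ht : t ∈ tsupport (φ e)
  · have hn : G.edge e ∈ 𝓝 t :=
      Filter.mem_of_superset ((G.isOpen_openEdge e).mem_nhds (h3 ht)) (G.openEdge_subset e)
    exact (((c.contDiffOn_P e).contDiffAt hn).clm_apply hd.contDiffAt).add
      (((c.contDiffOn_Q e).contDiffAt hn).clm_apply (h1.of_le (by exact_mod_cast le_top)).contDiffAt)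
  · have hz : φ e =ᶠ[𝓝 t] 0 := notMem_tsupport_iff_eventuallyEq.1 ht
    have : c.quasiDeriv φ e =ᶠ[𝓝 t] fun _ => 0 := by
      filter_upwards [hz, hz.deriv] with s hs hs'
      simp only [quasiDeriv, hs, hs']
      simp
    exact contDiffAt_const.congr_of_eventuallyEq this

theorem expr_eq_zero {e : E} {t : ℝ} (ht : t ∉ tsupport (φ e)) : c.expr φ e t = 0 := by
  have hz : φ e =ᶠ[𝓝 t] 0 := notMem_tsupport_iff_eventuallyEq.1 ht
  have h0 : c.quasiDeriv φ e =ᶠ[𝓝 t] fun _ => 0 := by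
    filter_upwards [hz, hz.deriv] with s hs hs'
    simp only [quasiDeriv, hs, hs']
    simp
  have h2 : deriv (φ e) t = 0 := by simpa using hz.deriv_eq
  simp only [expr, h0.deriv_eq, hz.eq_of_nhds, h2]
  simp

theorem continuous_expr (hφ : φ ∈ G.testSpace d) (e : E) : Continuous (c.expr φ e) := by
  obtain ⟨h1, h2, h3⟩ := hφ e
  have hd : Continuous (deriv (φ e)) := h1.continuous_deriv (by exact_mod_cast le_top)
  rw [continuous_iff_continuousAt]
  intro t
  by_cases ht : t ∈ tsupport (φ e)
  · have hn : G.edge e ∈ 𝓝 t :=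
      Filter.mem_of_superset ((G.isOpen_openEdge e).mem_nhds (h3 ht)) (G.openEdge_subset e)
    have hQ : ContinuousAt (fun s => ContinuousLinearMap.adjoint (c.Q e s)) t :=
      (ContinuousLinearMap.adjoint (𝕜 := ℝ)).continuous.continuousAt.comp
        ((c.contDiffOn_Q e).continuousOn.continuousAt hn)
    exact ((((c.contDiff_quasiDeriv hφ e).continuous_deriv le_rfl).continuousAt.neg).add
      (hQ.clm_apply hd.continuousAt)).add
      (((c.continuousOn_R e).continuousAt hn).clm_apply h1.continuous.continuousAt)
  · have hz : ∀ᶠ s in 𝓝 t, s ∉ tsupport (φ e) :=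
      (isClosed_tsupport (φ e)).isOpen_compl.mem_nhds ht
    have : c.expr φ e =ᶠ[𝓝 t] fun _ => 0 := hz.mono fun s hs => c.expr_eq_zero hs
    exact continuousAt_const.congr this.symm

theorem memLp_test (hφ : φ ∈ G.testSpace d) (e : E) :
    MemLp (φ e) 2 (volume.restrict (G.edge e)) :=
  (hφ e).1.continuous.memLp_of_hasCompactSupport (hφ e).2.1

theorem memLp_expr (hφ : φ ∈ G.testSpace d) (e : E) :
    MemLp (c.expr φ e) 2 (volume.restrict (G.edge e)) :=
  (c.continuous_expr hφ e).memLp_of_hasCompactSupport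
    (HasCompactSupport.intro (hφ e).2.1 fun _ ht => c.expr_eq_zero ht)

theorem expr_add (hφ : φ ∈ G.testSpace d) (hψ : ψ ∈ G.testSpace d) (e : E) :
    c.expr (φ + ψ) e = c.expr φ e + c.expr ψ e := by
  have hn : (∞ : WithTop ℕ∞) ≠ 0 := by simp
  have hd : deriv (φ e + ψ e) = deriv (φ e) + deriv (ψ e) := by
    ext1 s
    exact deriv_add ((hφ e).1.differentiable hn s) ((hψ e).1.differentiable hn s)
  have hq : c.quasiDeriv (φ + ψ) e = c.quasiDeriv φ e + c.quasiDeriv ψ e := by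
    ext1 s
    simp only [quasiDeriv, Pi.add_apply, hd, map_add]
    abel
  ext1 t
  have : deriv (c.quasiDeriv φ e + c.quasiDeriv ψ e) t
      = deriv (c.quasiDeriv φ e) t + deriv (c.quasiDeriv ψ e) t :=
    deriv_add ((c.contDiff_quasiDeriv hφ e).differentiable (by simp) t)
      ((c.contDiff_quasiDeriv hψ e).differentiable (by simp) t)
  simp only [expr, hq, hd, this, Pi.add_apply, map_add]
  abel

theorem expr_smul (r : ℝ) (φ : E → ℝ → EuclideanSpace ℝ (Fin d)) (e : E) :
    c.expr (r • φ) e = r • c.expr φ e := by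
  have hd : deriv (r • φ e) = r • deriv (φ e) := by
    ext1 s
    exact deriv_const_smul_field r (φ e)
  have hq : c.quasiDeriv (r • φ) e = r • c.quasiDeriv φ e := by
    ext1 s
    simp only [quasiDeriv, hd, Pi.smul_apply, map_smul, smul_add]
  ext1 t
  have : deriv (r • c.quasiDeriv φ e) t = r • deriv (c.quasiDeriv φ e) t :=
    deriv_const_smul_field r (c.quasiDeriv φ e)
  simp only [expr, hq, hd, this, Pi.smul_apply, map_smul, smul_add, smul_neg]

end Aux

variable [Fintype E]

variable (G d) in
/-- The inclusion of test functions into `L²(G)`. -/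
def testToL2 : G.testSpace d →ₗ[ℝ] G.L2 d where
  toFun φ := WithLp.toLp 2 fun e => (memLp_test φ.2 e).toLp (φ.1 e)
  map_add' _ _ := rfl
  map_smul' _ _ := rfl

variable (G d) in
theorem testToL2_injective : Function.Injective (testToL2 G d) := by
  rw [← LinearMap.ker_eq_bot, LinearMap.ker_eq_bot']
  intro φ h
  ext1
  funext e t
  by_cases ht : t ∈ G.openEdge e
  · have h0 : (memLp_test φ.2 e).toLp (φ.1 e) = 0 := congrArg (fun x : G.L2 d => x e) h
    have h1 : φ.1 e =ᵐ[volume.restrict (G.openEdge e)] 0 := by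
      have : φ.1 e =ᵐ[volume.restrict (G.edge e)] 0 :=
        (MemLp.coeFn_toLp (memLp_test φ.2 e)).symm.trans (by rw [h0]; exact Lp.coeFn_zero _ _ _)
      exact ae_restrict_of_ae_restrict_of_subset (G.openEdge_subset e) this
    exact Measure.eqOn_open_of_ae_eq h1 (G.isOpen_openEdge e)
      (φ.2 e).1.continuous.continuousOn continuousOn_const ht
  · exact image_eq_zero_of_notMem_tsupport fun h' => ht ((φ.2 e).2.2 h')

/-- `φ ↦ ℓ φ` from test functions to `L²(G)`. -/
def exprToL2 : G.testSpace d →ₗ[ℝ] G.L2 d where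
  toFun φ := WithLp.toLp 2 fun e => (c.memLp_expr φ.2 e).toLp (c.expr φ.1 e)
  map_add' φ ψ := by
    refine PiLp.ext fun e => ?_
    exact (MemLp.toLp_congr (c.memLp_expr (φ + ψ).2 e)
      ((c.memLp_expr φ.2 e).add (c.memLp_expr ψ.2 e))
      (by rw [← c.expr_add φ.2 ψ.2 e]; rfl)).trans
      (MemLp.toLp_add (c.memLp_expr φ.2 e) (c.memLp_expr ψ.2 e))
  map_smul' r φ := by
    refine PiLp.ext fun e => ?_
    exact (MemLp.toLp_congr (c.memLp_expr (r • φ).2 e) ((c.memLp_expr φ.2 e).const_smul r)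
      (by rw [← c.expr_smul r φ.1 e]; rfl)).trans (MemLp.toLp_const_smul r (c.memLp_expr φ.2 e))

/-- The operator `ℓ` in `L²(G)` with domain the test functions. -/
def preMinimal : G.L2 d →ₗ.[ℝ] G.L2 d where
  domain := LinearMap.range (testToL2 G d)
  toFun := c.exprToL2 ∘ₗ
    (LinearEquiv.ofInjective (testToL2 G d) (testToL2_injective G d)).symm.toLinearMap

/-- The minimal operator `L`: the closure of `ℓ` on test functions. -/
def minimal : G.L2 d →ₗ.[ℝ] G.L2 d := c.preMinimal.closure

/-- The maximal operator `L*`: the adjoint of the minimal operator. -/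
def maximal : G.L2 d →ₗ.[ℝ] G.L2 d := c.minimal.adjoint

/-- `ω(f, g) = ⟪f, L* g⟫ - ⟪L* f, g⟫` on `dom L*`. -/
def omega : LinearMap.BilinForm ℝ c.maximal.domain :=
  LinearMap.mk₂ ℝ (fun f g => ⟪(f : G.L2 d), c.maximal g⟫_ℝ - ⟪c.maximal f, (g : G.L2 d)⟫_ℝ)
    (fun f f' g => by
      simp only [LinearPMap.map_add, Submodule.coe_add, inner_add_left]; ring)
    (fun r f g => by
      simp only [LinearPMap.map_smul, Submodule.coe_smul, real_inner_smul_left, smul_eq_mul]; ring)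
    (fun f g g' => by
      simp only [LinearPMap.map_add, Submodule.coe_add, inner_add_right]; ring)
    (fun r f g => by
      simp only [LinearPMap.map_smul, Submodule.coe_smul, real_inner_smul_right, smul_eq_mul]; ring)

/-- `dom L` as a subspace of `dom L*`. -/
def minDomain : Submodule ℝ c.maximal.domain := c.minimal.domain.submoduleOf c.maximal.domain

/-- `ρ = ω|_U`. -/
def rho (U : Submodule ℝ c.maximal.domain) : LinearMap.BilinForm ℝ U := c.omega.restrict U

/-- `p(ker L*)`, where `p : dom L* → U` is the projection along `dom L`. -/
def cauchyData {U : Submodule ℝ c.maximal.domain} (hU : IsCompl c.minDomain U) :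
    Submodule ℝ U :=
  (LinearMap.ker c.maximal.toFun).map (U.projectionOnto c.minDomain hU.symm)

/-- `L_Λ`: the restriction of `L*` to `dom L + Λ`. -/
def extension (U : Submodule ℝ c.maximal.domain) (Λ : Submodule ℝ U) : G.L2 d →ₗ.[ℝ] G.L2 d :=
  c.maximal.domRestrict ((c.minDomain ⊔ Λ.map U.subtype).map c.maximal.domain.subtype)

variable (G d) in
/-- The `x ∈ L²(G)` whose components have continuous representatives on the (closed) edges that
vanish at all finite endpoints. -/
def vanishingTrace : Submodule ℝ (G.L2 d) where
  carrier := {x | ∀ e, ∃ g : ℝ → EuclideanSpace ℝ (Fin d), ContinuousOn g (G.edge e) ∧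
    x e =ᵐ[volume.restrict (G.edge e)] g ∧
    ∀ t : ℝ, (t : EReal) = G.lo e ∨ (t : EReal) = G.hi e → g t = 0}
  add_mem' {x y} hx hy e := by
    obtain ⟨g, hg, hxg, hg0⟩ := hx e
    obtain ⟨k, hk, hyk, hk0⟩ := hy e
    refine ⟨g + k, hg.add hk, ?_, fun t ht => by simp [hg0 t ht, hk0 t ht]⟩
    exact (Lp.coeFn_add (x e) (y e)).trans (hxg.add hyk)
  zero_mem' e := ⟨0, continuousOn_const, Lp.coeFn_zero _ _ _, fun _ _ => rfl⟩
  smul_mem' r x hx e := by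
    obtain ⟨g, hg, hxg, hg0⟩ := hx e
    refine ⟨r • g, hg.const_smul r, ?_, fun t ht => by simp [hg0 t ht]⟩
    exact (Lp.coeFn_smul r (x e)).trans (hxg.const_smul r)

/-- The Dirichlet subspace `Λ_D` of `U`. -/
def dirichlet (U : Submodule ℝ c.maximal.domain) : Submodule ℝ U :=
  ((vanishingTrace G d).submoduleOf c.maximal.domain).submoduleOf U

end SLCoeff

end

/-!
The theorem is an abstract index formula, `restrMorse_sub_eq_tripleIndex`, together with the
analytic facts that put Sturm–Liouville operators on metric graphs within its reach.

*The index formula.* Let `D₁ = dom L + Λ` and `D₂ = dom L + Λ_D`. On `D₁ × D₂` consider the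
symmetric form `pairForm` with diagonal blocks `-⟪L* x, x⟫` and cross terms `-⟪L* x, y⟫`, where `x
∈ D₁` and `y ∈ D₂`. Its positive index is computed in two ways.

* Elements of `D₂` differ from elements of `dom L ⊆ D₁` by boundary layers `hₙ` such that `hₙ → 0`
  and `⟪L* hₙ, hₙ⟫ → 0`. So `D₁ × 0` is dense in `D₁ × D₂` as far as the values of the form are
  concerned, and the index is the Morse index of `L_Λ` (`posIndex_eq_of_approx`).
* The orthogonal complement of `0 × D₂` consists of the pairs with `x + y ∈ ker L*`. There the
  form is the pull-back of the form `Q(p(ker L*), Λ; Λ_D)` of the triple index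
  (`posIndex_tripleForm`), while on `0 × D₂` it gives the Morse index of `L_{Λ_D}`. A subspace and
  its orthogonal complement do not determine the index when they meet: each dimension of the
  intersection, here `ker L* ∩ D₂`, that is not in the radical, here `ker L* ∩ D₁ ∩ D₂`, adds a
  hyperbolic plane (`posIndex_top_add_finrank`). This is the difference of dimensions in the
  triple index.

Both computations are combined in `restrMorse_add_finrank`. No lower bound for `L` is needed.

*The analytic facts.* Smooth functions with prescribed values and derivatives at the finite
endpoints (`maximalLift`) span a subspace of dimension `2 (N_a + N_b)` on which `ω` is
nondegenerate. As `dim U ≤ 2 (N_a + N_b)`, this subspace and `dom L` span `dom L*`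
(`exists_eq_add_maximalLift`). The bound on `dim U` is an assumption if there are half-lines. On a
compact graph it follows from `dim U ≤ 2 dim ker L*` (`finiteDimensional_complement`, where the
Fredholm property enters) and `dim ker L* ≤ N_a + N_b` (`finrank_ker_maximal_le`): by the lemma of
du Bois-Reymond a weak solution of `ℓ k = 0` satisfies a Volterra equation with two constants of
integration on each edge, and it is determined by these constants by Gronwall's inequality.

Gronwall's inequality also bounds a test function `φ` near a finite endpoint by `ℓ φ`, so that
elements of `dom L` vanish at the endpoints (`minimal_domain_le_vanishingTrace`). Hence `dom L +
Λ_D` consists of the elements of `dom L*` with vanishing boundary values, `Λ_D` is Lagrangian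
(`isLagrangian_dirichlet`), and cutting off near the endpoints yields the boundary layers
(`exists_seq_friedrichs`).
-/

/-! ### Indices of inertia -/

section Inertia

open Module

variable {X : Type*} [AddCommGroup X] [Module ℝ X]

theorem finrank_le_posIndex {q : X → ℝ} {S W : Submodule ℝ X} [FiniteDimensional ℝ W]
    (hWS : W ≤ S) (hW : ∀ w ∈ W, w ≠ 0 → 0 < q w) : (finrank ℝ W : ℕ∞) ≤ posIndex q S := by
  have h := le_iSup (fun W : {W : Submodule ℝ X // W ≤ S ∧ ∀ w ∈ W, w ≠ 0 → 0 < q w} =>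
    Cardinal.toENat (Module.rank ℝ W.1)) ⟨W, hWS, hW⟩
  rw [posIndex]
  refine le_trans (le_of_eq ?_) h
  rw [← finrank_eq_rank]
  simp

theorem exists_submodule_of_le_posIndex {q : X → ℝ} {S : Submodule ℝ X} {n : ℕ}
    (h : (n : ℕ∞) ≤ posIndex q S) :
    ∃ W ≤ S, FiniteDimensional ℝ W ∧ finrank ℝ W = n ∧ ∀ w ∈ W, w ≠ 0 → 0 < q w := by
  obtain ⟨W, hW⟩ : ∃ W : {W : Submodule ℝ X // W ≤ S ∧ ∀ w ∈ W, w ≠ 0 → 0 < q w},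
      (n : ℕ∞) ≤ Cardinal.toENat (Module.rank ℝ W.1) := by
    rcases n with _ | n
    · exact ⟨⟨⊥, bot_le, fun w hw h0 => absurd ((Submodule.mem_bot ℝ).1 hw) h0⟩, by simp⟩
    · by_contra! hcon
      have : posIndex q S ≤ n := iSup_le fun W => by
        have := hcon W
        push_cast at this
        exact Order.le_of_lt_add_one this
      have := h.trans this
      norm_cast at this
      omega
  obtain ⟨v, hv⟩ := Module.le_rank_iff.1 (Cardinal.natCast_le_toENat.1 hW)
  let T : Submodule ℝ W.1 := Submodule.span ℝ (range v)
  have hTf : finrank ℝ T = n := by simpa using finrank_span_eq_card hv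
  have hTfd : FiniteDimensional ℝ T := FiniteDimensional.span_of_finite ℝ (finite_range v)
  refine ⟨T.map W.1.subtype, ?_, inferInstance, ?_, ?_⟩
  · exact (Submodule.map_subtype_le _ _).trans W.2.1
  · rw [← hTf]
    exact (Submodule.equivMapOfInjective _ W.1.injective_subtype T).finrank_eq.symm
  · rintro w hw h0
    exact W.2.2 w (Submodule.map_subtype_le _ _ hw) h0

theorem posIndex_le_of_forall {q : X → ℝ} {S : Submodule ℝ X} {x : ℕ∞}
    (h : ∀ W ≤ S, FiniteDimensional ℝ W → (∀ w ∈ W, w ≠ 0 → 0 < q w) →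
      (finrank ℝ W : ℕ∞) ≤ x) : posIndex q S ≤ x := by
  refine ENat.forall_natCast_le_iff_le.1 fun n hn => ?_
  obtain ⟨W, hWS, hfd, rfl, hW⟩ := exists_submodule_of_le_posIndex hn
  exact h W hWS hfd hW

theorem posIndex_mono {q : X → ℝ} {S T : Submodule ℝ X} (h : S ≤ T) :
    posIndex q S ≤ posIndex q T :=
  posIndex_le_of_forall fun _ hWS _ hW => finrank_le_posIndex (hWS.trans h) hW

theorem posIndex_congr {q q' : X → ℝ} {S : Submodule ℝ X} (h : ∀ x ∈ S, q x = q' x) :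
    posIndex q S = posIndex q' S := by
  refine le_antisymm ?_ ?_ <;> refine posIndex_le_of_forall fun W hWS _ hW => ?_
  · exact finrank_le_posIndex hWS fun w hw h0 => by rw [← h w (hWS hw)]; exact hW w hw h0
  · exact finrank_le_posIndex hWS fun w hw h0 => by rw [h w (hWS hw)]; exact hW w hw h0

/-- The index of inertia does not change under pull-back along a linear map, injective or not:
a form vanishes on the kernel of the map along which it is pulled back. -/
theorem posIndex_comp {X' : Type*} [AddCommGroup X'] [Module ℝ X'] (f : X' →ₗ[ℝ] X)
    {q : X → ℝ} {q' : X' → ℝ} {S : Submodule ℝ X} {S' : Submodule ℝ X'} (hq : q 0 = 0)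
    (hqq : ∀ x ∈ S', q' x = q (f x)) (hS : S'.map f = S) : posIndex q' S' = posIndex q S := by
  refine le_antisymm ?_ ?_ <;> refine posIndex_le_of_forall fun W hWS _ hW => ?_
  · have hinj : Function.Injective (f.domRestrict W) := by
      rw [← LinearMap.ker_eq_bot, LinearMap.ker_eq_bot']
      intro w hw
      by_contra h0
      have h1 := hW w w.2 (by simpa using h0)
      rw [hqq w (hWS w.2), show f w = 0 from hw, hq] at h1
      exact lt_irrefl _ h1
    rw [← LinearMap.finrank_range_of_inj hinj]
    refine finrank_le_posIndex ?_ ?_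
    · rintro _ ⟨w, rfl⟩
      exact hS ▸ Submodule.mem_map_of_mem (hWS w.2)
    · rintro _ ⟨w, rfl⟩ h0
      rw [LinearMap.domRestrict_apply, ← hqq w (hWS w.2)]
      exact hW w w.2 fun h => h0 (by rw [LinearMap.domRestrict_apply, h, map_zero])
  · have hsurj : ∀ w : W, ∃ x : S', f x = w := fun w => by
      have := hWS w.2
      rw [← hS] at this
      obtain ⟨x, hx, hxw⟩ := this
      exact ⟨⟨x, hx⟩, hxw⟩
    let b := finBasis ℝ W
    choose g hg using hsurj
    let s : W →ₗ[ℝ] S' := b.constr ℝ fun i => g (b i)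
    have hs : ∀ w, f (s w) = w := by
      have : f ∘ₗ S'.subtype ∘ₗ s = W.subtype := b.ext fun i => by simp [s, hg]
      exact fun w => LinearMap.congr_fun this w
    have hinj : Function.Injective (S'.subtype ∘ₗ s) := fun w w' h => by
      have h' : f (s w) = f (s w') := congrArg f h
      rw [hs, hs] at h'
      exact Subtype.ext h'
    rw [← LinearMap.finrank_range_of_inj hinj]
    refine finrank_le_posIndex ?_ ?_
    · rintro _ ⟨w, rfl⟩
      exact (s w).2
    · rintro _ ⟨w, rfl⟩ h0
      have h1 : (w : X) ≠ 0 := fun h => h0 (by rw [show w = 0 from Subtype.ext h, map_zero])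
      have h2 := hW w w.2 h1
      rw [LinearMap.comp_apply, Submodule.subtype_apply, hqq _ (s w).2, hs]
      exact h2

/-- A form that is nonpositive on `P` has index at most `dim W` on `W + P`. -/
theorem posIndex_le_finrank_of_le_sup {q : X → ℝ} {S W P : Submodule ℝ X} [FiniteDimensional ℝ W]
    (hS : S ≤ W ⊔ P) (hP : ∀ x ∈ P, q x ≤ 0) : posIndex q S ≤ finrank ℝ W := by
  refine posIndex_le_of_forall fun W' hWS _ hW => ?_
  have hinj : Function.Injective (P.mkQ.domRestrict W') := by
    rw [← LinearMap.ker_eq_bot, LinearMap.ker_eq_bot']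
    intro w hw
    by_contra h0
    have h1 := hW w w.2 (by simpa using h0)
    exact (hP w ((Submodule.Quotient.mk_eq_zero P).1 hw)).not_gt h1
  rw [← LinearMap.finrank_range_of_inj hinj]
  have hle : LinearMap.range (P.mkQ.domRestrict W') ≤ W.map P.mkQ := by
    rintro _ ⟨w, rfl⟩
    obtain ⟨a, ha, p, hp, h⟩ := Submodule.mem_sup.1 (hS (hWS w.2))
    refine ⟨a, ha, ?_⟩
    rw [LinearMap.domRestrict_apply, ← h, map_add, P.mkQ_apply p,
      (Submodule.Quotient.mk_eq_zero P).2 hp, add_zero]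
  exact_mod_cast (Submodule.finrank_mono hle).trans (Submodule.finrank_map_le _ _)

theorem finrank_le_finrank_inf_add_map {W P : Submodule ℝ X} {Y : Type*} [AddCommGroup Y]
    [Module ℝ Y] [FiniteDimensional ℝ W] (f : X →ₗ[ℝ] Y) (hP : LinearMap.ker f = P) :
    finrank ℝ W = finrank ℝ ↥(W ⊓ P) + finrank ℝ (W.map f) := by
  have h1 := LinearMap.finrank_range_add_finrank_ker (f.domRestrict W)
  have h2 : LinearMap.range (f.domRestrict W) = W.map f := by
    rw [LinearMap.range_domRestrict]
  have h3 : finrank ℝ (LinearMap.ker (f.domRestrict W)) = finrank ℝ ↥(W ⊓ P) := by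
    rw [LinearMap.ker_domRestrict,
      (Submodule.equivMapOfInjective _ W.injective_subtype _).finrank_eq,
      Submodule.map_comap_subtype, hP]
  rw [h2, h3] at h1
  omega

theorem posIndex_le_add_finrank {q : X → ℝ} {S S₀ F : Submodule ℝ X} [FiniteDimensional ℝ F]
    (hS : S ≤ S₀ ⊔ F) : posIndex q S ≤ posIndex q S₀ + finrank ℝ F := by
  refine posIndex_le_of_forall fun W hWS _ hW => ?_
  have hfd : FiniteDimensional ℝ ↥(W ⊓ S₀) := Submodule.finiteDimensional_of_le inf_le_left
  have h1 := finrank_le_finrank_inf_add_map (W := W) S₀.mkQ S₀.ker_mkQ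
  have h2 : W.map S₀.mkQ ≤ F.map S₀.mkQ := by
    refine (Submodule.map_mono (hWS.trans hS)).trans ?_
    rw [Submodule.map_sup, Submodule.mkQ_map_self, bot_sup_eq]
  have h3 := (Submodule.finrank_mono h2).trans (Submodule.finrank_map_le _ _)
  have h4 : (finrank ℝ ↥(W ⊓ S₀) : ℕ∞) ≤ posIndex q S₀ :=
    finrank_le_posIndex inf_le_right fun w hw h0 => hW w hw.1 h0
  calc (finrank ℝ W : ℕ∞) ≤ (finrank ℝ ↥(W ⊓ S₀) + finrank ℝ F : ℕ) := by
        exact_mod_cast (by omega : finrank ℝ W ≤ finrank ℝ ↥(W ⊓ S₀) + finrank ℝ F)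
    _ ≤ _ := by push_cast; gcongr

variable {B : LinearMap.BilinForm ℝ X}

/-- A positive definite finite-dimensional subspace has an orthonormal basis. -/
theorem exists_orthonormal_family (hB : ∀ x y, B x y = B y x) {W : Submodule ℝ X}
    [FiniteDimensional ℝ W] (hW : ∀ w ∈ W, w ≠ 0 → 0 < B w w) :
    ∃ (m : ℕ) (v : Fin m → X), (∀ i, v i ∈ W) ∧ W ≤ Submodule.span ℝ (range v) ∧
      ∀ i j, B (v i) (v j) = if i = j then 1 else 0 := by
  have : Invertible (2 : ℝ) := invertibleOfNonzero two_ne_zero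
  obtain ⟨b, hb⟩ := LinearMap.BilinForm.exists_orthogonal_basis (B := B.restrict W)
    ⟨fun x y => hB x y⟩
  have hpos : ∀ i, 0 < B (b i) (b i) := fun i =>
    hW _ (b i).2 fun h => b.ne_zero i (Subtype.ext h)
  refine ⟨_, fun i => (√(B (b i) (b i)))⁻¹ • (b i : X), fun i => W.smul_mem _ (b i).2, ?_, ?_⟩
  · intro w hw
    have h1 := b.sum_repr ⟨w, hw⟩
    have h2 : w = ∑ i, b.repr ⟨w, hw⟩ i • (b i : X) := by
      have := congrArg (W.subtype) h1
      rw [map_sum] at this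
      exact this.symm
    rw [h2]
    refine Submodule.sum_mem _ fun i _ => ?_
    have : b.repr ⟨w, hw⟩ i • (b i : X) = (b.repr ⟨w, hw⟩ i * √(B (b i) (b i))) •
        ((√(B (b i) (b i)))⁻¹ • (b i : X)) := by
      rw [smul_smul, mul_assoc, mul_inv_cancel₀ (Real.sqrt_pos.2 (hpos i)).ne', mul_one]
    rw [this]
    exact Submodule.smul_mem _ _ (Submodule.subset_span ⟨i, rfl⟩)
  · intro i j
    simp only [map_smul, LinearMap.smul_apply, smul_eq_mul]
    split_ifs with h
    · subst h
      have h1 := (Real.sqrt_pos.2 (hpos i)).ne'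
      have h2 := Real.mul_self_sqrt (hpos i).le
      field_simp
      rw [sq, h2]
    · have : B (b i) (b j) = 0 := hb h
      rw [this]; simp

/-- The orthogonal projection to the span of an orthonormal family. -/
theorem apply_sub_sum_orthonormal {W : Submodule ℝ X} {m : ℕ}
    {v : Fin m → X} (hvW : W ≤ Submodule.span ℝ (range v))
    (hv : ∀ i j, B (v i) (v j) = if i = j then 1 else 0) (x : X) {w : X} (hw : w ∈ W) :
    B (x - ∑ i, B x (v i) • v i) w = 0 := by
  have : Submodule.span ℝ (range v) ≤ LinearMap.ker (B (x - ∑ i, B x (v i) • v i)) := by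
    rw [Submodule.span_le]
    rintro _ ⟨j, rfl⟩
    simp [hv]
  exact this (hvW hw)

/-- If the index of `B` on `S` is finite, it is attained on some subspace `W`, and `B` is
nonpositive on the orthogonal complement of `W` in `S`. -/
theorem exists_maximal_posDef (hB : ∀ x y, B x y = B y x) {S : Submodule ℝ X} {n : ℕ}
    (hn : posIndex (fun x => B x x) S = n) :
    ∃ W ≤ S, FiniteDimensional ℝ W ∧ finrank ℝ W = n ∧ (∀ w ∈ W, w ≠ 0 → 0 < B w w) ∧
      ∀ x ∈ S, (∀ w ∈ W, B x w = 0) → B x x ≤ 0 := by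
  obtain ⟨W, hWS, hfd, hWn, hW⟩ := exists_submodule_of_le_posIndex hn.ge
  refine ⟨W, hWS, hfd, hWn, hW, fun x hx hxW => ?_⟩
  by_contra! hpos
  have hxW' : x ∉ W := fun h => hpos.ne' (hxW x h)
  have h1 : (finrank ℝ ↥(W ⊔ Submodule.span ℝ {x}) : ℕ∞) ≤ posIndex (fun x => B x x) S := by
    refine finrank_le_posIndex (sup_le hWS (by simpa using hx)) ?_
    intro y hy h0
    obtain ⟨w, hw, z, hz, rfl⟩ := Submodule.mem_sup.1 hy
    obtain ⟨r, rfl⟩ := Submodule.mem_span_singleton.1 hz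
    have e : B (w + r • x) (w + r • x) = B w w + r ^ 2 * B x x := by
      simp only [map_add, map_smul, LinearMap.add_apply, LinearMap.smul_apply, smul_eq_mul,
        hB w x, hxW w hw]
      ring
    rw [e]
    by_cases hw0 : w = 0
    · have hr : r ≠ 0 := fun h => h0 (by simp [hw0, h])
      simp only [hw0, map_zero, zero_add]
      positivity
    · have := hW w hw hw0
      positivity
  have h2 : W < W ⊔ Submodule.span ℝ {x} :=
    lt_of_le_of_ne le_sup_left fun h => hxW' (h ▸ Submodule.mem_sup_right
      (Submodule.mem_span_singleton_self x))
  have h3 := Submodule.finrank_lt_finrank_of_lt h2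
  rw [hn] at h1
  have : finrank ℝ ↥(W ⊔ Submodule.span ℝ {x}) ≤ n := by exact_mod_cast h1
  omega

theorem le_sup_orthogonal (hB : ∀ x y, B x y = B y x) {S W : Submodule ℝ X}
    [FiniteDimensional ℝ W] (hWS : W ≤ S) (hW : ∀ w ∈ W, w ≠ 0 → 0 < B w w) :
    S ≤ W ⊔ (S ⊓ LinearMap.BilinForm.orthogonal B W) := by
  obtain ⟨m, v, hvW, hsp, hv⟩ := exists_orthonormal_family hB hW
  intro x hx
  have hp : ∑ i, B x (v i) • v i ∈ W := W.sum_mem fun i _ => W.smul_mem _ (hvW i)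
  refine Submodule.mem_sup.2 ⟨_, hp, x - ∑ i, B x (v i) • v i,
    ⟨S.sub_mem hx (hWS hp), ?_⟩, by abel⟩
  intro w hw
  change B w _ = 0
  rw [hB]
  exact apply_sub_sum_orthonormal hsp hv x hw

/-- A finite-dimensional subspace on which `B` is nonnegative exceeds the index of `B` at most by
the dimension of its intersection with the radical. -/
theorem finrank_le_add_finrank_inf_ker (hB : ∀ x y, B x y = B y x) {n : ℕ}
    (hn : posIndex (fun x => B x x) ⊤ = n) {F : Submodule ℝ X} [FiniteDimensional ℝ F]
    (hF : ∀ x ∈ F, 0 ≤ B x x) : finrank ℝ F ≤ n + finrank ℝ ↥(F ⊓ LinearMap.ker B) := by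
  obtain ⟨W, -, hfd, hWn, hW, hneg⟩ := exists_maximal_posDef hB hn
  let T : F →ₗ[ℝ] Dual ℝ W := (LinearMap.domRestrict₁₂ B F W : F →ₗ[ℝ] W →ₗ[ℝ] ℝ)
  have hT : ∀ (x : F) (w : W), T x w = B x w := fun _ _ => rfl
  have hker : (LinearMap.ker T).map F.subtype ≤ F ⊓ LinearMap.ker B := by
    rintro _ ⟨x, hx, rfl⟩
    refine ⟨x.2, ?_⟩
    have hxW : ∀ w ∈ W, B x w = 0 := fun w hw => by
      have := LinearMap.congr_fun (show T x = 0 from hx) ⟨w, hw⟩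
      exact this
    have h0 : B x x = 0 := le_antisymm (hneg x trivial hxW) (hF x x.2)
    refine LinearMap.mem_ker.2 (LinearMap.ext fun z => ?_)
    obtain ⟨w, hw, p, ⟨-, hp⟩, hwp⟩ := Submodule.mem_sup.1
      (le_sup_orthogonal hB (le_top : W ≤ ⊤) hW (Submodule.mem_top (x := z)))
    have hpW : ∀ w ∈ W, B p w = 0 := fun w hw => by rw [hB]; exact hp w hw
    -- `x` is isotropic, so `B` is affine on the line through `p` in the direction of `x`
    have key : ∀ t : ℝ, B p p + 2 * t * B x p ≤ 0 := fun t => by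
      have := hneg (p + t • (x : X)) trivial fun w hw => by simp [hpW w hw, hxW w hw]
      simp only [map_add, map_smul, LinearMap.add_apply, LinearMap.smul_apply, smul_eq_mul, h0,
        hB p x] at this
      linarith
    have hxp : B x p = 0 := by
      by_contra hne
      have := key ((1 - B p p) / (2 * B x p))
      field_simp at this
      linarith
    rw [← hwp]
    simp [hxW w hw, hxp]
  have h1 := LinearMap.finrank_range_add_finrank_ker T
  have h2 : finrank ℝ (LinearMap.range T) ≤ n :=
    (Submodule.finrank_le _).trans (by rw [Subspace.dual_finrank_eq, hWn])
  have h3 : finrank ℝ (LinearMap.ker T) ≤ finrank ℝ ↥(F ⊓ LinearMap.ker B) := by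
    rw [(Submodule.equivMapOfInjective _ F.injective_subtype (LinearMap.ker T)).finrank_eq]
    have : FiniteDimensional ℝ ↥(F ⊓ LinearMap.ker B) :=
      Submodule.finiteDimensional_of_le (inf_le_left : F ⊓ LinearMap.ker B ≤ F)
    exact Submodule.finrank_mono hker
  omega

/-- The index on a subspace `S` is that on a larger space `T` in which `S` is dense as far as the
values of the form are concerned. -/
theorem posIndex_eq_of_approx (hB : ∀ x y, B x y = B y x) {S T : Submodule ℝ X} (hST : S ≤ T)
    (h : ∀ z ∈ T, ∃ s : ℕ → X, (∀ n, s n ∈ S) ∧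
      Filter.Tendsto (fun n => B (s n) (s n)) Filter.atTop (𝓝 (B z z)) ∧
      ∀ y ∈ S, Filter.Tendsto (fun n => B (s n) y) Filter.atTop (𝓝 (B z y))) :
    posIndex (fun x => B x x) S = posIndex (fun x => B x x) T := by
  refine le_antisymm (posIndex_mono hST) ?_
  by_cases htop : posIndex (fun x => B x x) S = ⊤
  · rw [htop]; exact le_top
  obtain ⟨n, hn⟩ := ENat.ne_top_iff_exists.1 htop
  obtain ⟨W, hWS, hfd, hWn, hW, hneg⟩ := exists_maximal_posDef hB hn.symm
  rw [← hn, ← hWn]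
  refine posIndex_le_finrank_of_le_sup (le_sup_orthogonal hB (hWS.trans hST) hW) ?_
  rintro z ⟨hzT, hzW⟩
  obtain ⟨m, v, hvW, hsp, hv⟩ := exists_orthonormal_family hB hW
  obtain ⟨s, hsS, hss, hsy⟩ := h z hzT
  -- the projections of `s k` to the orthogonal complement of `W`
  have hle : ∀ k, B (s k) (s k) - ∑ i, B (s k) (v i) ^ 2 ≤ 0 := fun k => by
    have hp : ∑ i, B (s k) (v i) • v i ∈ W := W.sum_mem fun i _ => W.smul_mem _ (hvW i)
    have h1 := hneg (s k - ∑ i, B (s k) (v i) • v i) (S.sub_mem (hsS k) (hWS hp))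
      fun w hw => apply_sub_sum_orthonormal hsp hv _ hw
    have h3 := apply_sub_sum_orthonormal hsp hv (s k) hp
    rw [map_sub] at h1
    rw [h3, map_sub, LinearMap.sub_apply, hB _ (s k)] at h1
    simp only [map_sum, map_smul, LinearMap.sum_apply, LinearMap.smul_apply, smul_eq_mul,
      fun i => hB (v i) (s k)] at h1
    simp only [← sq] at h1
    linarith
  have hlim : Filter.Tendsto (fun k => B (s k) (s k) - ∑ i, B (s k) (v i) ^ 2) Filter.atTop
      (𝓝 (B z z - ∑ i, B z (v i) ^ 2)) :=
    hss.sub (tendsto_finsetSum _ fun i _ => (hsy _ (hWS (hvW i))).pow 2)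
  have h0 : ∀ i, B z (v i) = 0 := fun i => by rw [hB]; exact hzW _ (hvW i)
  have := le_of_tendsto' hlim hle
  simpa [h0] using this

/-- The index of `B` in terms of its restrictions to a subspace `Y` and to the orthogonal
complement `Y'` of `Y`, provided that `Y + Y'` is all of the orthogonal complement of
`R = Y ∩ Y'`: besides the indices of both restrictions it involves the number of dimensions of `R`
outside the radical, each of which spans a hyperbolic plane with a vector transversal to
`Y + Y'`. -/
theorem posIndex_top_add_finrank (hB : ∀ x y, B x y = B y x) {Y R : Submodule ℝ X}
    (hR : R = Y ⊓ LinearMap.BilinForm.orthogonal B Y) [FiniteDimensional ℝ R] {m s : ℕ}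
    (hm : posIndex (fun x => B x x) Y = m)
    (hs : posIndex (fun x => B x x) (LinearMap.BilinForm.orthogonal B Y) = s)
    (h : ∀ x, (∀ r ∈ R, B x r = 0) → ∃ y ∈ Y, ∀ y' ∈ Y, B x y' = B y y') :
    ∃ n : ℕ, posIndex (fun x => B x x) ⊤ = n ∧
      n + finrank ℝ ↥(R ⊓ LinearMap.ker B) = m + s + finrank ℝ R := by
  obtain ⟨W₁, hW₁Y, hfd₁, hWn₁, hW₁, hneg₁⟩ := exists_maximal_posDef hB hm
  obtain ⟨W₂, hW₂Y, hfd₂, hWn₂, hW₂, hneg₂⟩ := exists_maximal_posDef hB hs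
  have horth : ∀ y ∈ Y, ∀ x ∈ LinearMap.BilinForm.orthogonal B Y, B y x = 0 :=
    fun y hy x hx => hx y hy
  have hRY : ∀ r ∈ R, r ∈ Y := fun r hr => by rw [hR] at hr; exact hr.1
  have hRY' : ∀ r ∈ R, r ∈ LinearMap.BilinForm.orthogonal B Y := fun r hr => by
    rw [hR] at hr; exact hr.2
  -- the vectors of `C` are those transversal to `Y + Y'`, the orthogonal complement of `R`
  obtain ⟨C, hC⟩ := Submodule.exists_isCompl (LinearMap.BilinForm.orthogonal B R)
  -- the dimension of `C` is at most the number of dimensions of `R` outside the radical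
  obtain ⟨R', hR'⟩ := Submodule.exists_isCompl ((LinearMap.ker B).submoduleOf R)
  let T : C →ₗ[ℝ] Dual ℝ R' :=
    (LinearMap.domRestrict₁₂ B C R : C →ₗ[ℝ] R →ₗ[ℝ] ℝ).compl₂ R'.subtype
  have hT : ∀ (c : C) (r : R'), T c r = B c r := fun _ _ => rfl
  have hTinj : Function.Injective T := by
    rw [← LinearMap.ker_eq_bot, LinearMap.ker_eq_bot']
    intro c hc
    have h1 : (c : X) ∈ LinearMap.BilinForm.orthogonal B R := fun r hr => by
      obtain ⟨a, ha, b, hb, hab⟩ := Submodule.mem_sup.1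
        (hR'.sup_eq_top ▸ trivial : (⟨r, hr⟩ : R) ∈ (LinearMap.ker B).submoduleOf R ⊔ R')
      have h2 : B c b = 0 := LinearMap.congr_fun hc ⟨b, hb⟩
      have h3 : B a = 0 := ha
      have h4 : r = a + b := (congrArg R.subtype hab).symm
      change B r c = 0
      rw [h4, map_add, LinearMap.add_apply, h3, hB b c, h2]
      simp
    exact Subtype.ext (Submodule.disjoint_def.1 hC.disjoint c h1 c.2)
  have hCfd : FiniteDimensional ℝ C := FiniteDimensional.of_injective T hTinj
  have hCle : finrank ℝ C + finrank ℝ ↥(R ⊓ LinearMap.ker B) ≤ finrank ℝ R := by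
    have h1 := LinearMap.finrank_le_finrank_of_injective hTinj
    rw [Subspace.dual_finrank_eq] at h1
    have h2 := Submodule.finrank_add_eq_of_isCompl hR'
    have h3 : finrank ℝ ↥(R ⊓ LinearMap.ker B) = finrank ℝ ((LinearMap.ker B).submoduleOf R) := by
      rw [(Submodule.equivMapOfInjective _ R.injective_subtype _).finrank_eq,
        Submodule.submoduleOf, Submodule.map_comap_subtype]
    omega
  -- `X` is `W₁ + W₂ + C` plus a subspace on which `B` is nonpositive
  have hupper : posIndex (fun x => B x x) ⊤ ≤ (m + s + finrank ℝ C : ℕ) := by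
    have h1 : (⊤ : Submodule ℝ X) ≤ (W₁ ⊔ W₂ ⊔ C) ⊔
        ((Y ⊓ LinearMap.BilinForm.orthogonal B W₁) ⊔
        (LinearMap.BilinForm.orthogonal B Y ⊓ LinearMap.BilinForm.orthogonal B W₂)) := by
      have e1 := le_sup_orthogonal hB hW₁Y hW₁
      have e2 := le_sup_orthogonal hB hW₂Y hW₂
      have e3 : LinearMap.BilinForm.orthogonal B R ≤ Y ⊔ LinearMap.BilinForm.orthogonal B Y := by
        intro x hx
        obtain ⟨y, hy, hxy⟩ := h x fun r hr => by rw [hB]; exact hx r hr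
        refine Submodule.mem_sup.2 ⟨y, hy, x - y, fun y' hy' => ?_, by abel⟩
        change B y' (x - y) = 0
        rw [hB, map_sub, LinearMap.sub_apply, hxy y' hy', sub_self]
      rw [← hC.sup_eq_top]
      refine sup_le (e3.trans (sup_le (e1.trans (sup_le ?_ ?_)) (e2.trans (sup_le ?_ ?_)))) ?_
      · exact le_sup_of_le_left (le_sup_of_le_left le_sup_left)
      · exact le_sup_of_le_right le_sup_left
      · exact le_sup_of_le_left (le_sup_of_le_left le_sup_right)
      · exact le_sup_of_le_right le_sup_right
      · exact le_sup_of_le_left le_sup_right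
    refine (posIndex_le_finrank_of_le_sup h1 ?_).trans ?_
    · intro x hx
      obtain ⟨y, ⟨hy, hyW⟩, z, ⟨hz, hzW⟩, rfl⟩ := Submodule.mem_sup.1 hx
      have a1 := hneg₁ y hy fun w hw => by rw [hB]; exact hyW w hw
      have a2 := hneg₂ z hz fun w hw => by rw [hB]; exact hzW w hw
      simp only [map_add, LinearMap.add_apply, hB z y, horth y hy z hz]
      linarith
    · have b1 := Submodule.finrank_add_le_finrank_add_finrank W₁ W₂
      have b2 := Submodule.finrank_add_le_finrank_add_finrank (W₁ ⊔ W₂) C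
      exact_mod_cast (by omega : finrank ℝ ↥(W₁ ⊔ W₂ ⊔ C) ≤ m + s + finrank ℝ C)
  obtain ⟨n, hn⟩ := ENat.ne_top_iff_exists.1 (ne_top_of_le_ne_top (ENat.natCast_ne_top _) hupper)
  refine ⟨n, hn.symm, le_antisymm ?_ ?_⟩
  · rw [← hn] at hupper
    have : n ≤ m + s + finrank ℝ C := by exact_mod_cast hupper
    omega
  -- `B` is nonnegative on `W₁ + W₂ + R`, and only vectors of `R` can belong to the radical
  have hval : ∀ a ∈ W₁, ∀ b ∈ W₂, ∀ r ∈ R, B (a + b + r) (a + b + r) = B a a + B b b := by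
    intro a ha b hb r hr
    have e1 : B a b = 0 := horth a (hW₁Y ha) b (hW₂Y hb)
    have e2 : B a r = 0 := horth a (hW₁Y ha) r (hRY' r hr)
    have e3 : B r b = 0 := horth r (hRY r hr) b (hW₂Y hb)
    have e4 : B r r = 0 := horth r (hRY r hr) r (hRY' r hr)
    simp only [map_add, LinearMap.add_apply, hB b a, hB r a, hB b r, e1, e2, e3, e4]
    ring
  have hnn : ∀ W : Submodule ℝ X, (∀ w ∈ W, w ≠ 0 → 0 < B w w) → ∀ w ∈ W, 0 ≤ B w w := by
    intro W hW w hw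
    by_cases h0 : w = 0
    · simp [h0]
    · exact (hW w hw h0).le
  have hzero : ∀ a ∈ W₁, ∀ b ∈ W₂, ∀ r ∈ R, B (a + b + r) (a + b + r) = 0 → a = 0 ∧ b = 0 := by
    intro a ha b hb r hr h0
    rw [hval a ha b hb r hr] at h0
    have h1 := hnn W₁ hW₁ a ha
    have h2 := hnn W₂ hW₂ b hb
    constructor <;> by_contra hne
    · linarith [hW₁ a ha hne]
    · linarith [hW₂ b hb hne]
  have hdim : finrank ℝ ↥(W₁ ⊔ W₂ ⊔ R) = m + s + finrank ℝ R := by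
    have d1 : W₁ ⊓ W₂ = ⊥ := by
      refine (Submodule.eq_bot_iff _).2 fun x hx => ?_
      refine (hzero x hx.1 (-x) (W₂.neg_mem hx.2) 0 R.zero_mem (by simp)).1
    have d2 : (W₁ ⊔ W₂) ⊓ R = ⊥ := by
      refine (Submodule.eq_bot_iff _).2 fun x hx => ?_
      obtain ⟨a, ha, b, hb, hab⟩ := Submodule.mem_sup.1 hx.1
      obtain ⟨h1, h2⟩ := hzero a ha b hb (-x) (R.neg_mem hx.2) (by rw [hab]; simp)
      rw [← hab, h1, h2, add_zero]
    have f1 := Submodule.finrank_sup_add_finrank_inf_eq W₁ W₂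
    have f2 := Submodule.finrank_sup_add_finrank_inf_eq (W₁ ⊔ W₂) R
    rw [d1, finrank_bot] at f1
    rw [d2, finrank_bot] at f2
    omega
  have hrad : (W₁ ⊔ W₂ ⊔ R) ⊓ LinearMap.ker B ≤ R ⊓ LinearMap.ker B := by
    rintro x ⟨hx, hxk⟩
    refine ⟨?_, hxk⟩
    obtain ⟨w, hw, r, hr, rfl⟩ := Submodule.mem_sup.1 hx
    obtain ⟨a, ha, b, hb, rfl⟩ := Submodule.mem_sup.1 hw
    have h0 : B (a + b + r) = 0 := hxk
    obtain ⟨h1, h2⟩ := hzero a ha b hb r hr (by rw [h0]; rfl)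
    rw [h1, h2, add_zero, zero_add]
    exact hr
  have hfin : FiniteDimensional ℝ ↥(R ⊓ LinearMap.ker B) :=
    Submodule.finiteDimensional_of_le (inf_le_left : R ⊓ LinearMap.ker B ≤ R)
  have hfinal := finrank_le_add_finrank_inf_ker hB hn.symm (F := W₁ ⊔ W₂ ⊔ R) (by
    intro x hx
    obtain ⟨w, hw, r, hr, rfl⟩ := Submodule.mem_sup.1 hx
    obtain ⟨a, ha, b, hb, rfl⟩ := Submodule.mem_sup.1 hw
    rw [hval a ha b hb r hr]
    exact add_nonneg (hnn W₁ hW₁ a ha) (hnn W₂ hW₂ b hb))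
  have := Submodule.finrank_mono hrad
  omega

end Inertia

/-! ### Morse indices of two self-adjoint restrictions of an adjoint operator -/

section Abstract

open Module Filter

variable {D H : Type*} [AddCommGroup D] [Module ℝ D] [NormedAddCommGroup H]
  [InnerProductSpace ℝ H] (j A : D →ₗ[ℝ] H)

/-- The negative of the sum of the forms `⟪A x, x⟫` of two restrictions of `A`, on `D₁ × D₂`,
where a vector of `D₁` is paired with one of `D₂` by `⟪A x₁, x₂⟫`. -/
noncomputable def pairForm (D₁ D₂ : Submodule ℝ D) : LinearMap.BilinForm ℝ (D₁ × D₂) :=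
  LinearMap.mk₂ ℝ (fun z w => -(⟪A z.1, j w.1⟫_ℝ + ⟪A z.1, j w.2⟫_ℝ + ⟪j z.2, A w.1⟫_ℝ
      + ⟪A z.2, j w.2⟫_ℝ))
    (fun z z' w => by simp [inner_add_left]; ring)
    (fun r z w => by simp [real_inner_smul_left]; ring)
    (fun z w w' => by simp [inner_add_right]; ring)
    (fun r z w => by simp [real_inner_smul_right]; ring)

variable {j A} {D₀ D₁ D₂ : Submodule ℝ D}

theorem pairForm_apply (z w : D₁ × D₂) : pairForm j A D₁ D₂ z w =
    -(⟪A z.1, j w.1⟫_ℝ + ⟪A z.1, j w.2⟫_ℝ + ⟪j z.2, A w.1⟫_ℝ + ⟪A z.2, j w.2⟫_ℝ) := rfl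

theorem pairForm_symm (h₁ : ∀ x ∈ D₁, ∀ y ∈ D₁, ⟪j x, A y⟫_ℝ = ⟪A x, j y⟫_ℝ)
    (h₂ : ∀ x ∈ D₂, ∀ y ∈ D₂, ⟪j x, A y⟫_ℝ = ⟪A x, j y⟫_ℝ) (z w : D₁ × D₂) :
    pairForm j A D₁ D₂ z w = pairForm j A D₁ D₂ w z := by
  rw [pairForm_apply, pairForm_apply, ← h₁ z.1 z.1.2 w.1 w.1.2, ← h₂ z.2 z.2.2 w.2 w.2.2,
    real_inner_comm (A w.1) (j z.1), real_inner_comm (A w.2) (j z.2),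
    real_inner_comm (A w.1) (j z.2), real_inner_comm (j w.2) (A z.1)]
  ring

variable (j A) in
/-- The Morse index of the restriction of `A` to a subspace of its domain. -/
noncomputable def restrMorse (S : Submodule ℝ D) : ℕ∞ := posIndex (fun x => -⟪A x, j x⟫_ℝ) S

/-- The relation between the Morse indices of the restrictions of `A` to `D₁` and `D₂`. That
elements of `D₂` are approximated by `D₀` in the sense of the form (`hF`) is the property of the
Friedrichs extension; by it `D₁ × D₂` has the same index as `D₁`. -/
theorem restrMorse_add_finrank (h₀₁ : D₀ ≤ D₁) (h₀₂ : D₀ ≤ D₂)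
    (h₁ : ∀ x, x ∈ D₁ ↔ ∀ y ∈ D₁, ⟪j x, A y⟫_ℝ = ⟪A x, j y⟫_ℝ)
    (h₂ : ∀ x, x ∈ D₂ ↔ ∀ y ∈ D₂, ⟪j x, A y⟫_ℝ = ⟪A x, j y⟫_ℝ)
    (hdense : ∀ v : H, (∀ y ∈ D₀, ⟪j y, v⟫_ℝ = 0) → v = 0)
    (hrange : ∀ x, (∀ k ∈ LinearMap.ker A ⊓ D₂, ⟪A x, j k⟫_ℝ = 0) → ∃ y ∈ D₂, A y = A x)
    (hF : ∀ x ∈ D₂, ∃ h : ℕ → D, (∀ n, x - h n ∈ D₀) ∧ Tendsto (fun n => j (h n)) atTop (𝓝 0) ∧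
      Tendsto (fun n => ⟪A (h n), j (h n)⟫_ℝ) atTop (𝓝 0))
    [FiniteDimensional ℝ ↥(LinearMap.ker A ⊓ D₂)] {m s : ℕ} (hm : restrMorse j A D₂ = m)
    (hs : posIndex (fun z : D₁ × D₂ => ⟪j z.1, A z.2⟫_ℝ - ⟪A z.1, j z.2⟫_ℝ)
      (LinearMap.ker (A ∘ₗ D₁.subtype.coprod D₂.subtype)) = s) :
    ∃ n : ℕ, restrMorse j A D₁ = n ∧ n + finrank ℝ ↥(LinearMap.ker A ⊓ (D₁ ⊓ D₂)) =
      m + s + finrank ℝ ↥(LinearMap.ker A ⊓ D₂) := by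
  have s₁ : ∀ x ∈ D₁, ∀ y ∈ D₁, ⟪j x, A y⟫_ℝ = ⟪A x, j y⟫_ℝ := fun x hx => (h₁ x).1 hx
  have s₂ : ∀ x ∈ D₂, ∀ y ∈ D₂, ⟪j x, A y⟫_ℝ = ⟪A x, j y⟫_ℝ := fun x hx => (h₂ x).1 hx
  have hB := pairForm_symm s₁ s₂
  set B := pairForm j A D₁ D₂ with hBdef
  let Y : Submodule ℝ (D₁ × D₂) := LinearMap.range (LinearMap.inr ℝ D₁ D₂)
  -- `B (0, y) z = -⟪y, A (z₁ + z₂)⟫` for `y` in the dense subspace `D₀`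
  have hY' : LinearMap.BilinForm.orthogonal B Y =
      LinearMap.ker (A ∘ₗ D₁.subtype.coprod D₂.subtype) := by
    ext z
    have e : ∀ y : D₂, B (0, y) z = -⟪j y, A (z.1 + z.2)⟫_ℝ := fun y => by
      rw [hBdef, pairForm_apply, ← s₂ y y.2 z.2 z.2.2]
      simp [inner_add_right]
    constructor
    · intro hz
      refine hdense _ fun y hy => ?_
      have : B (0, ⟨y, h₀₂ hy⟩) z = 0 := hz _ ⟨⟨y, h₀₂ hy⟩, rfl⟩
      rw [e] at this
      simpa using this
    · rintro hz _ ⟨y, rfl⟩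
      have hz' : A (z.1 + z.2) = 0 := hz
      change B (0, y) z = 0
      rw [e, hz', inner_zero_right, neg_zero]
  have hYm : posIndex (fun z => B z z) Y = m := by
    rw [← hm]
    refine posIndex_comp (D₂.subtype ∘ₗ LinearMap.snd ℝ D₁ D₂) (by simp) ?_ ?_
    · rintro _ ⟨y, rfl⟩
      simp [hBdef, pairForm_apply]
    · ext x
      constructor
      · rintro ⟨z, -, rfl⟩
        exact z.2.2
      · exact fun hx => ⟨(0, ⟨x, hx⟩), ⟨⟨x, hx⟩, rfl⟩, rfl⟩
  have hY's : posIndex (fun z => B z z) (LinearMap.BilinForm.orthogonal B Y) = s := by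
    rw [← hs, hY']
    refine posIndex_congr fun z hz => ?_
    have h0 : A z.1 + A z.2 = 0 := by
      rw [← map_add]; exact hz
    have h1 : A z.1 = -A z.2 := eq_neg_of_add_eq_zero_left h0
    rw [hBdef, pairForm_apply, h1]
    simp only [inner_neg_left, inner_neg_right]
    rw [real_inner_comm (j z.1) (A z.2), real_inner_comm (A z.2) (j z.2)]
    ring
  -- `(x, y)` is approximated by `(x + (y - hₙ), 0)`, where `y - hₙ ∈ D₀`
  have hSt : posIndex (fun z => B z z) (LinearMap.range (LinearMap.inl ℝ D₁ D₂)) =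
      posIndex (fun z => B z z) ⊤ := by
    refine posIndex_eq_of_approx hB le_top fun z _ => ?_
    obtain ⟨h, hh0, hh1, hh2⟩ := hF z.2 z.2.2
    have hl₁ : ∀ n, (z.2 : D) - h n ∈ D₁ := fun n => h₀₁ (hh0 n)
    have hh₂ : ∀ n, h n ∈ D₂ := fun n => by
      have := D₂.sub_mem z.2.2 (h₀₂ (hh0 n))
      rwa [sub_sub_cancel] at this
    have lim : ∀ v : H, Tendsto (fun n => ⟪j (h n), v⟫_ℝ) atTop (𝓝 0) := fun v => by
      have := hh1.inner (𝕜 := ℝ) (tendsto_const_nhds (x := v))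
      simpa using this
    have lim' : ∀ v : H, Tendsto (fun n => ⟪v, j (h n)⟫_ℝ) atTop (𝓝 0) := fun v => by
      simpa only [real_inner_comm v] using lim v
    refine ⟨fun n => (z.1 + ⟨z.2 - h n, hl₁ n⟩, 0), fun n => ⟨_, rfl⟩, ?_, ?_⟩
    · have e : ∀ n, B (z.1 + ⟨z.2 - h n, hl₁ n⟩, 0) (z.1 + ⟨z.2 - h n, hl₁ n⟩, 0) =
          B z z + 2 * ⟪A z.1, j (h n)⟫_ℝ + 2 * ⟪A z.2, j (h n)⟫_ℝ - ⟪A (h n), j (h n)⟫_ℝ := by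
        intro n
        have e1 := s₁ _ (hl₁ n) z.1 z.1.2
        have e2 := s₂ _ (hh₂ n) z.2 z.2.2
        simp only [hBdef, pairForm_apply]
        simp only [map_add, map_sub, inner_add_left, inner_add_right, inner_sub_left,
          inner_sub_right, Submodule.coe_add, Submodule.coe_zero, map_zero, inner_zero_left,
          inner_zero_right] at e1 e2 ⊢
        rw [real_inner_comm (A z.1) (j (h n))] at e1
        rw [real_inner_comm (A z.2) (j (h n))] at e2
        rw [real_inner_comm (A z.1) (j z.2)] at e1 ⊢
        linarith
      simp only [e]
      have := (((lim' (A z.1)).const_mul 2).const_add (B z z)).add ((lim' (A z.2)).const_mul 2)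
      simpa using this.sub hh2
    · rintro _ ⟨y, rfl⟩
      have e : ∀ n, B (z.1 + ⟨z.2 - h n, hl₁ n⟩, 0) (LinearMap.inl ℝ D₁ D₂ y) =
          B z (LinearMap.inl ℝ D₁ D₂ y) + ⟪j (h n), A y⟫_ℝ := by
        intro n
        have e1 := s₁ _ (hl₁ n) y y.2
        simp only [hBdef, pairForm_apply, LinearMap.inl_apply]
        simp only [map_add, map_sub, inner_add_left, inner_sub_left, Submodule.coe_add,
          Submodule.coe_zero, map_zero, inner_zero_left, inner_zero_right] at e1 ⊢
        linarith
      simp only [e]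
      simpa using (lim (A y)).const_add (B z (LinearMap.inl ℝ D₁ D₂ y))
  have hS₁ : posIndex (fun z => B z z) (LinearMap.range (LinearMap.inl ℝ D₁ D₂)) =
      restrMorse j A D₁ := by
    refine posIndex_comp (D₁.subtype ∘ₗ LinearMap.fst ℝ D₁ D₂) (by simp) ?_ ?_
    · rintro _ ⟨y, rfl⟩
      simp [hBdef, pairForm_apply]
    · ext x
      constructor
      · rintro ⟨z, -, rfl⟩
        exact z.1.2
      · exact fun hx => ⟨(⟨x, hx⟩, 0), ⟨⟨x, hx⟩, rfl⟩, rfl⟩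
  -- the intersection of `Y` with its complement, and its intersection with the radical
  have hinr : Function.Injective (LinearMap.inr ℝ D₁ D₂) := LinearMap.inr_injective
  let R : Submodule ℝ (D₁ × D₂) :=
    ((LinearMap.ker A).comap D₂.subtype).map (LinearMap.inr ℝ D₁ D₂)
  have hR : R = Y ⊓ LinearMap.BilinForm.orthogonal B Y := by
    rw [hY']
    ext z
    constructor
    · rintro ⟨y, hy, rfl⟩
      refine ⟨⟨y, rfl⟩, ?_⟩
      have : A y = 0 := hy
      simp [this]
    · rintro ⟨⟨y, rfl⟩, hy⟩
      refine ⟨y, ?_, rfl⟩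
      simpa using hy
  have fin : ∀ T : Submodule ℝ D, T ≤ D₂ →
      finrank ℝ ((T.comap D₂.subtype).map (LinearMap.inr ℝ D₁ D₂)) = finrank ℝ T := by
    intro T hT
    rw [← (Submodule.equivMapOfInjective _ hinr _).finrank_eq,
      (Submodule.equivMapOfInjective _ D₂.injective_subtype _).finrank_eq,
      Submodule.map_comap_subtype, inf_eq_right.2 hT]
  have hRd : finrank ℝ R = finrank ℝ ↥(LinearMap.ker A ⊓ D₂) := by
    rw [← fin _ inf_le_right, Submodule.comap_inf, Submodule.comap_subtype_self, inf_top_eq]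
  have hRfd : FiniteDimensional ℝ R := by
    have : FiniteDimensional ℝ ((LinearMap.ker A).comap D₂.subtype) := by
      refine Module.Finite.of_injective
        (LinearMap.restrict D₂.subtype (q := LinearMap.ker A ⊓ D₂) fun x hx => ⟨hx, x.2⟩) ?_
      intro x y hxy
      have h := congrArg Subtype.val hxy
      exact Subtype.ext (Subtype.ext h)
    infer_instance
  have hRk : R ⊓ LinearMap.ker B =
      ((LinearMap.ker A ⊓ (D₁ ⊓ D₂)).comap D₂.subtype).map (LinearMap.inr ℝ D₁ D₂) := by
    ext z
    constructor
    · rintro ⟨⟨y, hy, rfl⟩, hz⟩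
      have hy' : A y = 0 := hy
      refine ⟨y, ⟨hy, ?_, y.2⟩, rfl⟩
      refine (h₁ _).2 fun x hx => ?_
      have := LinearMap.congr_fun (show B (LinearMap.inr ℝ D₁ D₂ y) = 0 from hz) (⟨x, hx⟩, 0)
      simp [hBdef, pairForm_apply] at this
      change ⟪j y, A x⟫_ℝ = ⟪A y, j x⟫_ℝ
      rw [this, hy', inner_zero_left]
    · rintro ⟨y, ⟨hy, hy1, -⟩, rfl⟩
      have hy' : A y = 0 := hy
      refine ⟨⟨y, hy, rfl⟩, LinearMap.mem_ker.2 (LinearMap.ext fun w => ?_)⟩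
      have := s₁ y hy1 w.1 w.1.2
      simp [hBdef, pairForm_apply, hy'] at this ⊢
      exact this
  obtain ⟨n, hn, hsum⟩ := posIndex_top_add_finrank hB hR hYm hY's (by
    intro x hx
    obtain ⟨y, hy, hyx⟩ := hrange (x.1 + x.2) (by
      rintro k ⟨hk, hk2⟩
      have := hx (0, ⟨k, hk2⟩) ⟨⟨k, hk2⟩, hk, rfl⟩
      simp only [hBdef, pairForm_apply] at this
      simp only [Submodule.coe_zero, map_zero, inner_zero_right] at this
      rw [map_add, inner_add_left]
      linarith)
    refine ⟨(0, ⟨y, hy⟩), ⟨⟨y, hy⟩, rfl⟩, ?_⟩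
    rintro _ ⟨y', rfl⟩
    simp only [hBdef, pairForm_apply, LinearMap.inr_apply]
    simp only [Submodule.coe_zero, map_zero, inner_zero_right, inner_zero_left, hyx, map_add,
      inner_add_left]
    ring)
  refine ⟨n, ?_, ?_⟩
  · rw [← hS₁, hSt, hn]
  · rw [hRk, fin _ (inf_le_right.trans inf_le_right), hRd] at hsum
    exact hsum

variable {U : Submodule ℝ D} (hU : IsCompl D₀ U) {Ω : LinearMap.BilinForm ℝ D}

theorem sub_projectionOnto_mem (x : D) : x - (U.projectionOnto D₀ hU.symm x : D) ∈ D₀ := by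
  rw [← Submodule.projectionOnto_apply_eq_zero_iff hU.symm, map_sub,
    Submodule.projectionOnto_apply_left, sub_self]

theorem apply_eq_apply_projectionOnto (hΩ₀ : ∀ x ∈ D₀, ∀ y, Ω x y = 0)
    (hanti : ∀ x y, Ω x y = -Ω y x) (x y : D) :
    Ω x y = Ω (U.projectionOnto D₀ hU.symm x) (U.projectionOnto D₀ hU.symm y) := by
  have h1 := hΩ₀ _ (sub_projectionOnto_mem hU x) y
  have h2 := hΩ₀ _ (sub_projectionOnto_mem hU y) (U.projectionOnto D₀ hU.symm x)
  rw [map_sub, LinearMap.sub_apply] at h1 h2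
  rw [hanti _ (U.projectionOnto D₀ hU.symm y : D)]
  rw [hanti y] at h2
  linarith

theorem comap_projectionOnto (Λ : Submodule ℝ U) :
    Λ.comap (U.projectionOnto D₀ hU.symm) = D₀ ⊔ Λ.map U.subtype := by
  ext x
  rw [Submodule.mem_comap]
  constructor
  · intro hx
    exact Submodule.mem_sup.2 ⟨_, sub_projectionOnto_mem hU x, _, ⟨_, hx, rfl⟩, by simp⟩
  · intro hx
    obtain ⟨y, hy, _, ⟨u, hu, rfl⟩, rfl⟩ := Submodule.mem_sup.1 hx
    rw [map_add, (Submodule.projectionOnto_apply_eq_zero_iff hU.symm).2 hy, zero_add]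
    erw [Submodule.projectionOnto_apply_left]
    exact hu

theorem mem_comap_iff_of_isLagrangian (hΩ₀ : ∀ x ∈ D₀, ∀ y, Ω x y = 0)
    (hanti : ∀ x y, Ω x y = -Ω y x) {Λ : Submodule ℝ U} (hΛ : IsLagrangian (Ω.restrict U) Λ)
    (x : D) : x ∈ Λ.comap (U.projectionOnto D₀ hU.symm) ↔
      ∀ y ∈ Λ.comap (U.projectionOnto D₀ hU.symm), Ω x y = 0 := by
  rw [Submodule.mem_comap, hΛ]
  constructor
  · intro h y hy
    rw [apply_eq_apply_projectionOnto hU hΩ₀ hanti]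
    exact h _ hy
  · intro h u hu
    have := h u (by rw [Submodule.mem_comap, Submodule.projectionOnto_apply_left]; exact hu)
    rw [apply_eq_apply_projectionOnto hU hΩ₀ hanti, Submodule.projectionOnto_apply_left] at this
    exact this

/-- The pair form on the pairs with sum in the kernel of `A` is the form of the triple index. -/
theorem posIndex_tripleForm (hΩ : ∀ x y, Ω x y = ⟪j x, A y⟫_ℝ - ⟪A x, j y⟫_ℝ)
    (hΩ₀ : ∀ x ∈ D₀, ∀ y, Ω x y = 0) {Λ Γ : Submodule ℝ U}
    (hΛ : IsLagrangian (Ω.restrict U) Λ) (hΓ : IsLagrangian (Ω.restrict U) Γ) :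
    posIndex (fun z : Λ.comap (U.projectionOnto D₀ hU.symm) ×
          Γ.comap (U.projectionOnto D₀ hU.symm) => ⟪j z.1, A z.2⟫_ℝ - ⟪A z.1, j z.2⟫_ℝ)
        (LinearMap.ker (A ∘ₗ (Submodule.subtype _).coprod (Submodule.subtype _))) =
      posIndex (tripleForm (Ω.restrict U) Λ Γ)
        ((LinearMap.ker A).map (U.projectionOnto D₀ hU.symm) ⊓ (Λ ⊔ Γ)) := by
  set p := U.projectionOnto D₀ hU.symm with hp
  have hanti : ∀ x y, Ω x y = -Ω y x := fun x y => by
    rw [hΩ, hΩ, real_inner_comm, real_inner_comm (A x)]; ring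
  refine posIndex_comp (p ∘ₗ (Submodule.subtype _).coprod (Submodule.subtype _)) ?_ ?_ ?_
  · unfold tripleForm
    split_ifs <;> simp
  · rintro z -
    change _ = tripleForm (Ω.restrict U) Λ Γ (p (z.1 + z.2))
    have hz1 : p z.1 ∈ Λ := z.1.2
    have hz2 : p z.2 ∈ Γ := z.2.2
    have hex : ∃ v ∈ Λ, p (z.1 + z.2) + v ∈ Γ :=
      ⟨-p z.1, Λ.neg_mem hz1, by rw [map_add]; simpa using hz2⟩
    rw [tripleForm, dif_pos hex]
    obtain ⟨hv, hv'⟩ := hex.choose_spec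
    set v := hex.choose
    -- two choices of `v` differ by an element of `Λ ∩ Γ`
    have hd1 : v + p z.1 ∈ Λ := Λ.add_mem hv hz1
    have hd2 : v + p z.1 ∈ Γ := by
      have := Γ.sub_mem hv' hz2
      rw [map_add] at this
      convert this using 1
      abel
    have e1 := (hΛ (p z.1)).1 hz1 _ hd1
    have e2 := (hΓ (p z.2)).1 hz2 _ hd2
    have e3 := (hΛ (p z.1)).1 hz1 _ hz1
    have e4 := apply_eq_apply_projectionOnto hU hΩ₀ hanti z.1 z.2
    have e5 := hanti (p z.1) (p z.2)
    rw [← hp] at e4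
    change Ω (p z.1) (v + p z.1 : U) = 0 at e1
    change Ω (p z.2) (v + p z.1 : U) = 0 at e2
    change Ω (p z.1) (p z.1) = 0 at e3
    change _ = Ω (p (z.1 + z.2)) v
    rw [← hΩ, e4, map_add, Submodule.coe_add, map_add, LinearMap.add_apply]
    rw [Submodule.coe_add, map_add] at e1 e2
    linarith
  · ext u
    constructor
    · rintro ⟨z, hz, rfl⟩
      refine ⟨⟨z.1 + z.2, hz, rfl⟩, ?_⟩
      change p (z.1 + z.2) ∈ _
      rw [map_add]
      exact Submodule.add_mem_sup z.1.2 z.2.2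
    · rintro ⟨⟨k, hk, rfl⟩, hu⟩
      obtain ⟨a, ha, g, hg, hag⟩ := Submodule.mem_sup.1 hu
      have hg' : (g : D) ∈ Γ.comap p := by
        rw [Submodule.mem_comap, hp, Submodule.projectionOnto_apply_left]; exact hg
      have hkg : k - g ∈ Λ.comap p := by
        rw [Submodule.mem_comap, map_sub, ← hag, hp, Submodule.projectionOnto_apply_left]
        simpa using ha
      refine ⟨(⟨k - g, hkg⟩, ⟨g, hg'⟩), ?_, ?_⟩
      · change A (k - g + g) = 0
        rw [sub_add_cancel]; exact hk
      · change p (k - g + g) = p k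
        rw [sub_add_cancel]

theorem finrank_ker_inf_comap [FiniteDimensional ℝ (LinearMap.ker A)] (Θ : Submodule ℝ U) :
    finrank ℝ ↥(LinearMap.ker A ⊓ Θ.comap (U.projectionOnto D₀ hU.symm)) =
      finrank ℝ ↥(LinearMap.ker A ⊓ D₀) +
        finrank ℝ ↥((LinearMap.ker A).map (U.projectionOnto D₀ hU.symm) ⊓ Θ) := by
  have hfd : FiniteDimensional ℝ
      ↥(LinearMap.ker A ⊓ Θ.comap (U.projectionOnto D₀ hU.symm)) :=
    Submodule.finiteDimensional_of_le inf_le_left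
  rw [finrank_le_finrank_inf_add_map (U.projectionOnto D₀ hU.symm)
    (Submodule.ker_projectionOnto hU.symm)]
  have h1 : D₀ ≤ Θ.comap (U.projectionOnto D₀ hU.symm) := by
    rw [comap_projectionOnto hU]; exact le_sup_left
  have h2 : (LinearMap.ker A ⊓ Θ.comap (U.projectionOnto D₀ hU.symm)).map
      (U.projectionOnto D₀ hU.symm) = (LinearMap.ker A).map (U.projectionOnto D₀ hU.symm) ⊓ Θ := by
    ext u
    constructor
    · rintro ⟨x, ⟨hx, hx'⟩, rfl⟩
      exact ⟨⟨x, hx, rfl⟩, hx'⟩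
    · rintro ⟨⟨x, hx, rfl⟩, hx'⟩
      exact ⟨x, ⟨hx, hx'⟩, rfl⟩
  rw [h2, inf_assoc, inf_eq_right.2 h1]

/-- The index formula in abstract form: `Γ` is a Lagrangian subspace whose restriction has the
approximation property `hF` of the Friedrichs extension. -/
theorem restrMorse_sub_eq_tripleIndex [FiniteDimensional ℝ U]
    [FiniteDimensional ℝ (LinearMap.ker A)]
    (hΩ : ∀ x y, Ω x y = ⟪j x, A y⟫_ℝ - ⟪A x, j y⟫_ℝ)
    (hΩ₀ : ∀ x ∈ D₀, ∀ y, Ω x y = 0) {Λ Γ : Submodule ℝ U}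
    (hΛ : IsLagrangian (Ω.restrict U) Λ) (hΓ : IsLagrangian (Ω.restrict U) Γ)
    (hdense : ∀ v : H, (∀ y ∈ D₀, ⟪j y, v⟫_ℝ = 0) → v = 0)
    (hrange : ∀ x, (∀ k ∈ LinearMap.ker A ⊓ (D₀ ⊔ Γ.map U.subtype), ⟪A x, j k⟫_ℝ = 0) →
      ∃ y ∈ D₀ ⊔ Γ.map U.subtype, A y = A x)
    (hF : ∀ x ∈ D₀ ⊔ Γ.map U.subtype, ∃ h : ℕ → D, (∀ n, x - h n ∈ D₀) ∧
      Tendsto (fun n => j (h n)) atTop (𝓝 0) ∧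
      Tendsto (fun n => ⟪A (h n), j (h n)⟫_ℝ) atTop (𝓝 0)) :
    (restrMorse j A (D₀ ⊔ Λ.map U.subtype) = ⊤ ↔ restrMorse j A (D₀ ⊔ Γ.map U.subtype) = ⊤) ∧
    (restrMorse j A (D₀ ⊔ Γ.map U.subtype) ≠ ⊤ →
      ((restrMorse j A (D₀ ⊔ Λ.map U.subtype)).toNat : ℤ)
          - ((restrMorse j A (D₀ ⊔ Γ.map U.subtype)).toNat : ℤ)
        = tripleIndex (Ω.restrict U) ((LinearMap.ker A).map (U.projectionOnto D₀ hU.symm))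
            Λ Γ) := by
  have hanti : ∀ x y, Ω x y = -Ω y x := fun x y => by
    rw [hΩ, hΩ, real_inner_comm, real_inner_comm (A x)]; ring
  have hle : ∀ Θ Θ' : Submodule ℝ U, restrMorse j A (D₀ ⊔ Θ.map U.subtype) ≠ ⊤ →
      restrMorse j A (D₀ ⊔ Θ'.map U.subtype) ≠ ⊤ := by
    intro Θ Θ' h
    -- both subspaces exceed `D₀` by finitely many dimensions
    have h0 : restrMorse j A D₀ ≠ ⊤ := ne_top_of_le_ne_top h (posIndex_mono le_sup_left)
    refine ne_top_of_le_ne_top ?_ (posIndex_le_add_finrank le_rfl)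
    exact WithTop.add_ne_top.2 ⟨h0, ENat.natCast_ne_top _⟩
  refine ⟨not_iff_not.1 ⟨hle _ _, hle _ _⟩, fun htop => ?_⟩
  obtain ⟨m, hm⟩ := ENat.ne_top_iff_exists.1 htop
  have hsub : ∀ x y, Ω x y = 0 ↔ ⟪j x, A y⟫_ℝ = ⟪A x, j y⟫_ℝ := fun x y => by
    rw [hΩ, sub_eq_zero]
  obtain ⟨s, hs⟩ : ∃ s : ℕ, posIndex (tripleForm (Ω.restrict U) Λ Γ)
      ((LinearMap.ker A).map (U.projectionOnto D₀ hU.symm) ⊓ (Λ ⊔ Γ)) = s := by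
    have : posIndex (tripleForm (Ω.restrict U) Λ Γ)
        ((LinearMap.ker A).map (U.projectionOnto D₀ hU.symm) ⊓ (Λ ⊔ Γ)) ≤ finrank ℝ U :=
      posIndex_le_of_forall fun W _ _ _ => by exact_mod_cast Submodule.finrank_le W
    obtain ⟨s, hs⟩ := ENat.ne_top_iff_exists.1 (ne_top_of_le_ne_top (ENat.natCast_ne_top _) this)
    exact ⟨s, hs.symm⟩
  simp only [← comap_projectionOnto hU] at hrange hF hm ⊢
  have hD₀ : ∀ Θ : Submodule ℝ U, D₀ ≤ Θ.comap (U.projectionOnto D₀ hU.symm) := fun Θ => by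
    rw [comap_projectionOnto hU]; exact le_sup_left
  have hfd : FiniteDimensional ℝ
      ↥(LinearMap.ker A ⊓ Γ.comap (U.projectionOnto D₀ hU.symm)) :=
    Submodule.finiteDimensional_of_le inf_le_left
  obtain ⟨n, hn, hsum⟩ := restrMorse_add_finrank (hD₀ Λ) (hD₀ Γ)
    (by simpa only [hsub] using mem_comap_iff_of_isLagrangian hU hΩ₀ hanti hΛ)
    (by simpa only [hsub] using mem_comap_iff_of_isLagrangian hU hΩ₀ hanti hΓ)
    hdense hrange hF hm.symm
    ((posIndex_tripleForm hU hΩ hΩ₀ hΛ hΓ).trans hs)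
  rw [← Submodule.comap_inf, finrank_ker_inf_comap hU,
    finrank_ker_inf_comap hU] at hsum
  rw [tripleIndex, hs, hn, ← hm, inf_assoc]
  simp only [ENat.toNat_natCast]
  omega

end Abstract

/-! ### Edges and integration on them -/

namespace MetricGraph

open Filter

variable {V E : Type*} (G : MetricGraph V E)

theorem edge_cases (e : E) :
    (∃ a b : ℝ, a < b ∧ G.lo e = a ∧ G.hi e = b) ∨ (∃ a : ℝ, G.lo e = a ∧ G.hi e = ⊤) ∨
      ∃ b : ℝ, G.lo e = ⊥ ∧ G.hi e = b := by
  have h1 := G.lo_lt_hi e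
  have h2 := G.ne_line e
  generalize G.lo e = x at *
  generalize G.hi e = y at *
  induction x <;> induction y <;> simp_all

theorem edge_eq_Icc {e : E} {a b : ℝ} (ha : G.lo e = a) (hb : G.hi e = b) :
    G.edge e = Icc a b := by
  ext t; simp [edge, ha, hb]

theorem edge_eq_Ici {e : E} {a : ℝ} (ha : G.lo e = a) (hb : G.hi e = ⊤) :
    G.edge e = Ici a := by
  ext t; simp [edge, ha, hb]

theorem edge_eq_Iic {e : E} {b : ℝ} (ha : G.lo e = ⊥) (hb : G.hi e = b) :
    G.edge e = Iic b := by
  ext t; simp [edge, ha, hb]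

theorem openEdge_eq_Ioo {e : E} {a b : ℝ} (ha : G.lo e = a) (hb : G.hi e = b) :
    G.openEdge e = Ioo a b := by
  ext t; simp [openEdge, ha, hb]

theorem openEdge_eq_Ioi {e : E} {a : ℝ} (ha : G.lo e = a) (hb : G.hi e = ⊤) :
    G.openEdge e = Ioi a := by
  ext t; simp [openEdge, ha, hb]

theorem openEdge_eq_Iio {e : E} {b : ℝ} (ha : G.lo e = ⊥) (hb : G.hi e = b) :
    G.openEdge e = Iio b := by
  ext t; simp [openEdge, ha, hb]

theorem isClosed_edge (e : E) : IsClosed (G.edge e) :=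
  (isClosed_le continuous_const continuous_coe_real_ereal).inter
    (isClosed_le continuous_coe_real_ereal continuous_const)

theorem measurableSet_edge (e : E) : MeasurableSet (G.edge e) := (G.isClosed_edge e).measurableSet

theorem edge_subset_closure_interior (e : E) : G.edge e ⊆ closure (interior (G.edge e)) := by
  rcases G.edge_cases e with ⟨a, b, hab, ha, hb⟩ | ⟨a, ha, hb⟩ | ⟨b, ha, hb⟩
  · rw [G.edge_eq_Icc ha hb, interior_Icc, closure_Ioo hab.ne]
  · rw [G.edge_eq_Ici ha hb, interior_Ici, closure_Ioi]
  · rw [G.edge_eq_Iic ha hb, interior_Iic, closure_Iio]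

theorem uniqueDiffOn_edge (e : E) : UniqueDiffOn ℝ (G.edge e) := by
  rcases G.edge_cases e with ⟨a, b, hab, ha, hb⟩ | ⟨a, ha, hb⟩ | ⟨b, ha, hb⟩
  · rw [G.edge_eq_Icc ha hb]; exact uniqueDiffOn_Icc hab
  · rw [G.edge_eq_Ici ha hb]; exact uniqueDiffOn_Ici a
  · rw [G.edge_eq_Iic ha hb]; exact uniqueDiffOn_Iic b

theorem ae_mem_openEdge (e : E) : ∀ᵐ t ∂volume.restrict (G.edge e), t ∈ G.openEdge e := by
  rw [ae_restrict_iff' (G.measurableSet_edge e)]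
  rcases G.edge_cases e with ⟨a, b, hab, ha, hb⟩ | ⟨a, ha, hb⟩ | ⟨b, ha, hb⟩
  · rw [G.edge_eq_Icc ha hb, G.openEdge_eq_Ioo ha hb]
    filter_upwards [(Ioo_ae_eq_Icc (a := a) (b := b) (μ := volume)).mem_iff] with t ht
    exact ht.2
  · rw [G.edge_eq_Ici ha hb, G.openEdge_eq_Ioi ha hb]
    filter_upwards [(Ioi_ae_eq_Ici (a := a) (μ := volume)).mem_iff] with t ht
    exact ht.2
  · rw [G.edge_eq_Iic ha hb, G.openEdge_eq_Iio ha hb]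
    filter_upwards [(Iio_ae_eq_Iic (a := b) (μ := volume)).mem_iff] with t ht
    exact ht.2

theorem edge_mem_nhds {e : E} {t : ℝ} (ht : t ∈ G.openEdge e) : G.edge e ∈ 𝓝 t :=
  mem_of_superset ((G.isOpen_openEdge e).mem_nhds ht) (G.openEdge_subset e)

theorem memLp_of_continuousOn {F : Type*} [NormedAddCommGroup F] {e : E} {f : ℝ → F}
    (hf : ContinuousOn f (G.edge e)) (hc : HasCompactSupport f) (p : ENNReal) :
    MemLp f p (volume.restrict (G.edge e)) := by
  have hK : IsCompact (G.edge e ∩ tsupport f) := hc.isCompact.inter_left (G.isClosed_edge e)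
  have hf' : ContinuousOn f (G.edge e ∩ tsupport f) := hf.mono inter_subset_left
  obtain ⟨C, hC⟩ := hK.exists_bound_of_continuousOn hf'
  have hfin : IsFiniteMeasure (volume.restrict (G.edge e ∩ tsupport f)) :=
    ⟨by simpa using hK.measure_lt_top⟩
  have h1 : MemLp f p (volume.restrict (G.edge e ∩ tsupport f)) :=
    MemLp.of_bound (hf'.aestronglyMeasurable hK.measurableSet) C
      ((ae_restrict_iff' hK.measurableSet).2 (ae_of_all _ hC))
  have hm : MeasurableSet (tsupport f) := (isClosed_tsupport f).measurableSet
  rw [inter_comm, ← Measure.restrict_restrict hm] at h1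
  have h2 := (memLp_indicator_iff_restrict hm).2 h1
  rwa [indicator_eq_self.2 (subset_tsupport f)] at h2

theorem integrable_of_continuousOn {F : Type*} [NormedAddCommGroup F] {e : E} {f : ℝ → F}
    (hf : ContinuousOn f (G.edge e)) (hc : HasCompactSupport f) :
    IntegrableOn f (G.edge e) :=
  memLp_one_iff_integrable.1 (G.memLp_of_continuousOn hf hc 1)

/-- The fundamental theorem of calculus for functions of compact support on an edge, which may
end at infinity. -/
theorem integral_edge_eq_sub {e : E} {f W : ℝ → ℝ} (hf : IntegrableOn f (G.edge e))
    (hW : ContinuousOn W (G.edge e)) (hc : HasCompactSupport W)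
    (hd : ∀ t ∈ G.openEdge e, HasDerivAt W (f t) t) :
    ∫ t in G.edge e, f t = (if G.hi e = ⊤ then 0 else W (G.hi e).toReal) -
      (if G.lo e = ⊥ then 0 else W (G.lo e).toReal) := by
  rcases G.edge_cases e with ⟨a, b, hab, ha, hb⟩ | ⟨a, ha, hb⟩ | ⟨b, ha, hb⟩
  · rw [G.edge_eq_Icc ha hb] at *
    rw [G.openEdge_eq_Ioo ha hb] at hd
    rw [integral_Icc_eq_integral_Ioc, ← intervalIntegral.integral_of_le hab.le,
      intervalIntegral.integral_eq_sub_of_hasDerivAt_of_le hab.le hW hd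
        ((intervalIntegrable_iff_integrableOn_Icc_of_le hab.le).2 hf)]
    simp [ha, hb]
  · rw [G.edge_eq_Ici ha hb] at *
    rw [G.openEdge_eq_Ioi ha hb] at hd
    rw [integral_Ici_eq_integral_Ioi, integral_Ioi_of_hasDerivAt_of_tendsto
      (hW a self_mem_Ici) hd (hf.mono_set Ioi_subset_Ici_self)
      (m := 0)]
    · simp [ha, hb]
    · exact (hc.is_zero_at_infty).mono_left atTop_le_cocompact
  · rw [G.edge_eq_Iic ha hb] at *
    rw [G.openEdge_eq_Iio ha hb] at hd
    rw [integral_Iic_of_hasDerivAt_of_tendsto (hW b self_mem_Iic) hd hf (m := 0)]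
    · simp [ha, hb]
    · exact (hc.is_zero_at_infty).mono_left atBot_le_cocompact

end MetricGraph

/-! ### The differential expression in expanded form -/

namespace SLCoeff

variable {V E : Type*} {G : MetricGraph V E} {d : ℕ} (c : SLCoeff G d)

/-- The coefficient `-P' - Q + Qᵀ` of `x'` in `ℓ x`. At the endpoints of the edge one-sided
derivatives are used, which makes it continuous on the closed edge. -/
noncomputable def coeffOne (e : E) (t : ℝ) :
    EuclideanSpace ℝ (Fin d) →L[ℝ] EuclideanSpace ℝ (Fin d) :=
  -derivWithin (c.P e) (G.edge e) t - c.Q e t + ContinuousLinearMap.adjoint (c.Q e t)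

/-- The coefficient `-Q' + R` of `x` in `ℓ x`. -/
noncomputable def coeffZero (e : E) (t : ℝ) :
    EuclideanSpace ℝ (Fin d) →L[ℝ] EuclideanSpace ℝ (Fin d) :=
  -derivWithin (c.Q e) (G.edge e) t + c.R e t

/-- The differential expression `ℓ x = -P x'' + (-P' - Q + Qᵀ) x' + (-Q' + R) x` of a function on
the edge `e`. -/
noncomputable def expandedExpr (e : E) (x : ℝ → EuclideanSpace ℝ (Fin d)) (t : ℝ) :
    EuclideanSpace ℝ (Fin d) :=
  -c.P e t (deriv (deriv x) t) + c.coeffOne e t (deriv x t) + c.coeffZero e t (x t)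

theorem continuousOn_coeffOne (e : E) : ContinuousOn (c.coeffOne e) (G.edge e) :=
  (((c.contDiffOn_P e).continuousOn_derivWithin (G.uniqueDiffOn_edge e) le_rfl).neg.sub
    (c.contDiffOn_Q e).continuousOn).add
    ((ContinuousLinearMap.adjoint (𝕜 := ℝ)).continuous.comp_continuousOn
      (c.contDiffOn_Q e).continuousOn)

theorem continuousOn_coeffZero (e : E) : ContinuousOn (c.coeffZero e) (G.edge e) :=
  ((c.contDiffOn_Q e).continuousOn_derivWithin (G.uniqueDiffOn_edge e) le_rfl).neg.add
    (c.continuousOn_R e)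

theorem _root_.ContDiff.deriv_infty {F : Type*} [NormedAddCommGroup F] [NormedSpace ℝ F]
    {x : ℝ → F} (hx : ContDiff ℝ ∞ x) : ContDiff ℝ ∞ (deriv x) :=
  (contDiff_infty_iff_deriv.1 hx).2

theorem _root_.ContDiff.hasDerivAt_infty {F : Type*} [NormedAddCommGroup F] [NormedSpace ℝ F]
    {x : ℝ → F} (hx : ContDiff ℝ ∞ x) (t : ℝ) : HasDerivAt x (deriv x t) t :=
  ((contDiff_infty_iff_deriv.1 hx).1 t).hasDerivAt

section

variable {e : E} {x y : ℝ → EuclideanSpace ℝ (Fin d)}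

theorem continuousOn_expandedExpr (hx : ContDiff ℝ ∞ x) :
    ContinuousOn (c.expandedExpr e x) (G.edge e) :=
  (((c.contDiffOn_P e).continuousOn.clm_apply
    hx.deriv_infty.deriv_infty.continuous.continuousOn).neg.add
    ((c.continuousOn_coeffOne e).clm_apply hx.deriv_infty.continuous.continuousOn)).add
    ((c.continuousOn_coeffZero e).clm_apply hx.continuous.continuousOn)

theorem hasCompactSupport_expandedExpr (hx : HasCompactSupport x) :
    HasCompactSupport (c.expandedExpr e x) := by
  refine hx.mono' fun t ht => ?_
  by_contra hcon
  have h0 : x =ᶠ[𝓝 t] 0 := notMem_tsupport_iff_eventuallyEq.1 hcon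
  have h1 : deriv x t = 0 := by simpa using h0.deriv_eq
  have h2 : deriv (deriv x) t = 0 := by
    have := h0.deriv.deriv_eq
    simpa using this
  exact ht (by simp [expandedExpr, h0.eq_of_nhds, h1, h2])

theorem expandedExpr_add (hx : ContDiff ℝ ∞ x) (hy : ContDiff ℝ ∞ y) :
    c.expandedExpr e (x + y) = c.expandedExpr e x + c.expandedExpr e y := by
  have h1 : deriv (x + y) = deriv x + deriv y :=
    funext fun t => ((hx.hasDerivAt_infty t).add (hy.hasDerivAt_infty t)).deriv
  have h2 : deriv (deriv x + deriv y) = deriv (deriv x) + deriv (deriv y) :=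
    funext fun t => ((hx.deriv_infty.hasDerivAt_infty t).add
      (hy.deriv_infty.hasDerivAt_infty t)).deriv
  ext1 t
  simp only [expandedExpr, h1, h2, Pi.add_apply, map_add]
  abel

theorem expandedExpr_smul (r : ℝ) : c.expandedExpr e (r • x) = r • c.expandedExpr e x := by
  have h1 : deriv (r • x) = r • deriv x := funext fun t => deriv_const_smul_field r x
  have h2 : deriv (r • deriv x) = r • deriv (deriv x) :=
    funext fun t => deriv_const_smul_field r (deriv x)
  ext1 t
  simp only [expandedExpr, h1, h2, Pi.smul_apply, map_smul, smul_add, smul_neg]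

theorem hasDerivAt_quasiDeriv {f : E → ℝ → EuclideanSpace ℝ (Fin d)} (hx : ContDiff ℝ ∞ (f e))
    {t : ℝ} (ht : t ∈ G.openEdge e) :
    HasDerivAt (c.quasiDeriv f e) (derivWithin (c.P e) (G.edge e) t (deriv (f e) t) +
      c.P e t (deriv (deriv (f e)) t) + (derivWithin (c.Q e) (G.edge e) t (f e t) +
      c.Q e t (deriv (f e) t))) t := by
  have hn := G.edge_mem_nhds ht
  have hP : HasDerivAt (c.P e) (derivWithin (c.P e) (G.edge e) t) t := by
    rw [derivWithin_of_mem_nhds hn]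
    exact (((c.contDiffOn_P e).contDiffAt hn).differentiableAt one_ne_zero).hasDerivAt
  have hQ : HasDerivAt (c.Q e) (derivWithin (c.Q e) (G.edge e) t) t := by
    rw [derivWithin_of_mem_nhds hn]
    exact (((c.contDiffOn_Q e).contDiffAt hn).differentiableAt one_ne_zero).hasDerivAt
  exact (hP.clm_apply (hx.deriv_infty.hasDerivAt_infty t)).add
    (hQ.clm_apply (hx.hasDerivAt_infty t))

theorem expr_eq_expandedExpr {f : E → ℝ → EuclideanSpace ℝ (Fin d)} (hx : ContDiff ℝ ∞ (f e))
    {t : ℝ} (ht : t ∈ G.openEdge e) : c.expr f e t = c.expandedExpr e (f e) t := by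
  rw [expr, (c.hasDerivAt_quasiDeriv hx ht).deriv, expandedExpr, coeffOne, coeffZero]
  simp only [add_apply, sub_apply,
    neg_apply]
  abel

/-- The boundary form `⟪x, P y' + Q y⟫ - ⟪P x' + Q x, y⟫` at the point `t`. -/
noncomputable def wronskian (e : E) (x y : ℝ → EuclideanSpace ℝ (Fin d)) (t : ℝ) : ℝ :=
  ⟪x t, c.P e t (deriv y t) + c.Q e t (y t)⟫_ℝ - ⟪c.P e t (deriv x t) + c.Q e t (x t), y t⟫_ℝ

theorem hasDerivAt_wronskian (hx : ContDiff ℝ ∞ x) (hy : ContDiff ℝ ∞ y) {t : ℝ}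
    (ht : t ∈ G.openEdge e) : HasDerivAt (c.wronskian e x y)
      (⟪c.expandedExpr e x t, y t⟫_ℝ - ⟪x t, c.expandedExpr e y t⟫_ℝ) t := by
  have h1 := c.hasDerivAt_quasiDeriv (f := fun _ => x) (e := e) hx ht
  have h2 := c.hasDerivAt_quasiDeriv (f := fun _ => y) (e := e) hy ht
  have hte := G.openEdge_subset e ht
  refine (((hx.hasDerivAt_infty t).inner ℝ h2).sub
    (h1.inner ℝ (hy.hasDerivAt_infty t))).congr_deriv ?_
  simp only [expandedExpr, coeffOne, coeffZero, quasiDeriv, add_apply,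
    sub_apply, neg_apply, inner_add_left, inner_add_right,
    inner_sub_left, inner_sub_right, inner_neg_left, inner_neg_right,
    ContinuousLinearMap.adjoint_inner_left, ContinuousLinearMap.adjoint_inner_right,
    c.symm_R e t hte, c.symm_P e t hte]
  ring

theorem continuousOn_wronskian (hx : ContDiff ℝ ∞ x) (hy : ContDiff ℝ ∞ y) :
    ContinuousOn (c.wronskian e x y) (G.edge e) := by
  have hP := (c.contDiffOn_P e).continuousOn
  have hQ := (c.contDiffOn_Q e).continuousOn
  exact (hx.continuous.continuousOn.inner
    ((hP.clm_apply hy.deriv_infty.continuous.continuousOn).add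
      (hQ.clm_apply hy.continuous.continuousOn))).sub
    (((hP.clm_apply hx.deriv_infty.continuous.continuousOn).add
      (hQ.clm_apply hx.continuous.continuousOn)).inner hy.continuous.continuousOn)

/-- Lagrange's identity. -/
theorem integral_expandedExpr_sub (hx : ContDiff ℝ ∞ x) (hy : ContDiff ℝ ∞ y)
    (hxc : HasCompactSupport x) (hyc : HasCompactSupport y) :
    ∫ t in G.edge e, (⟪c.expandedExpr e x t, y t⟫_ℝ - ⟪x t, c.expandedExpr e y t⟫_ℝ) =
      (if G.hi e = ⊤ then 0 else c.wronskian e x y (G.hi e).toReal) -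
      (if G.lo e = ⊥ then 0 else c.wronskian e x y (G.lo e).toReal) := by
  refine G.integral_edge_eq_sub (G.integrable_of_continuousOn ?_ ?_)
    (c.continuousOn_wronskian hx hy) ?_ fun t ht => c.hasDerivAt_wronskian hx hy ht
  · exact ((c.continuousOn_expandedExpr hx).inner hy.continuous.continuousOn).sub
      (hx.continuous.continuousOn.inner (c.continuousOn_expandedExpr hy))
  · refine HasCompactSupport.intro (hxc.isCompact.union hyc.isCompact) fun t ht => ?_
    rw [mem_union, not_or] at ht
    simp [image_eq_zero_of_notMem_tsupport ht.1, image_eq_zero_of_notMem_tsupport ht.2]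
  · refine HasCompactSupport.intro (hxc.isCompact.union hyc.isCompact) fun t ht => ?_
    rw [mem_union, not_or] at ht
    simp [wronskian, image_eq_zero_of_notMem_tsupport ht.1, image_eq_zero_of_notMem_tsupport ht.2]

end

end SLCoeff

/-! ### Smooth functions in the domain of the maximal operator -/

namespace MetricGraph

variable {V E : Type*} (G : MetricGraph V E)

variable (E) in
/-- Families of smooth functions of compact support on the line, one for each edge. Their
restrictions to the edges need not vanish at the endpoints. -/
def _root_.smoothSpace (d : ℕ) : Submodule ℝ (E → ℝ → EuclideanSpace ℝ (Fin d)) where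
  carrier := {x | ∀ e, ContDiff ℝ ∞ (x e) ∧ HasCompactSupport (x e)}
  add_mem' hx hy e := ⟨(hx e).1.add (hy e).1, (hx e).2.add (hy e).2⟩
  zero_mem' _ := ⟨contDiff_const, HasCompactSupport.zero⟩
  smul_mem' r _ hx e := ⟨(hx e).1.const_smul r, (hx e).2.smul_left (f := fun _ => r)⟩

theorem testSpace_le_smoothSpace (d : ℕ) : G.testSpace d ≤ smoothSpace E d :=
  fun _ h e => ⟨(h e).1, (h e).2.1⟩

theorem memLp_smooth {d : ℕ} {x : E → ℝ → EuclideanSpace ℝ (Fin d)} (hx : x ∈ smoothSpace E d)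
    (e : E) : MemLp (x e) 2 (volume.restrict (G.edge e)) :=
  G.memLp_of_continuousOn (hx e).1.continuous.continuousOn (hx e).2 2

/-- Restriction of smooth families to the edges. -/
noncomputable def smoothToL2 [Fintype E] (d : ℕ) : smoothSpace E d →ₗ[ℝ] G.L2 d where
  toFun x := WithLp.toLp 2 fun e => (G.memLp_smooth x.2 e).toLp (x.1 e)
  map_add' _ _ := rfl
  map_smul' _ _ := rfl

theorem inner_toLp_toLp [Fintype E] {d : ℕ} {f g : E → ℝ → EuclideanSpace ℝ (Fin d)}
    (hf : ∀ e, MemLp (f e) 2 (volume.restrict (G.edge e)))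
    (hg : ∀ e, MemLp (g e) 2 (volume.restrict (G.edge e))) :
    ⟪(WithLp.toLp 2 fun e => (hf e).toLp (f e) : G.L2 d),
      WithLp.toLp 2 fun e => (hg e).toLp (g e)⟫_ℝ = ∑ e, ∫ t in G.edge e, ⟪f e t, g e t⟫_ℝ := by
  rw [PiLp.inner_apply]
  refine Finset.sum_congr rfl fun e _ => ?_
  rw [L2.inner_def]
  refine integral_congr_ae ?_
  filter_upwards [(hf e).coeFn_toLp, (hg e).coeFn_toLp] with t h1 h2
  rw [h1, h2]

end MetricGraph

namespace SLCoeff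

open Filter

variable {V E : Type*} {G : MetricGraph V E} {d : ℕ} (c : SLCoeff G d)

theorem memLp_expandedExpr {x : E → ℝ → EuclideanSpace ℝ (Fin d)} (hx : x ∈ smoothSpace E d)
    (e : E) : MemLp (c.expandedExpr e (x e)) 2 (volume.restrict (G.edge e)) :=
  G.memLp_of_continuousOn (c.continuousOn_expandedExpr (hx e).1)
    (c.hasCompactSupport_expandedExpr (hx e).2) 2

/-- A test function as a smooth family. -/
def testToSmooth (φ : G.testSpace d) : smoothSpace E d := ⟨φ.1, G.testSpace_le_smoothSpace d φ.2⟩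

theorem wronskian_eq_zero_of_test (φ : G.testSpace d) (e : E)
    (y : ℝ → EuclideanSpace ℝ (Fin d)) {t : ℝ} (ht : t ∉ G.openEdge e) :
    c.wronskian e (φ.1 e) y t = 0 := by
  have ht' : t ∉ tsupport (φ.1 e) := fun h => ht ((φ.2 e).2.2 h)
  have h0 : φ.1 e =ᶠ[𝓝 t] 0 := notMem_tsupport_iff_eventuallyEq.1 ht'
  have h1 : deriv (φ.1 e) t = 0 := by simpa using h0.deriv_eq
  simp [wronskian, h0.eq_of_nhds, h1]

theorem toReal_notMem_openEdge (e : E) :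
    (G.hi e ≠ ⊤ → (G.hi e).toReal ∉ G.openEdge e) ∧
      (G.lo e ≠ ⊥ → (G.lo e).toReal ∉ G.openEdge e) := by
  rcases G.edge_cases e with ⟨a, b, hab, ha, hb⟩ | ⟨a, ha, hb⟩ | ⟨b, ha, hb⟩ <;>
    simp [MetricGraph.openEdge, ha, hb]

variable [Fintype E]

/-- The differential expression on smooth families. -/
noncomputable def smoothExprToL2 : smoothSpace E d →ₗ[ℝ] G.L2 d where
  toFun x := WithLp.toLp 2 fun e => (c.memLp_expandedExpr x.2 e).toLp (c.expandedExpr e (x.1 e))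
  map_add' x y := by
    refine PiLp.ext fun e => ?_
    exact (MemLp.toLp_congr (c.memLp_expandedExpr (x + y).2 e)
      ((c.memLp_expandedExpr x.2 e).add (c.memLp_expandedExpr y.2 e))
      (by rw [← c.expandedExpr_add (x.2 e).1 (y.2 e).1]; rfl)).trans
      (MemLp.toLp_add (c.memLp_expandedExpr x.2 e) (c.memLp_expandedExpr y.2 e))
  map_smul' r x := by
    refine PiLp.ext fun e => ?_
    exact (MemLp.toLp_congr (c.memLp_expandedExpr (r • x).2 e)
      ((c.memLp_expandedExpr x.2 e).const_smul r)
      (by rw [← c.expandedExpr_smul r]; rfl)).trans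
      (MemLp.toLp_const_smul r (c.memLp_expandedExpr x.2 e))

theorem smoothToL2_testToSmooth (φ : G.testSpace d) :
    G.smoothToL2 d (testToSmooth φ) = testToL2 G d φ := rfl

theorem smoothExprToL2_testToSmooth (φ : G.testSpace d) :
    c.smoothExprToL2 (testToSmooth φ) = c.exprToL2 φ := by
  refine PiLp.ext fun e => MemLp.toLp_congr (c.memLp_expandedExpr (testToSmooth φ).2 e)
    (c.memLp_expr φ.2 e) ?_
  filter_upwards [G.ae_mem_openEdge e] with t ht
  exact (c.expr_eq_expandedExpr (φ.2 e).1 ht).symm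

theorem inner_smoothExprToL2_sub (x y : smoothSpace E d) :
    ⟪c.smoothExprToL2 x, G.smoothToL2 d y⟫_ℝ - ⟪G.smoothToL2 d x, c.smoothExprToL2 y⟫_ℝ =
      ∑ e, ((if G.hi e = ⊤ then 0 else c.wronskian e (x.1 e) (y.1 e) (G.hi e).toReal) -
      (if G.lo e = ⊥ then 0 else c.wronskian e (x.1 e) (y.1 e) (G.lo e).toReal)) := by
  have h1 := G.inner_toLp_toLp (c.memLp_expandedExpr x.2) (G.memLp_smooth y.2)
  have h2 := G.inner_toLp_toLp (G.memLp_smooth x.2) (c.memLp_expandedExpr y.2)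
  refine (congrArg₂ (· - ·) h1 h2).trans ?_
  rw [← Finset.sum_sub_distrib]
  refine Finset.sum_congr rfl fun e _ => ?_
  rw [← c.integral_expandedExpr_sub (x.2 e).1 (y.2 e).1 (x.2 e).2 (y.2 e).2, integral_sub]
  · refine G.integrable_of_continuousOn
      ((c.continuousOn_expandedExpr (x.2 e).1).inner (y.2 e).1.continuous.continuousOn)
      (HasCompactSupport.intro (y.2 e).2 fun t ht => ?_)
    rw [image_eq_zero_of_notMem_tsupport ht, inner_zero_right]
  · refine G.integrable_of_continuousOn
      ((x.2 e).1.continuous.continuousOn.inner (c.continuousOn_expandedExpr (y.2 e).1))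
      (HasCompactSupport.intro (x.2 e).2 fun t ht => ?_)
    rw [image_eq_zero_of_notMem_tsupport ht, inner_zero_left]

theorem inner_exprToL2 (φ : G.testSpace d) (y : smoothSpace E d) :
    ⟪c.exprToL2 φ, G.smoothToL2 d y⟫_ℝ = ⟪testToL2 G d φ, c.smoothExprToL2 y⟫_ℝ := by
  rw [← sub_eq_zero, ← smoothExprToL2_testToSmooth, ← smoothToL2_testToSmooth,
    inner_smoothExprToL2_sub]
  refine Finset.sum_eq_zero fun e _ => ?_
  have h := toReal_notMem_openEdge (G := G) e
  rw [sub_eq_zero]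
  split_ifs with h1 h2 h2
  · rfl
  · exact (c.wronskian_eq_zero_of_test φ e _ (h.2 h2)).symm
  · exact c.wronskian_eq_zero_of_test φ e _ (h.1 h1)
  · exact (c.wronskian_eq_zero_of_test φ e _ (h.1 h1)).trans
      (c.wronskian_eq_zero_of_test φ e _ (h.2 h2)).symm

theorem preMinimal_apply (φ : G.testSpace d) (h : testToL2 G d φ ∈ c.preMinimal.domain) :
    c.preMinimal ⟨testToL2 G d φ, h⟩ = c.exprToL2 φ := by
  change c.exprToL2 ((LinearEquiv.ofInjective (testToL2 G d) (testToL2_injective G d)).symm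
    ⟨testToL2 G d φ, h⟩) = _
  congr 1
  exact (LinearEquiv.ofInjective (testToL2 G d) (testToL2_injective G d)).symm_apply_apply φ

theorem minimal_graph_le : c.minimal.graph ≤ c.preMinimal.graph.topologicalClosure := by
  by_cases h : c.preMinimal.IsClosable
  · exact h.graph_closure_eq_closure_graph.ge
  · rw [minimal, LinearPMap.closure_def' h]
    exact Submodule.le_topologicalClosure _

/-- Elements of the domain of the minimal operator are limits of test functions in the graph
norm. -/
theorem exists_seq_test (x : c.minimal.domain) : ∃ φ : ℕ → G.testSpace d,
    Tendsto (fun n => testToL2 G d (φ n)) atTop (𝓝 (x : G.L2 d)) ∧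
    Tendsto (fun n => c.exprToL2 (φ n)) atTop (𝓝 (c.minimal x)) := by
  have h1 : ((x : G.L2 d), c.minimal x) ∈ c.preMinimal.graph.topologicalClosure :=
    c.minimal_graph_le (c.minimal.mem_graph x)
  rw [← SetLike.mem_coe, Submodule.topologicalClosure_coe, mem_closure_iff_seq_limit] at h1
  obtain ⟨z, hz, hlim⟩ := h1
  have h2 : ∀ n, ∃ φ : G.testSpace d, z n = (testToL2 G d φ, c.exprToL2 φ) := fun n => by
    obtain ⟨y, hy1, hy2⟩ := (LinearPMap.mem_graph_iff _).1 (hz n)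
    obtain ⟨φ, hφ⟩ := y.2
    refine ⟨φ, Prod.ext (hy1.symm.trans hφ.symm) ?_⟩
    rw [← hy2, ← c.preMinimal_apply φ ⟨φ, rfl⟩]
    congr 1
    exact Subtype.ext hφ.symm
  choose φ hφ using h2
  refine ⟨φ, ?_, ?_⟩
  · simpa [hφ] using hlim.fst_nhds
  · simpa [hφ] using hlim.snd_nhds

theorem inner_minimal_of_forall_test {y z : G.L2 d}
    (h : ∀ φ : G.testSpace d, ⟪c.exprToL2 φ, y⟫_ℝ = ⟪testToL2 G d φ, z⟫_ℝ)
    (x : c.minimal.domain) : ⟪c.minimal x, y⟫_ℝ = ⟪(x : G.L2 d), z⟫_ℝ := by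
  obtain ⟨φ, h1, h2⟩ := c.exists_seq_test x
  refine tendsto_nhds_unique (h2.inner (𝕜 := ℝ) tendsto_const_nhds) ?_
  simp only [h]
  exact h1.inner (𝕜 := ℝ) tendsto_const_nhds

theorem mem_maximal_of_forall_test {y z : G.L2 d}
    (h : ∀ φ : G.testSpace d, ⟪c.exprToL2 φ, y⟫_ℝ = ⟪testToL2 G d φ, z⟫_ℝ) :
    y ∈ c.maximal.domain :=
  LinearPMap.mem_adjoint_domain_of_exists y ⟨z, fun x => by
    rw [real_inner_comm (c.minimal x), c.inner_minimal_of_forall_test h, real_inner_comm]⟩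

theorem maximal_apply_of_forall_test (hd : Dense (c.minimal.domain : Set (G.L2 d))) {y z : G.L2 d}
    (h : ∀ φ : G.testSpace d, ⟪c.exprToL2 φ, y⟫_ℝ = ⟪testToL2 G d φ, z⟫_ℝ)
    (hy : y ∈ c.maximal.domain) : c.maximal ⟨y, hy⟩ = z :=
  LinearPMap.adjoint_apply_eq hd _ fun x => by
    rw [real_inner_comm (c.minimal x), c.inner_minimal_of_forall_test h, real_inner_comm]

theorem test_mem_minimal (φ : G.testSpace d) : testToL2 G d φ ∈ c.minimal.domain :=
  c.preMinimal.le_closure.1 ⟨φ, rfl⟩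

theorem minimal_apply_test (φ : G.testSpace d) :
    c.minimal ⟨testToL2 G d φ, c.test_mem_minimal φ⟩ = c.exprToL2 φ := by
  rw [← c.preMinimal_apply φ ⟨φ, rfl⟩]
  exact (c.preMinimal.le_closure.2 rfl).symm

theorem inner_maximal (hd : Dense (c.minimal.domain : Set (G.L2 d))) (y : c.maximal.domain)
    (x : c.minimal.domain) : ⟪c.maximal y, (x : G.L2 d)⟫_ℝ = ⟪(y : G.L2 d), c.minimal x⟫_ℝ :=
  LinearPMap.adjoint_isFormalAdjoint hd y x

theorem inner_exprToL2_minimal (x : c.minimal.domain) (φ : G.testSpace d) :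
    ⟪c.exprToL2 φ, (x : G.L2 d)⟫_ℝ = ⟪testToL2 G d φ, c.minimal x⟫_ℝ := by
  rw [real_inner_comm, real_inner_comm (c.minimal x)]
  refine (c.inner_minimal_of_forall_test (fun ψ => ?_) x).symm
  exact (c.inner_exprToL2 ψ (testToSmooth φ)).trans (by rw [smoothExprToL2_testToSmooth])

/-- The minimal operator is symmetric. -/
theorem minimal_le_maximal (hd : Dense (c.minimal.domain : Set (G.L2 d))) :
    c.minimal ≤ c.maximal :=
  ⟨fun x hx => c.mem_maximal_of_forall_test (c.inner_exprToL2_minimal ⟨x, hx⟩), fun x y hxy => by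
    have := c.maximal_apply_of_forall_test hd (c.inner_exprToL2_minimal x)
      (c.mem_maximal_of_forall_test (c.inner_exprToL2_minimal x))
    rw [← this]
    congr 1
    exact Subtype.ext hxy⟩

theorem maximal_eq_minimal (hd : Dense (c.minimal.domain : Set (G.L2 d))) {x : c.maximal.domain}
    (hx : x ∈ c.minDomain) : c.maximal x = c.minimal ⟨x, hx⟩ :=
  ((c.minimal_le_maximal hd).2 rfl).symm

theorem omega_apply (x y : c.maximal.domain) : c.omega x y =
    ⟪(x : G.L2 d), c.maximal y⟫_ℝ - ⟪c.maximal x, (y : G.L2 d)⟫_ℝ := rfl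

theorem omega_eq_zero_of_mem_minDomain (hd : Dense (c.minimal.domain : Set (G.L2 d)))
    (x : c.maximal.domain) (hx : x ∈ c.minDomain) (y : c.maximal.domain) : c.omega x y = 0 := by
  rw [omega_apply, c.maximal_eq_minimal hd hx, real_inner_comm,
    c.inner_maximal hd y ⟨x, hx⟩, real_inner_comm, sub_self]

/-- Smooth families belong to the domain of the maximal operator. -/
noncomputable def smoothToMaximal : smoothSpace E d →ₗ[ℝ] c.maximal.domain :=
  (G.smoothToL2 d).codRestrict _ fun y => c.mem_maximal_of_forall_test fun φ => c.inner_exprToL2 φ y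

theorem maximal_smoothToMaximal (hd : Dense (c.minimal.domain : Set (G.L2 d)))
    (y : smoothSpace E d) : c.maximal (c.smoothToMaximal y) = c.smoothExprToL2 y :=
  c.maximal_apply_of_forall_test hd (fun φ => c.inner_exprToL2 φ y) _

theorem omega_smoothToMaximal (hd : Dense (c.minimal.domain : Set (G.L2 d)))
    (x y : smoothSpace E d) : c.omega (c.smoothToMaximal x) (c.smoothToMaximal y) =
      ∑ e, ((if G.lo e = ⊥ then 0 else c.wronskian e (x.1 e) (y.1 e) (G.lo e).toReal) -
      (if G.hi e = ⊤ then 0 else c.wronskian e (x.1 e) (y.1 e) (G.hi e).toReal)) := by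
  rw [omega_apply, c.maximal_smoothToMaximal hd, c.maximal_smoothToMaximal hd]
  have := c.inner_smoothExprToL2_sub x y
  rw [← neg_inj, neg_sub]
  refine this.trans ?_
  rw [← Finset.sum_neg_distrib]
  exact Finset.sum_congr rfl fun e _ => by ring

end SLCoeff

/-! ### Smooth functions with prescribed boundary data -/

section Profile

/-- A smooth cutoff function, equal to `1` near `0` and supported in `[-1, 1]`. -/
noncomputable def cutoff : ContDiffBump (0 : ℝ) := ⟨1 / 2, 1, by norm_num, by norm_num⟩

/-- A smooth function supported in `[-1, 1]` and equal to the identity near `0`. -/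
noncomputable def cutoffId (s : ℝ) : ℝ := s * cutoff s

theorem contDiff_cutoffId : ContDiff ℝ ∞ cutoffId := contDiff_id.mul cutoff.contDiff

theorem cutoff_eq_zero {s : ℝ} (hs : 1 ≤ |s|) : cutoff s = 0 :=
  cutoff.zero_of_le_dist (by simpa [cutoff] using hs)

theorem cutoff_eq_one {s : ℝ} (hs : |s| ≤ 1 / 2) : cutoff s = 1 :=
  cutoff.one_of_mem_closedBall (by simpa [cutoff] using hs)

theorem cutoffId_eq_zero {s : ℝ} (hs : 1 ≤ |s|) : cutoffId s = 0 := by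
  rw [cutoffId, cutoff_eq_zero hs, mul_zero]

theorem hasCompactSupport_cutoffId : HasCompactSupport cutoffId :=
  HasCompactSupport.intro (isCompact_closedBall (0 : ℝ) 1) fun s hs => cutoffId_eq_zero (by
    simpa using (not_le.1 (by simpa using hs)).le)

/-- Rescaling of a function by the factor `r` about the point `p`. -/
theorem hasDerivAt_rescale {k : ℝ → ℝ} (hk : ContDiff ℝ ∞ k) (r p t : ℝ) :
    HasDerivAt (fun t => k (r * (t - p))) (r * deriv k (r * (t - p))) t := by
  have h1 : HasDerivAt (fun t : ℝ => r * (t - p)) r t := by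
    simpa using ((hasDerivAt_id t).sub_const p).const_mul r
  rw [mul_comm]
  exact (hk.hasDerivAt_infty _).comp t h1

theorem contDiff_rescale {k : ℝ → ℝ} (hk : ContDiff ℝ ∞ k) (r p : ℝ) :
    ContDiff ℝ ∞ (fun t => k (r * (t - p))) :=
  hk.comp (contDiff_const.mul (contDiff_id.sub contDiff_const))

end Profile

namespace MetricGraph

open Filter

variable {V E : Type*} (G : MetricGraph V E)

/-- The finite endpoints of the edges: the left ones, then the right ones. -/
abbrev Endpoint : Type _ := {e // G.lo e ≠ ⊥} ⊕ {e // G.hi e ≠ ⊤}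

variable {G}

/-- The edge to which an endpoint belongs. -/
def Endpoint.edge (p : G.Endpoint) : E := Sum.elim (fun e => e.1) (fun e => e.1) p

/-- The position of an endpoint on the line. -/
noncomputable def Endpoint.pos (p : G.Endpoint) : ℝ :=
  Sum.elim (fun e => (G.lo e.1).toReal) (fun e => (G.hi e.1).toReal) p

/-- The orientation of an endpoint: `1` at left ends and `-1` at right ends. -/
def Endpoint.sign (p : G.Endpoint) : ℝ := Sum.elim (fun _ => 1) (fun _ => -1) p

theorem Endpoint.coe_pos (p : G.Endpoint) :
    (p.pos : EReal) = G.lo p.edge ∨ (p.pos : EReal) = G.hi p.edge := by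
  rcases p with ⟨e, he⟩ | ⟨e, he⟩
  · left
    exact EReal.coe_toReal (ne_top_of_lt (G.lo_lt_hi e)) he
  · right
    exact EReal.coe_toReal he (ne_bot_of_gt (G.lo_lt_hi e))

theorem Endpoint.pos_mem (p : G.Endpoint) : p.pos ∈ G.edge p.edge := by
  rcases p.coe_pos with h | h
  · exact ⟨h.ge, h ▸ (G.lo_lt_hi _).le⟩
  · exact ⟨h ▸ (G.lo_lt_hi _).le, h.le⟩

theorem Endpoint.exists_of_coe_eq {e : E} {t : ℝ}
    (h : (t : EReal) = G.lo e ∨ (t : EReal) = G.hi e) :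
    ∃ p : G.Endpoint, p.edge = e ∧ p.pos = t := by
  rcases h with h | h
  · exact ⟨Sum.inl ⟨e, by rw [← h]; exact EReal.coe_ne_bot t⟩, rfl, by simp [pos, ← h]⟩
  · exact ⟨Sum.inr ⟨e, by rw [← h]; exact EReal.coe_ne_top t⟩, rfl, by simp [pos, ← h]⟩

theorem Endpoint.sign_ne_zero (p : G.Endpoint) : p.sign ≠ 0 := by
  rcases p with p | p <;> simp [sign]

theorem Endpoint.pos_ne {p q : G.Endpoint} (hpq : p ≠ q) (he : p.edge = q.edge) :
    p.pos ≠ q.pos := by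
  have key : ∀ e (h1 : G.lo e ≠ ⊥) (h2 : G.hi e ≠ ⊤), (G.lo e).toReal ≠ (G.hi e).toReal := by
    intro e h1 h2 h
    have h3 := G.lo_lt_hi e
    rw [← EReal.coe_toReal (ne_top_of_lt h3) h1, ← EReal.coe_toReal h2 (ne_bot_of_gt h3), h] at h3
    exact lt_irrefl _ h3
  rcases p with ⟨e, h1⟩ | ⟨e, h1⟩ <;> rcases q with ⟨e', h2⟩ | ⟨e', h2⟩ <;>
    obtain rfl : e = e' := he
  · exact absurd rfl hpq
  · exact key e h1 h2
  · exact (key e h2 h1).symm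
  · exact absurd rfl hpq

variable [Fintype E]

open Classical in
theorem sum_endpoint (f : E → ℝ → ℝ) :
    ∑ e, ((if G.lo e = ⊥ then 0 else f e (G.lo e).toReal) -
      (if G.hi e = ⊤ then 0 else f e (G.hi e).toReal)) =
    ∑ p : G.Endpoint, p.sign * f p.edge p.pos := by
  rw [Fintype.sum_sum_type, Finset.sum_sub_distrib, sub_eq_add_neg]
  have h1 : ∀ (s : E → Prop) [DecidablePred s] [Fintype {e // ¬ s e}] (g : E → ℝ),
      (∑ e, if s e then 0 else g e) = ∑ e : {e // ¬ s e}, g e := by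
    intro s _ _ g
    rw [← Finset.sum_subtype (Finset.univ.filter fun e => ¬ s e) (by simp), Finset.sum_filter]
    exact Finset.sum_congr rfl fun e _ => by split_ifs <;> rfl
  rw [h1, h1, ← Finset.sum_neg_distrib]
  congr 1
  · exact Finset.sum_congr rfl fun e _ => by simp [Endpoint.sign, Endpoint.edge, Endpoint.pos]
  · exact Finset.sum_congr rfl fun e _ => by simp [Endpoint.sign, Endpoint.edge, Endpoint.pos]

variable (G) in
/-- Boundary data: a value and a derivative at every finite endpoint. -/
abbrev BoundaryData (d : ℕ) : Type _ :=
  (G.Endpoint → EuclideanSpace ℝ (Fin d)) × (G.Endpoint → EuclideanSpace ℝ (Fin d))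

theorem finrank_boundaryData (d : ℕ) :
    Module.finrank ℝ (G.BoundaryData d) = 2 * (G.Na d + G.Nb d) := by
  classical
  have h : Module.finrank ℝ (G.Endpoint → EuclideanSpace ℝ (Fin d)) = G.Na d + G.Nb d := by
    rw [Module.finrank_pi_fintype]
    simp only [finrank_euclideanSpace_fin, Finset.sum_const, Finset.card_univ, smul_eq_mul]
    rw [Na, Nb, Nat.card_eq_fintype_card, Nat.card_eq_fintype_card, Fintype.card_sum, add_mul]
  rw [Module.finrank_prod, h]
  ring

open Classical in
/-- The function on the edge `e` with boundary data `z` that is supported in the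
`1 / r`-neighbourhoods of the endpoints. -/
noncomputable def boundaryFun {d : ℕ} (r : ℝ) (z : G.BoundaryData d) (e : E) (t : ℝ) :
    EuclideanSpace ℝ (Fin d) :=
  ∑ p : G.Endpoint with p.edge = e, (cutoff (r * (t - p.pos)) • z.1 p +
    (r⁻¹ * cutoffId (r * (t - p.pos))) • z.2 p)

theorem boundaryFun_mem {d : ℕ} {r : ℝ} (hr : r ≠ 0) (z : G.BoundaryData d) :
    boundaryFun r z ∈ smoothSpace E d := by
  classical
  refine fun e => ⟨ContDiff.sum fun p _ => ?_, ?_⟩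
  · exact ((contDiff_rescale cutoff.contDiff r p.pos).smul contDiff_const).add
      ((contDiff_const.mul (contDiff_rescale contDiff_cutoffId r p.pos)).smul contDiff_const)
  · refine HasCompactSupport.intro (K := ⋃ p : G.Endpoint, Metric.closedBall p.pos |r|⁻¹)
      (isCompact_iUnion fun p => isCompact_closedBall _ _) fun t ht => ?_
    refine Finset.sum_eq_zero fun p _ => ?_
    have h1 : |r|⁻¹ < |t - p.pos| := by
      simp only [mem_iUnion, not_exists] at ht
      simpa [Real.dist_eq] using ht p
    have h2 : 1 ≤ |r * (t - p.pos)| := by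
      rw [abs_mul]
      have := mul_lt_mul_of_pos_left h1 (abs_pos.2 hr)
      rw [mul_inv_cancel₀ (abs_pos.2 hr).ne'] at this
      exact this.le
    rw [cutoff_eq_zero h2, cutoffId_eq_zero h2]
    simp

/-- The factor `r` is so large that the parts of `boundaryFun r z` at different endpoints of an edge
do not interfere. -/
def Separates (G : MetricGraph V E) (r : ℝ) : Prop :=
  0 < r ∧ ∀ p q : G.Endpoint, p ≠ q → p.edge = q.edge → 1 < |r * (p.pos - q.pos)|

variable (G) in
theorem eventually_separates : ∀ᶠ n : ℕ in atTop, G.Separates (n + 1) := by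
  classical
  have h : ∀ p q : G.Endpoint, ∀ᶠ n : ℕ in atTop,
      p ≠ q → p.edge = q.edge → 1 < |((n : ℝ) + 1) * (p.pos - q.pos)| := by
    intro p q
    by_cases hpq : p ≠ q ∧ p.edge = q.edge
    · have h0 : 0 < |p.pos - q.pos| := abs_pos.2 (sub_ne_zero.2 (Endpoint.pos_ne hpq.1 hpq.2))
      have h1 : Tendsto (fun n : ℕ => ((n : ℝ) + 1) * |p.pos - q.pos|) atTop atTop :=
        (tendsto_atTop_add_const_right _ _ tendsto_natCast_atTop_atTop).atTop_mul_const h0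
      filter_upwards [h1.eventually_gt_atTop 1] with n hn _ _
      rwa [abs_mul, abs_of_pos (by positivity : (0 : ℝ) < n + 1)]
    · exact Eventually.of_forall fun n h1 h2 => absurd ⟨h1, h2⟩ hpq
  filter_upwards [eventually_all.2 fun p => eventually_all.2 fun q => h p q] with n hn
  exact ⟨by positivity, hn⟩

theorem Separates.boundaryFun_eventuallyEq {d : ℕ} {r : ℝ} (hr : G.Separates r)
    (z : G.BoundaryData d) (p : G.Endpoint) :
    boundaryFun r z p.edge =ᶠ[𝓝 p.pos] fun t => z.1 p + (t - p.pos) • z.2 p := by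
  classical
  have hcont : ∀ q : G.Endpoint, Tendsto (fun t : ℝ => |r * (t - q.pos)|) (𝓝 p.pos)
      (𝓝 |r * (p.pos - q.pos)|) := fun q =>
    (Continuous.tendsto (by fun_prop) _)
  have h1 : ∀ q : G.Endpoint, ∀ᶠ t in 𝓝 p.pos, q ≠ p → q.edge = p.edge →
      1 < |r * (t - q.pos)| := by
    intro q
    by_cases hqp : q ≠ p ∧ q.edge = p.edge
    · filter_upwards [(hcont q).eventually (lt_mem_nhds (hr.2 p q hqp.1.symm hqp.2.symm))]
        with t ht _ _ using ht
    · exact Eventually.of_forall fun t h1 h2 => absurd ⟨h1, h2⟩ hqp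
  have h2 : ∀ᶠ t in 𝓝 p.pos, |r * (t - p.pos)| < 1 / 2 :=
    (hcont p).eventually (gt_mem_nhds (by simp))
  filter_upwards [eventually_all.2 h1, h2] with t ht1 ht2
  rw [boundaryFun, Finset.sum_eq_single_of_mem p (by simp)]
  · rw [cutoffId, cutoff_eq_one ht2.le, one_smul, mul_one, ← mul_assoc, inv_mul_cancel₀ hr.1.ne',
      one_mul]
  · intro q hq hqp
    have := ht1 q hqp (by simpa using hq)
    rw [cutoff_eq_zero this.le, cutoffId_eq_zero this.le]
    simp

theorem Separates.boundaryFun_pos {d : ℕ} {r : ℝ} (hr : G.Separates r)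
    (z : G.BoundaryData d) (p : G.Endpoint) : boundaryFun r z p.edge p.pos = z.1 p := by
  rw [(hr.boundaryFun_eventuallyEq z p).eq_of_nhds]
  simp

theorem Separates.deriv_boundaryFun_pos {d : ℕ} {r : ℝ} (hr : G.Separates r)
    (z : G.BoundaryData d) (p : G.Endpoint) : deriv (boundaryFun r z p.edge) p.pos = z.2 p := by
  rw [(hr.boundaryFun_eventuallyEq z p).deriv_eq]
  have : HasDerivAt (fun t : ℝ => z.1 p + (t - p.pos) • z.2 p) ((1 : ℝ) • z.2 p) p.pos :=
    (((hasDerivAt_id p.pos).sub_const p.pos).smul_const (z.2 p)).const_add _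
  rw [this.deriv, one_smul]

/-- `boundaryFun` as a linear map; the scaling factor is `n + 1`. -/
noncomputable def boundaryLift (d n : ℕ) : G.BoundaryData d →ₗ[ℝ] smoothSpace E d where
  toFun z := ⟨boundaryFun (n + 1) z, boundaryFun_mem (by positivity) z⟩
  map_add' z z' := by
    ext e t : 3
    simp only [boundaryFun, Prod.fst_add, Prod.snd_add, Pi.add_apply, smul_add, Submodule.coe_add,
      Finset.sum_add_distrib]
    abel
  map_smul' r z := by
    ext e t : 3
    simp only [boundaryFun, Prod.smul_fst, Prod.smul_snd, Pi.smul_apply, Submodule.coe_smul,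
      Finset.smul_sum, smul_add, RingHom.id_apply, smul_comm r]

end MetricGraph

namespace SLCoeff

open Filter Module

variable {V E : Type*} {G : MetricGraph V E} {d : ℕ} (c : SLCoeff G d) [Fintype E]

open Classical in
/-- The form `ω` in terms of boundary data. -/
noncomputable def boundaryForm (z z' : G.BoundaryData d) : ℝ :=
  ∑ p : G.Endpoint, p.sign * (⟪z.1 p, c.P p.edge p.pos (z'.2 p) + c.Q p.edge p.pos (z'.1 p)⟫_ℝ -
    ⟪c.P p.edge p.pos (z.2 p) + c.Q p.edge p.pos (z.1 p), z'.1 p⟫_ℝ)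

/-- Nondegeneracy rests on `P` being positive definite at the endpoints. -/
theorem boundaryForm_nondegenerate {z : G.BoundaryData d} (h : ∀ z', c.boundaryForm z z' = 0) :
    z = 0 := by
  classical
  have hsingle : ∀ (p : G.Endpoint) (v w : EuclideanSpace ℝ (Fin d)),
      c.boundaryForm z (Pi.single p v, Pi.single p w) =
        p.sign * (⟪z.1 p, c.P p.edge p.pos w + c.Q p.edge p.pos v⟫_ℝ -
          ⟪c.P p.edge p.pos (z.2 p) + c.Q p.edge p.pos (z.1 p), v⟫_ℝ) := by
    intro p v w
    rw [boundaryForm, Finset.sum_eq_single p]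
    · simp
    · intro q _ hq
      simp [hq]
    · simp
  have hzero : ∀ (p : G.Endpoint) (v : EuclideanSpace ℝ (Fin d)),
      ⟪c.P p.edge p.pos v, v⟫_ℝ = 0 → v = 0 := by
    intro p v hv
    by_contra hne
    exact (c.pos_P _ _ p.pos_mem v hne).ne' hv
  have h1 : ∀ p, z.1 p = 0 := fun p => by
    have := hsingle p 0 (z.1 p)
    rw [h] at this
    have h2 := (mul_eq_zero.1 this.symm).resolve_left p.sign_ne_zero
    refine hzero p _ ?_
    rw [c.symm_P _ _ p.pos_mem]
    simpa using h2
  have h2 : ∀ p, z.2 p = 0 := fun p => by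
    have := hsingle p (z.2 p) 0
    rw [h] at this
    have h2 := (mul_eq_zero.1 this.symm).resolve_left p.sign_ne_zero
    refine hzero p _ ?_
    simpa [h1] using h2
  exact Prod.ext (funext h1) (funext h2)

/-- Elements of the domain of the maximal operator with given boundary data. -/
noncomputable def maximalLift (n : ℕ) : G.BoundaryData d →ₗ[ℝ] c.maximal.domain :=
  c.smoothToMaximal ∘ₗ MetricGraph.boundaryLift d n

theorem omega_maximalLift (hd : Dense (c.minimal.domain : Set (G.L2 d))) {n m : ℕ}
    (hn : G.Separates (n + 1)) (hm : G.Separates (m + 1)) (z z' : G.BoundaryData d) :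
    c.omega (c.maximalLift n z) (c.maximalLift m z') = c.boundaryForm z z' := by
  classical
  refine (c.omega_smoothToMaximal hd _ _).trans ?_
  rw [MetricGraph.sum_endpoint, boundaryForm]
  refine Finset.sum_congr rfl fun p _ => ?_
  simp only [wronskian]
  change _ * (⟪MetricGraph.boundaryFun (n + 1) z p.edge p.pos, c.P p.edge p.pos
    (deriv (MetricGraph.boundaryFun (m + 1) z' p.edge) p.pos) + c.Q p.edge p.pos
    (MetricGraph.boundaryFun (m + 1) z' p.edge p.pos)⟫_ℝ - ⟪c.P p.edge p.pos
    (deriv (MetricGraph.boundaryFun (n + 1) z p.edge) p.pos) + c.Q p.edge p.pos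
    (MetricGraph.boundaryFun (n + 1) z p.edge p.pos),
    MetricGraph.boundaryFun (m + 1) z' p.edge p.pos⟫_ℝ) = _
  rw [hn.boundaryFun_pos, hm.boundaryFun_pos, hn.deriv_boundaryFun_pos, hm.deriv_boundaryFun_pos]

/-- If `dim U ≤ 2 (N_a + N_b)`, then the domain of the maximal operator is spanned by that of the
minimal operator and by elements with given boundary data. -/
theorem exists_eq_add_maximalLift (hd : Dense (c.minimal.domain : Set (G.L2 d)))
    {U : Submodule ℝ c.maximal.domain} (hU : IsCompl c.minDomain U) [FiniteDimensional ℝ U]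
    (hdim : finrank ℝ U ≤ 2 * (G.Na d + G.Nb d)) {n : ℕ} (hn : G.Separates (n + 1))
    (x : c.maximal.domain) : ∃ z : G.BoundaryData d, x - c.maximalLift n z ∈ c.minDomain := by
  classical
  -- boundary data embed into `U`, as `boundaryForm` is nondegenerate; the dimensions agree
  let T : G.BoundaryData d →ₗ[ℝ] U := U.projectionOnto c.minDomain hU.symm ∘ₗ c.maximalLift n
  have hinj : Function.Injective T := by
    rw [← LinearMap.ker_eq_bot, LinearMap.ker_eq_bot']
    intro z hz
    have h1 : c.maximalLift n z ∈ c.minDomain :=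
      (Submodule.projectionOnto_apply_eq_zero_iff hU.symm).1 hz
    exact c.boundaryForm_nondegenerate fun z' => by
      rw [← c.omega_maximalLift hd hn hn, c.omega_eq_zero_of_mem_minDomain hd _ h1]
  have hfin : finrank ℝ (G.BoundaryData d) = finrank ℝ U :=
    le_antisymm (LinearMap.finrank_le_finrank_of_injective hinj)
      (hdim.trans (MetricGraph.finrank_boundaryData d).ge)
  obtain ⟨z, hz⟩ := (LinearMap.injective_iff_surjective_of_finrank_eq_finrank hfin).1 hinj
    (U.projectionOnto c.minDomain hU.symm x)
  refine ⟨z, (Submodule.projectionOnto_apply_eq_zero_iff hU.symm).1 ?_⟩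
  rw [map_sub, ← hz]
  exact sub_self _

theorem maximalLift_sub_maximalLift_mem (hd : Dense (c.minimal.domain : Set (G.L2 d)))
    {U : Submodule ℝ c.maximal.domain} (hU : IsCompl c.minDomain U) [FiniteDimensional ℝ U]
    (hdim : finrank ℝ U ≤ 2 * (G.Na d + G.Nb d)) {n m : ℕ} (hn : G.Separates (n + 1))
    (hm : G.Separates (m + 1)) (z : G.BoundaryData d) :
    c.maximalLift n z - c.maximalLift m z ∈ c.minDomain := by
  obtain ⟨y, hy⟩ := c.exists_eq_add_maximalLift hd hU hdim hm
    (c.maximalLift n z - c.maximalLift m z)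
  have : y = 0 := c.boundaryForm_nondegenerate fun z' => by
    have h1 := c.omega_eq_zero_of_mem_minDomain hd _ hy (c.maximalLift m z')
    rw [map_sub, map_sub, LinearMap.sub_apply, LinearMap.sub_apply, c.omega_maximalLift hd hn hm,
      c.omega_maximalLift hd hm hm, c.omega_maximalLift hd hm hm] at h1
    linarith
  simpa [this] using hy

end SLCoeff

/-! ### Boundary layers of small energy -/

namespace MetricGraph

open Filter

variable {V E : Type*} {G : MetricGraph V E} [Fintype E] {d : ℕ}

open Classical in
theorem norm_sum_endpoint_le {a : G.Endpoint → ℝ} {A : ℝ} (hA : ∀ p, |a p| ≤ A)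
    (w : G.Endpoint → EuclideanSpace ℝ (Fin d)) (e : E) :
    ‖∑ p : G.Endpoint with p.edge = e, a p • w p‖ ≤ A * ∑ p, ‖w p‖ := by
  refine (norm_sum_le _ _).trans ?_
  rw [Finset.mul_sum]
  refine (Finset.sum_le_univ_sum_of_nonneg fun p => norm_nonneg _).trans
    (Finset.sum_le_sum fun p _ => ?_)
  rw [norm_smul, Real.norm_eq_abs]
  exact mul_le_mul_of_nonneg_right (hA p) (norm_nonneg _)

open Classical in
theorem boundaryFun_zero_left (r : ℝ) (w : G.Endpoint → EuclideanSpace ℝ (Fin d)) (e : E) :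
    boundaryFun r (0, w) e = fun t => ∑ p : G.Endpoint with p.edge = e,
      (r⁻¹ * cutoffId (r * (t - p.pos))) • w p := by
  ext1 t
  simp [boundaryFun]

open Classical in
theorem deriv_boundaryFun_zero_left {r : ℝ} (hr : r ≠ 0)
    (w : G.Endpoint → EuclideanSpace ℝ (Fin d)) (e : E) :
    deriv (boundaryFun r (0, w) e) = fun t => ∑ p : G.Endpoint with p.edge = e,
      deriv cutoffId (r * (t - p.pos)) • w p := by
  ext1 t
  rw [boundaryFun_zero_left]
  refine (HasDerivAt.fun_sum fun p _ => ?_).deriv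
  have := ((hasDerivAt_rescale contDiff_cutoffId r p.pos t).const_mul r⁻¹).smul_const (w p)
  rwa [← mul_assoc, inv_mul_cancel₀ hr, one_mul] at this

open Classical in
theorem deriv_deriv_boundaryFun_zero_left {r : ℝ} (hr : r ≠ 0)
    (w : G.Endpoint → EuclideanSpace ℝ (Fin d)) (e : E) :
    deriv (deriv (boundaryFun r (0, w) e)) = fun t => ∑ p : G.Endpoint with p.edge = e,
      (r * deriv (deriv cutoffId) (r * (t - p.pos))) • w p := by
  ext1 t
  rw [deriv_boundaryFun_zero_left hr]
  exact (HasDerivAt.fun_sum fun p _ =>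
    (hasDerivAt_rescale contDiff_cutoffId.deriv_infty r p.pos t).smul_const (w p)).deriv

variable (G) in
/-- The `r`-neighbourhood of the set of endpoints. -/
def nearEndpoints (r : ℝ) : Set ℝ := ⋃ p : G.Endpoint, Metric.closedBall p.pos r

theorem isCompact_nearEndpoints (r : ℝ) : IsCompact (G.nearEndpoints r) :=
  isCompact_iUnion fun _ => isCompact_closedBall _ _

theorem boundaryFun_eq_zero {r : ℝ} (hr : 0 < r) (z : G.BoundaryData d) (e : E) {t : ℝ}
    (ht : t ∉ G.nearEndpoints r⁻¹) : boundaryFun r z e t = 0 := by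
  classical
  refine Finset.sum_eq_zero fun p _ => ?_
  have h1 : r⁻¹ < |t - p.pos| := by
    simp only [nearEndpoints, mem_iUnion, not_exists] at ht
    simpa [Real.dist_eq] using ht p
  have h2 : 1 ≤ |r * (t - p.pos)| := by
    rw [abs_mul, abs_of_pos hr]
    have := mul_lt_mul_of_pos_left h1 hr
    rw [mul_inv_cancel₀ hr.ne'] at this
    exact this.le
  rw [cutoff_eq_zero h2, cutoffId_eq_zero h2]
  simp

theorem abs_setIntegral_le (e : E) {f : ℝ → ℝ} {r C : ℝ} (hr : 0 ≤ r) (hC : 0 ≤ C)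
    (hf : ∀ t ∈ G.edge e, t ∈ G.nearEndpoints r → |f t| ≤ C)
    (hf0 : ∀ t, t ∉ G.nearEndpoints r → f t = 0) :
    |∫ t in G.edge e, f t| ≤ C * (Nat.card G.Endpoint * (2 * r)) := by
  classical
  rw [setIntegral_eq_of_subset_of_forall_sdiff_eq_zero (s := G.edge e ∩ G.nearEndpoints r)
    (G.measurableSet_edge e) inter_subset_left fun t ht => hf0 t fun h => ht.2 ⟨ht.1, h⟩]
  have hfin : volume (G.nearEndpoints r) < ⊤ := (isCompact_nearEndpoints r).measure_lt_top
  refine (norm_setIntegral_le_of_norm_le_const (f := f) (C := C)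
    ((measure_mono inter_subset_right).trans_lt hfin) fun t ht => hf t ht.1 ht.2).trans ?_
  refine mul_le_mul_of_nonneg_left ?_ hC
  refine (measureReal_mono inter_subset_right hfin.ne).trans ?_
  refine (measureReal_iUnion_fintype_le _).trans ?_
  simp [Measure.real, Real.volume_closedBall, hr]

end MetricGraph

namespace SLCoeff

open Filter MetricGraph

variable {V E : Type*} {G : MetricGraph V E} {d : ℕ} (c : SLCoeff G d) [Fintype E]

/-- Bounds for the boundary layer with vanishing boundary values. -/
theorem exists_bound_boundaryFun (w : G.Endpoint → EuclideanSpace ℝ (Fin d)) (e : E) :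
    ∃ C, 0 ≤ C ∧ ∀ r : ℝ, 1 ≤ r → ∀ t ∈ G.edge e, t ∈ G.nearEndpoints r⁻¹ →
      ‖boundaryFun r (0, w) e t‖ ≤ C * r⁻¹ ∧
      ‖c.expandedExpr e (boundaryFun r (0, w) e) t‖ ≤ C * r := by
  classical
  have hk := contDiff_cutoffId
  have hkc := hasCompactSupport_cutoffId
  obtain ⟨C₀, hC₀⟩ := hk.continuous.bounded_above_of_compact_support hkc
  obtain ⟨C₁, hC₁⟩ := hk.deriv_infty.continuous.bounded_above_of_compact_support hkc.deriv
  obtain ⟨C₂, hC₂⟩ :=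
    hk.deriv_infty.deriv_infty.continuous.bounded_above_of_compact_support hkc.deriv.deriv
  have hK : IsCompact (G.edge e ∩ G.nearEndpoints 1) :=
    (isCompact_nearEndpoints 1).inter_left (G.isClosed_edge e)
  obtain ⟨M₂, hM₂⟩ := hK.exists_bound_of_continuousOn
    ((c.contDiffOn_P e).continuousOn.mono inter_subset_left)
  obtain ⟨M₁, hM₁⟩ := hK.exists_bound_of_continuousOn
    ((c.continuousOn_coeffOne e).mono inter_subset_left)
  obtain ⟨M₀, hM₀⟩ := hK.exists_bound_of_continuousOn
    ((c.continuousOn_coeffZero e).mono inter_subset_left)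
  set S := ∑ p, ‖w p‖ with hS
  have hS0 : 0 ≤ S := Finset.sum_nonneg fun p _ => norm_nonneg _
  have hC₀' : 0 ≤ C₀ := (norm_nonneg _).trans (hC₀ 0)
  have hC₁' : 0 ≤ C₁ := (norm_nonneg _).trans (hC₁ 0)
  have hC₂' : 0 ≤ C₂ := (norm_nonneg _).trans (hC₂ 0)
  refine ⟨C₀ * S + |M₂| * (C₂ * S) + |M₁| * (C₁ * S) + |M₀| * (C₀ * S), by positivity,
    fun r hr t hte htn => ?_⟩
  have hr0 : 0 < r := one_pos.trans_le hr
  have hrinv : r⁻¹ ≤ 1 := inv_le_one_of_one_le₀ hr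
  have b0 : ‖boundaryFun r (0, w) e t‖ ≤ r⁻¹ * C₀ * S := by
    rw [boundaryFun_zero_left]
    refine norm_sum_endpoint_le (fun p => ?_) w e
    rw [abs_mul, abs_of_pos (inv_pos.2 hr0)]
    exact mul_le_mul_of_nonneg_left (hC₀ _) (inv_pos.2 hr0).le
  have b1 : ‖deriv (boundaryFun r (0, w) e) t‖ ≤ C₁ * S := by
    rw [deriv_boundaryFun_zero_left hr0.ne']
    exact norm_sum_endpoint_le (fun p => hC₁ _) w e
  have b2 : ‖deriv (deriv (boundaryFun r (0, w) e)) t‖ ≤ r * C₂ * S := by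
    rw [deriv_deriv_boundaryFun_zero_left hr0.ne']
    refine norm_sum_endpoint_le (fun p => ?_) w e
    rw [abs_mul, abs_of_pos hr0]
    exact mul_le_mul_of_nonneg_left (hC₂ _) hr0.le
  have htn1 : t ∈ G.nearEndpoints 1 := by
    obtain ⟨p, hp⟩ := mem_iUnion.1 htn
    exact mem_iUnion.2 ⟨p, Metric.closedBall_subset_closedBall hrinv hp⟩
  have m2 := (hM₂ t ⟨hte, htn1⟩).trans (le_abs_self _)
  have m1 := (hM₁ t ⟨hte, htn1⟩).trans (le_abs_self _)
  have m0 := (hM₀ t ⟨hte, htn1⟩).trans (le_abs_self _)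
  constructor
  · refine b0.trans ?_
    have : 0 ≤ |M₂| * (C₂ * S) + |M₁| * (C₁ * S) + |M₀| * (C₀ * S) := by positivity
    calc r⁻¹ * C₀ * S = C₀ * S * r⁻¹ := by ring
      _ ≤ _ := mul_le_mul_of_nonneg_right (by linarith) (inv_pos.2 hr0).le
  · have t2 : ‖c.P e t (deriv (deriv (boundaryFun r (0, w) e)) t)‖ ≤ |M₂| * (r * C₂ * S) :=
      (ContinuousLinearMap.le_opNorm _ _).trans (mul_le_mul m2 b2 (norm_nonneg _) (abs_nonneg _))
    have t1 : ‖c.coeffOne e t (deriv (boundaryFun r (0, w) e) t)‖ ≤ |M₁| * (C₁ * S) :=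
      (ContinuousLinearMap.le_opNorm _ _).trans (mul_le_mul m1 b1 (norm_nonneg _) (abs_nonneg _))
    have t0 : ‖c.coeffZero e t (boundaryFun r (0, w) e t)‖ ≤ |M₀| * (r⁻¹ * C₀ * S) :=
      (ContinuousLinearMap.le_opNorm _ _).trans (mul_le_mul m0 b0 (norm_nonneg _) (abs_nonneg _))
    have t3 : ‖c.expandedExpr e (boundaryFun r (0, w) e) t‖ ≤
        |M₂| * (r * C₂ * S) + |M₁| * (C₁ * S) + |M₀| * (r⁻¹ * C₀ * S) := by
      refine (norm_add_le _ _).trans (add_le_add ((norm_add_le _ _).trans (add_le_add ?_ t1)) t0)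
      rwa [norm_neg]
    refine t3.trans ?_
    have e1 : |M₁| * (C₁ * S) ≤ |M₁| * (C₁ * S) * r := le_mul_of_one_le_right (by positivity) hr
    have e0 : |M₀| * (r⁻¹ * C₀ * S) ≤ |M₀| * (C₀ * S) * r := by
      calc |M₀| * (r⁻¹ * C₀ * S) = |M₀| * (C₀ * S) * r⁻¹ := by ring
        _ ≤ _ := mul_le_mul_of_nonneg_left (hrinv.trans hr) (by positivity)
    have e2 : 0 ≤ C₀ * S * r := by positivity
    nlinarith

/-- Bounded functions supported near the endpoints have small integrals, as the measure of their
supports tends to zero. -/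
theorem tendsto_sum_setIntegral {f : ℕ → E → ℝ → ℝ}
    (hf : ∀ e, ∃ C, 0 ≤ C ∧ ∀ n : ℕ, ∀ t ∈ G.edge e, t ∈ G.nearEndpoints ((n : ℝ) + 1)⁻¹ →
      |f n e t| ≤ C)
    (hf0 : ∀ (n : ℕ) e t, t ∉ G.nearEndpoints ((n : ℝ) + 1)⁻¹ → f n e t = 0) :
    Tendsto (fun n => ∑ e, ∫ t in G.edge e, f n e t) atTop (𝓝 0) := by
  rw [← Finset.sum_const_zero (s := (Finset.univ : Finset E))]
  refine tendsto_finsetSum _ fun e _ => ?_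
  obtain ⟨C, hC, hfC⟩ := hf e
  refine squeeze_zero_norm (a := fun n : ℕ => C * (Nat.card G.Endpoint * (2 * ((n : ℝ) + 1)⁻¹)))
    (fun n => abs_setIntegral_le e (by positivity) hC (hfC n) (hf0 n e)) ?_
  have h1 : Tendsto (fun n : ℕ => ((n : ℝ) + 1)⁻¹) atTop (𝓝 0) := by
    simpa using tendsto_one_div_add_atTop_nhds_zero_nat (𝕜 := ℝ)
  simpa using ((h1.const_mul 2).const_mul (Nat.card G.Endpoint : ℝ)).const_mul C

theorem tendsto_maximalLift (w : G.Endpoint → EuclideanSpace ℝ (Fin d)) :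
    Tendsto (fun n => (c.maximalLift n (0, w) : G.L2 d)) atTop (𝓝 0) := by
  rw [tendsto_zero_iff_norm_tendsto_zero]
  have h2 : Tendsto (fun n => ‖(c.maximalLift n (0, w) : G.L2 d)‖ ^ 2) atTop (𝓝 0) := by
    have h3 : ∀ n, ‖(c.maximalLift n (0, w) : G.L2 d)‖ ^ 2 = ∑ e, ∫ t in G.edge e,
        ⟪boundaryFun ((n : ℝ) + 1) (0, w) e t, boundaryFun ((n : ℝ) + 1) (0, w) e t⟫_ℝ := by
      intro n
      rw [← real_inner_self_eq_norm_sq]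
      exact G.inner_toLp_toLp (G.memLp_smooth (boundaryLift d n (0, w)).2)
        (G.memLp_smooth (boundaryLift d n (0, w)).2)
    simp only [h3]
    refine tendsto_sum_setIntegral (fun e => ?_) fun n e t ht => ?_
    · obtain ⟨C, hC, h⟩ := c.exists_bound_boundaryFun w e
      refine ⟨C ^ 2, by positivity, fun n t hte htn => ?_⟩
      have hr : (1 : ℝ) ≤ n + 1 := by simp
      have h4 : ‖boundaryFun ((n : ℝ) + 1) (0, w) e t‖ ≤ C :=
        (h _ hr t hte htn).1.trans (mul_le_of_le_one_right hC (inv_le_one_of_one_le₀ hr))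
      rw [real_inner_self_eq_norm_sq, abs_of_nonneg (by positivity)]
      exact pow_le_pow_left₀ (norm_nonneg _) h4 2
    · rw [boundaryFun_eq_zero (by positivity) _ _ ht, inner_zero_left]
  have := h2.sqrt
  simpa [Real.sqrt_sq (norm_nonneg _)] using this

/-- The boundary layers with vanishing boundary values have small energy: a layer of width `1 / n`
is of size `1 / n`, and `ℓ` of it of size `n`, so that the integrand is bounded. -/
theorem tendsto_inner_maximalLift (hd : Dense (c.minimal.domain : Set (G.L2 d)))
    (w : G.Endpoint → EuclideanSpace ℝ (Fin d)) :
    Tendsto (fun n => ⟪c.maximal (c.maximalLift n (0, w)), (c.maximalLift n (0, w) : G.L2 d)⟫_ℝ)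
      atTop (𝓝 0) := by
  have h3 : ∀ n, ⟪c.maximal (c.maximalLift n (0, w)), (c.maximalLift n (0, w) : G.L2 d)⟫_ℝ =
      ∑ e, ∫ t in G.edge e, ⟪c.expandedExpr e (boundaryFun ((n : ℝ) + 1) (0, w) e) t,
        boundaryFun ((n : ℝ) + 1) (0, w) e t⟫_ℝ := by
    intro n
    rw [maximalLift, LinearMap.comp_apply, c.maximal_smoothToMaximal hd]
    exact G.inner_toLp_toLp (c.memLp_expandedExpr (boundaryLift d n (0, w)).2)
      (G.memLp_smooth (boundaryLift d n (0, w)).2)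
  simp only [h3]
  refine tendsto_sum_setIntegral (fun e => ?_) fun n e t ht => ?_
  · obtain ⟨C, hC, h⟩ := c.exists_bound_boundaryFun w e
    refine ⟨C * C, by positivity, fun n t hte htn => ?_⟩
    have hr : (1 : ℝ) ≤ n + 1 := by simp
    have hr0 : (0 : ℝ) < n + 1 := by positivity
    obtain ⟨h4, h5⟩ := h _ hr t hte htn
    refine (abs_real_inner_le_norm _ _).trans ((mul_le_mul h5 h4 (norm_nonneg _)
      (by positivity)).trans (le_of_eq ?_))
    rw [mul_mul_mul_comm, mul_inv_cancel₀ hr0.ne', mul_one]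
  · rw [boundaryFun_eq_zero (by positivity) _ _ ht, inner_zero_right]

end SLCoeff

/-! ### Gronwall's inequality -/

section Gronwall

open Filter

/-- Gronwall's inequality in integral form. The interval of integration may be on either side of
the initial point. -/
theorem le_mul_exp_of_le_abs_integral {u : ℝ → ℝ} (hu : Continuous u) (hu0 : ∀ t, 0 ≤ u t)
    {M δ : ℝ} (hM : 0 ≤ M) (hδ : 0 ≤ δ) {p q : ℝ}
    (h : ∀ t ∈ uIcc p q, u t ≤ δ + M * |∫ s in p..t, u s|) {t : ℝ} (ht : t ∈ uIcc p q) :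
    u t ≤ δ * Real.exp (M * |t - p|) := by
  have key : ∀ {v : ℝ → ℝ} (_ : Continuous v) (_ : ∀ t, 0 ≤ v t) {a b : ℝ}
      (_ : ∀ t ∈ Icc a b, v t ≤ δ + M * |∫ s in a..t, v s|) {t : ℝ} (_ : t ∈ Icc a b),
      v t ≤ δ * Real.exp (M * (t - a)) := by
    intro v hv hv0 a b h t ht
    have hI : ∀ t ∈ Icc a b, 0 ≤ ∫ s in a..t, v s := fun t ht =>
      intervalIntegral.integral_nonneg ht.1 fun s _ => hv0 s
    have hd : ∀ t, HasDerivAt (fun t => δ + M * ∫ s in a..t, v s) (M * v t) t := fun t =>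
      ((hv.integral_hasStrictDerivAt a t).hasDerivAt.const_mul M).const_add δ
    have h1 := norm_le_gronwallBound_of_norm_deriv_right_le
      (f := fun t => δ + M * ∫ s in a..t, v s) (δ := δ) (K := M) (ε := 0) (a := a) (b := b)
      (fun t _ => (hd t).continuousAt.continuousWithinAt) (fun t _ => (hd t).hasDerivWithinAt)
      (by simp [abs_of_nonneg hδ]) (fun t ht => ?_) t ht
    · rw [gronwallBound_ε0] at h1
      refine ((h t ht).trans ?_).trans h1
      rw [abs_of_nonneg (hI t ht)]
      exact le_abs_self _
    · have h2 := hI t (Ico_subset_Icc_self ht)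
      have h3 := h t (Ico_subset_Icc_self ht)
      rw [abs_of_nonneg h2] at h3
      rw [Real.norm_eq_abs, Real.norm_eq_abs, abs_of_nonneg (mul_nonneg hM (hv0 t)), add_zero,
        abs_of_nonneg (by positivity)]
      exact mul_le_mul_of_nonneg_left h3 hM
  rcases le_total p q with hpq | hpq
  · rw [uIcc_of_le hpq] at h ht
    rw [abs_of_nonneg (sub_nonneg.2 ht.1)]
    exact key hu hu0 h ht
  · rw [uIcc_of_ge hpq] at h ht
    have h1 := key (v := fun s => u (-s)) (hu.comp continuous_neg) (fun s => hu0 _) (a := -p)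
      (b := -q) (fun s hs => ?_) (t := -t) ⟨neg_le_neg ht.2, neg_le_neg ht.1⟩
    · rw [neg_neg] at h1
      rw [abs_of_nonpos (sub_nonpos.2 ht.2)]
      convert h1 using 3
      ring
    · have h2 := h (-s) ⟨by linarith [hs.2], by linarith [hs.1]⟩
      rwa [intervalIntegral.integral_comp_neg u, neg_neg, intervalIntegral.integral_symm, abs_neg]

end Gronwall

/-! ### Functions in the domain of the minimal operator vanish at the endpoints -/

namespace MetricGraph

open Filter

variable {V E : Type*} (G : MetricGraph V E)

theorem exists_endpoint (e : E) : ∃ p : G.Endpoint, p.edge = e := by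
  rcases G.edge_cases e with ⟨a, b, hab, ha, hb⟩ | ⟨a, ha, hb⟩ | ⟨b, ha, hb⟩
  · exact (Endpoint.exists_of_coe_eq (t := a) (Or.inl ha.symm)).imp fun _ h => h.1
  · exact (Endpoint.exists_of_coe_eq (t := a) (Or.inl ha.symm)).imp fun _ h => h.1
  · exact (Endpoint.exists_of_coe_eq (t := b) (Or.inr hb.symm)).imp fun _ h => h.1

theorem ordConnected_edge (e : E) : (G.edge e).OrdConnected :=
  ⟨fun _ hs _ ht _ hr => ⟨hs.1.trans (EReal.coe_le_coe_iff.2 hr.1),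
    (EReal.coe_le_coe_iff.2 hr.2).trans ht.2⟩⟩

variable {G} in
theorem Endpoint.uIcc_subset (p : G.Endpoint) {q : ℝ} (hq : q ∈ G.edge p.edge) :
    uIcc p.pos q ⊆ G.edge p.edge :=
  (G.ordConnected_edge p.edge).uIcc_subset p.pos_mem hq

variable {G} in
/-- The intervals from a finite endpoint exhaust the edge. -/
theorem Endpoint.exists_uIcc_mem_nhdsWithin (p : G.Endpoint) {t : ℝ} (ht : t ∈ G.edge p.edge) :
    ∃ q ∈ G.edge p.edge, uIcc p.pos q ∈ 𝓝[G.edge p.edge] t := by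
  have hp := p.coe_pos
  rcases G.edge_cases p.edge with ⟨a, b, hab, ha, hb⟩ | ⟨a, ha, hb⟩ | ⟨b, ha, hb⟩
  · rw [ha, hb, EReal.coe_eq_coe_iff, EReal.coe_eq_coe_iff] at hp
    rw [G.edge_eq_Icc ha hb] at *
    rcases hp with hp | hp
    · refine ⟨b, right_mem_Icc.2 hab.le, ?_⟩
      rw [hp, uIcc_of_le hab.le]
      exact self_mem_nhdsWithin
    · refine ⟨a, left_mem_Icc.2 hab.le, ?_⟩
      rw [hp, uIcc_of_ge hab.le]
      exact self_mem_nhdsWithin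
  · simp only [ha, hb, EReal.coe_eq_coe_iff, EReal.coe_ne_top, or_false] at hp
    rw [G.edge_eq_Ici ha hb] at *
    rw [mem_Ici] at ht
    refine ⟨t + 1, by rw [mem_Ici]; linarith, ?_⟩
    rw [hp, uIcc_of_le (by linarith), ← Ici_inter_Iic]
    exact inter_mem self_mem_nhdsWithin (mem_nhdsWithin_of_mem_nhds (Iic_mem_nhds (by linarith)))
  · simp only [ha, hb, EReal.coe_eq_coe_iff, EReal.coe_ne_bot, false_or] at hp
    rw [G.edge_eq_Iic ha hb] at *
    rw [mem_Iic] at ht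
    refine ⟨t - 1, by rw [mem_Iic]; linarith, ?_⟩
    rw [hp, uIcc_of_ge (by linarith), ← Ici_inter_Iic, inter_comm]
    exact inter_mem self_mem_nhdsWithin (mem_nhdsWithin_of_mem_nhds (Ici_mem_nhds (by linarith)))

variable {G} in
theorem Endpoint.notMem_openEdge (p : G.Endpoint) : p.pos ∉ G.openEdge p.edge := fun h =>
  p.coe_pos.elim (fun h1 => h.1.ne h1.symm) fun h1 => h.2.ne h1

/-- On a compact interval the `L¹`-norm is controlled by the `L²`-norm. -/
theorem exists_integral_norm_le {F : Type*} [NormedAddCommGroup F] {e : E} {p q : ℝ}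
    (hJ : uIcc p q ⊆ G.edge e) : ∃ C, 0 ≤ C ∧ ∀ (f : ℝ → F)
      (hf : MemLp f 2 (volume.restrict (G.edge e))),
      |∫ t in p..q, ‖f t‖| ≤ C * ‖hf.toLp f‖ := by
  have hJ' : uIoc p q ⊆ G.edge e := uIoc_subset_uIcc.trans hJ
  set μ := volume.restrict (uIoc p q) with hμ
  have hfin : IsFiniteMeasure μ := by
    refine ⟨?_⟩
    rw [hμ, Measure.restrict_apply_univ]
    exact (measure_mono uIoc_subset_uIcc).trans_lt isCompact_uIcc.measure_lt_top
  set K := μ univ ^ (1 / (1 : ENNReal).toReal - 1 / (2 : ENNReal).toReal) with hK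
  have hKt : K ≠ ⊤ := by
    refine ENNReal.rpow_ne_top_of_nonneg ?_ (measure_ne_top _ _)
    norm_num
  refine ⟨K.toReal, ENNReal.toReal_nonneg, fun f hf => ?_⟩
  have hf' : MemLp f 2 μ := hf.mono_measure (Measure.restrict_mono hJ' le_rfl)
  have h1 : |∫ t in p..q, ‖f t‖| = (eLpNorm f 1 μ).toReal := by
    rw [intervalIntegral.abs_integral_eq_abs_integral_uIoc,
      abs_of_nonneg (integral_nonneg fun t => norm_nonneg _), eLpNorm_one_eq_lintegral_enorm,
      integral_norm_eq_lintegral_enorm hf'.1]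
  rw [h1, Lp.norm_toLp, mul_comm, ← ENNReal.toReal_mul]
  refine ENNReal.toReal_mono (ENNReal.mul_ne_top hf.eLpNorm_ne_top hKt) ?_
  exact (eLpNorm_le_eLpNorm_mul_rpow_measure_univ one_le_two hf'.1).trans
    (mul_le_mul_left (eLpNorm_mono_measure f (Measure.restrict_mono hJ' le_rfl)) _)

end MetricGraph

namespace SLCoeff

open Filter MetricGraph

variable {V E : Type*} {G : MetricGraph V E} {d : ℕ} (c : SLCoeff G d)

/-- `P` is uniformly positive on compact subsets of the edges. -/
theorem exists_coercive {e : E} {J : Set ℝ} (hJ : IsCompact J) (hJe : J ⊆ G.edge e) :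
    ∃ m, 0 < m ∧ ∀ t ∈ J, ∀ v, m * ‖v‖ ≤ ‖c.P e t v‖ := by
  have hK : IsCompact (J ×ˢ Metric.sphere (0 : EuclideanSpace ℝ (Fin d)) 1) :=
    hJ.prod (isCompact_sphere _ _)
  have hcont : ContinuousOn (fun z : ℝ × EuclideanSpace ℝ (Fin d) => ‖c.P e z.1 z.2‖)
      (J ×ˢ Metric.sphere (0 : EuclideanSpace ℝ (Fin d)) 1) :=
    (((((c.contDiffOn_P e).continuousOn.mono hJe).comp continuousOn_fst fun z hz => hz.1)).clm_apply
      continuousOn_snd).norm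
  obtain ⟨m, hm, hmb⟩ : ∃ m, 0 < m ∧ ∀ z ∈ J ×ˢ Metric.sphere (0 : EuclideanSpace ℝ (Fin d)) 1,
      m ≤ ‖c.P e z.1 z.2‖ := by
    rcases (J ×ˢ Metric.sphere (0 : EuclideanSpace ℝ (Fin d)) 1).eq_empty_or_nonempty with h0 | hne
    · exact ⟨1, one_pos, fun z hz => by rw [h0] at hz; exact hz.elim⟩
    · obtain ⟨z, hz, hmin⟩ := hK.exists_isMinOn hne hcont
      refine ⟨_, norm_pos_iff.2 fun h0 => ?_, fun y hy => hmin hy⟩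
      have hz2 : z.2 ≠ 0 := by
        intro h
        have := hz.2
        simp [h] at this
      have := c.pos_P e z.1 (hJe hz.1) z.2 hz2
      rw [h0, inner_zero_left] at this
      exact lt_irrefl _ this
  refine ⟨m, hm, fun t ht v => ?_⟩
  rcases eq_or_ne v 0 with rfl | hv
  · simp
  · have hn : ‖v‖ ≠ 0 := norm_ne_zero_iff.2 hv
    have h1 := hmb (t, ‖v‖⁻¹ • v) ⟨ht, by simp [norm_smul, inv_mul_cancel₀ hn]⟩
    simp only [map_smul, norm_smul, norm_inv, norm_norm] at h1
    rwa [inv_mul_eq_div, le_div_iff₀ (norm_pos_iff.2 hv)] at h1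

variable [Fintype E]

/-- A test function is controlled by its image under `ℓ`: together with its quasi-derivative it
solves a first order system with zero initial value at a finite endpoint. -/
theorem exists_norm_test_le (p : G.Endpoint) {q : ℝ} (hq : q ∈ G.edge p.edge) :
    ∃ C, 0 ≤ C ∧ ∀ φ : G.testSpace d, ∀ t ∈ uIcc p.pos q,
      ‖φ.1 p.edge t‖ ≤ C * ‖c.exprToL2 φ‖ := by
  set e := p.edge with he
  have hJe : uIcc p.pos q ⊆ G.edge e := p.uIcc_subset hq
  have hJ : IsCompact (uIcc p.pos q) := isCompact_uIcc
  obtain ⟨m, hm, hmP⟩ := c.exists_coercive hJ hJe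
  obtain ⟨MQ, hMQ⟩ := hJ.exists_bound_of_continuousOn ((c.contDiffOn_Q e).continuousOn.mono hJe)
  obtain ⟨MR, hMR⟩ := hJ.exists_bound_of_continuousOn ((c.continuousOn_R e).mono hJe)
  obtain ⟨CJ, hCJ, hint⟩ := G.exists_integral_norm_le (F := EuclideanSpace ℝ (Fin d)) hJe
  have hMQ0 : 0 ≤ MQ := (norm_nonneg _).trans (hMQ _ left_mem_uIcc)
  have hMR0 : 0 ≤ MR := (norm_nonneg _).trans (hMR _ left_mem_uIcc)
  set B := m⁻¹ * (1 + MQ) with hB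
  have hB0 : 0 ≤ B := by positivity
  set M := B + (MQ * B + MR) with hMdef
  have hM0 : 0 ≤ M := by positivity
  refine ⟨CJ * Real.exp (M * |q - p.pos|), by positivity, fun φ t ht => ?_⟩
  have hφ := (φ.2 e).1
  have hy := c.contDiff_quasiDeriv φ.2 e
  set x := φ.1 e with hx
  set y := c.quasiDeriv φ.1 e with hydef
  set u : ℝ → ℝ := fun t => ‖x t‖ + ‖y t‖ with hu
  have hx0 : x =ᶠ[𝓝 p.pos] 0 :=
    notMem_tsupport_iff_eventuallyEq.1 fun h => p.notMem_openEdge ((φ.2 e).2.2 h)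
  have hxp : x p.pos = 0 := hx0.eq_of_nhds
  have hyp : y p.pos = 0 := by
    have h1 : deriv x p.pos = 0 := by simpa using hx0.deriv_eq
    rw [hydef, quasiDeriv, ← hx, h1, hxp, map_zero, map_zero, add_zero]
  have hcu : Continuous u := hφ.continuous.norm.add hy.continuous.norm
  have hcx' : Continuous (deriv x) := hφ.deriv_infty.continuous
  have hcy' : Continuous (deriv y) := hy.continuous_deriv le_rfl
  have hcl : Continuous (c.expr φ.1 e) := c.continuous_expr φ.2 e
  have bx : ∀ s ∈ uIcc p.pos q, ‖deriv x s‖ ≤ B * u s := by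
    intro s hs
    have h1 : c.P e s (deriv x s) = y s - c.Q e s (x s) := by
      rw [hydef, quasiDeriv, add_sub_cancel_right]
    have h2 := hmP s hs (deriv x s)
    have h3 : ‖c.Q e s (x s)‖ ≤ MQ * ‖x s‖ := (c.Q e s).le_of_opNorm_le (hMQ s hs) _
    rw [h1] at h2
    have h4 : m * ‖deriv x s‖ ≤ (1 + MQ) * u s := by
      refine h2.trans ((norm_sub_le _ _).trans ?_)
      have := norm_nonneg (x s)
      have h5 := mul_nonneg hMQ0 (norm_nonneg (y s))
      simp only [hu]
      linarith
    rw [hB, mul_assoc, inv_mul_eq_div, le_div_iff₀ hm, mul_comm]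
    exact h4
  have b_y : ∀ s ∈ uIcc p.pos q, ‖deriv y s‖ ≤ (MQ * B + MR) * u s + ‖c.expr φ.1 e s‖ := by
    intro s hs
    have h1 : deriv y s = ContinuousLinearMap.adjoint (c.Q e s) (deriv x s) + c.R e s (x s) -
        c.expr φ.1 e s := by
      rw [expr]
      abel
    have h2 : ‖ContinuousLinearMap.adjoint (c.Q e s) (deriv x s)‖ ≤ MQ * (B * u s) := by
      refine ((ContinuousLinearMap.adjoint (c.Q e s)).le_opNorm _).trans ?_
      rw [LinearIsometryEquiv.norm_map]
      exact mul_le_mul (hMQ s hs) (bx s hs) (norm_nonneg _) hMQ0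
    have h3 : ‖c.R e s (x s)‖ ≤ MR * u s :=
      ((c.R e s).le_of_opNorm_le (hMR s hs) _).trans
        (mul_le_mul_of_nonneg_left (le_add_of_nonneg_right (norm_nonneg _)) hMR0)
    rw [h1]
    refine (norm_sub_le _ _).trans (add_le_add ((norm_add_le _ _).trans ?_) le_rfl)
    linarith
  have hsub : ∀ s ∈ uIcc p.pos q, uIcc p.pos s ⊆ uIcc p.pos q := fun s hs =>
    uIcc_subset_uIcc left_mem_uIcc hs
  have hgron : ∀ s ∈ uIcc p.pos q,
      u s ≤ CJ * ‖c.exprToL2 φ‖ + M * |∫ r in p.pos..s, u r| := by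
    intro s hs
    have ex : x s = ∫ r in p.pos..s, deriv x r := by
      rw [intervalIntegral.integral_eq_sub_of_hasDerivAt
        (fun r _ => hφ.hasDerivAt_infty r) (hcx'.intervalIntegrable _ _), hxp, sub_zero]
    have ey : y s = ∫ r in p.pos..s, deriv y r := by
      rw [intervalIntegral.integral_eq_sub_of_hasDerivAt
        (fun r _ => ((hy.differentiable one_ne_zero) r).hasDerivAt)
        (hcy'.intervalIntegrable _ _), hyp, sub_zero]
    have h1 : u s ≤ |∫ r in p.pos..s, ‖deriv x r‖| + |∫ r in p.pos..s, ‖deriv y r‖| := by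
      refine add_le_add ?_ ?_
      · rw [ex]; exact intervalIntegral.norm_integral_le_abs_integral_norm
      · rw [ey]; exact intervalIntegral.norm_integral_le_abs_integral_norm
    have habs : ∀ {f g : ℝ → ℝ} (_ : Continuous f) (_ : Continuous g) (_ : ∀ r, 0 ≤ f r)
        (_ : ∀ r ∈ uIcc p.pos q, f r ≤ g r),
        |∫ r in p.pos..s, f r| ≤ |∫ r in p.pos..s, g r| := by
      intro f g hf hg hf0 hfg
      rw [intervalIntegral.abs_integral_eq_abs_integral_uIoc,
        intervalIntegral.abs_integral_eq_abs_integral_uIoc,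
        abs_of_nonneg (integral_nonneg hf0)]
      refine (setIntegral_mono_on (hf.integrableOn_uIoc) hg.integrableOn_uIoc measurableSet_uIoc
        fun r hr => hfg r (hsub s hs (uIoc_subset_uIcc hr))).trans (le_abs_self _)
    have h2 := habs (g := fun r => B * u r) hcx'.norm (continuous_const.mul hcu)
      (fun r => norm_nonneg _) bx
    have h3 := habs (g := fun r => (MQ * B + MR) * u r + ‖c.expr φ.1 e r‖) hcy'.norm
      ((continuous_const.mul hcu).add hcl.norm) (fun r => norm_nonneg _) b_y
    rw [intervalIntegral.integral_const_mul, abs_mul, abs_of_nonneg hB0] at h2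
    have hi : IntervalIntegrable (fun r => (MQ * B + MR) * u r) volume p.pos s :=
      Continuous.intervalIntegrable (continuous_const.mul hcu) _ _
    rw [intervalIntegral.integral_add hi (hcl.norm.intervalIntegrable _ _),
      intervalIntegral.integral_const_mul] at h3
    have h4 : |∫ r in p.pos..s, ‖c.expr φ.1 e r‖| ≤ CJ * ‖c.exprToL2 φ‖ := by
      refine (intervalIntegral.abs_integral_mono_interval (c := p.pos) (d := q)
        (uIoc_subset_uIoc_of_uIcc_subset_uIcc (hsub s hs)) (ae_of_all _ fun r => norm_nonneg _)
        (hcl.norm.intervalIntegrable _ _)).trans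
        ((hint _ (c.memLp_expr φ.2 e)).trans (mul_le_mul_of_nonneg_left ?_ hCJ))
      exact PiLp.norm_apply_le (c.exprToL2 φ) e
    have h5 := h3.trans (abs_add_le _ _)
    rw [abs_mul, abs_of_nonneg (by positivity : 0 ≤ MQ * B + MR)] at h5
    rw [hMdef, add_mul]
    linarith
  have h6 := le_mul_exp_of_le_abs_integral hcu (fun s => by positivity) hM0 (by positivity) hgron ht
  have h7 : |t - p.pos| ≤ |q - p.pos| := abs_sub_left_of_mem_uIcc ht
  calc ‖x t‖ ≤ u t := le_add_of_nonneg_right (norm_nonneg _)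
    _ ≤ CJ * ‖c.exprToL2 φ‖ * Real.exp (M * |t - p.pos|) := h6
    _ ≤ CJ * ‖c.exprToL2 φ‖ * Real.exp (M * |q - p.pos|) :=
      mul_le_mul_of_nonneg_left (Real.exp_le_exp.2 (mul_le_mul_of_nonneg_left h7 hM0))
        (by positivity)
    _ = _ := by ring

/-- A sequence of test functions that converges in the graph norm converges locally uniformly on the
closed edges, endpoints included. -/
theorem minimal_domain_le_vanishingTrace : c.minimal.domain ≤ vanishingTrace G d := by
  intro x hx e
  obtain ⟨p, rfl⟩ := G.exists_endpoint e
  obtain ⟨φ, h1, h2⟩ := c.exists_seq_test ⟨x, hx⟩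
  have hcauchy : ∀ q ∈ G.edge p.edge,
      UniformCauchySeqOn (fun n => (φ n).1 p.edge) atTop (uIcc p.pos q) := by
    intro q hq
    obtain ⟨C, hC, hbound⟩ := c.exists_norm_test_le p hq
    rw [Metric.uniformCauchySeqOn_iff]
    intro ε hε
    obtain ⟨N, hN⟩ := Metric.cauchySeq_iff.1 h2.cauchySeq (ε / (C + 1)) (by positivity)
    refine ⟨N, fun m hm n hn t ht => ?_⟩
    have h3 := hbound (φ m - φ n) t ht
    have h4 := hN m hm n hn
    rw [map_sub] at h3
    rw [dist_eq_norm] at h4 ⊢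
    have h5 : C * ‖c.exprToL2 (φ m) - c.exprToL2 (φ n)‖ ≤
        (C + 1) * ‖c.exprToL2 (φ m) - c.exprToL2 (φ n)‖ := by
      gcongr
      linarith
    refine (h3.trans h5).trans_lt ?_
    rwa [lt_div_iff₀' (by positivity)] at h4
  have hlim : ∀ t, ∃ y, t ∈ G.edge p.edge →
      Tendsto (fun n => (φ n).1 p.edge t) atTop (𝓝 y) := by
    intro t
    by_cases ht : t ∈ G.edge p.edge
    · obtain ⟨y, hy⟩ := cauchySeq_tendsto_of_complete ((hcauchy t ht).cauchySeq right_mem_uIcc)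
      exact ⟨y, fun _ => hy⟩
    · exact ⟨0, fun h => absurd h ht⟩
  choose g hg using hlim
  refine ⟨g, fun t ht => ?_, ?_, fun t ht => ?_⟩
  · obtain ⟨q, hq, hmem⟩ := p.exists_uIcc_mem_nhdsWithin ht
    have h3 : TendstoUniformlyOn (fun n => (φ n).1 p.edge) g atTop (uIcc p.pos q) :=
      (hcauchy q hq).tendstoUniformlyOn_of_tendsto fun s hs => hg s (p.uIcc_subset hq hs)
    have h4 : ContinuousOn g (uIcc p.pos q) :=
      h3.continuousOn (Frequently.of_forall fun n => ((φ n).2 p.edge).1.continuous.continuousOn)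
    exact (h4 t (mem_of_mem_nhdsWithin ht hmem)).mono_of_mem_nhdsWithin hmem
  · have h3 : Tendsto (fun n => testToL2 G d (φ n) p.edge) atTop (𝓝 (x p.edge)) :=
      ((PiLp.continuous_apply 2 _ p.edge).tendsto x).comp h1
    obtain ⟨ns, hns, hae⟩ := (tendstoInMeasure_of_tendsto_Lp h3).exists_seq_tendsto_ae
    have h4 : ∀ᵐ t ∂volume.restrict (G.edge p.edge), ∀ n,
        testToL2 G d (φ n) p.edge t = (φ n).1 p.edge t :=
      ae_all_iff.2 fun n => (memLp_test (φ n).2 p.edge).coeFn_toLp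
    filter_upwards [hae, h4, ae_restrict_mem (G.measurableSet_edge p.edge)] with t ht1 ht2 ht3
    simp only [ht2] at ht1
    exact tendsto_nhds_unique ht1 ((hg t ht3).comp hns.tendsto_atTop)
  · obtain ⟨p', hp', rfl⟩ := Endpoint.exists_of_coe_eq ht
    have hmem : p'.pos ∈ G.edge p.edge := hp' ▸ p'.pos_mem
    refine tendsto_nhds_unique (hg _ hmem) ?_
    have : ∀ n, (φ n).1 p.edge p'.pos = 0 := fun n =>
      image_eq_zero_of_notMem_tsupport fun h =>
        p'.notMem_openEdge (hp' ▸ ((φ n).2 p.edge).2.2 h)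
    simp only [this]
    exact tendsto_const_nhds

theorem maximalLift_mem_vanishingTrace_iff {n : ℕ} (hn : G.Separates (n + 1))
    (z : G.BoundaryData d) :
    (c.maximalLift n z : G.L2 d) ∈ vanishingTrace G d ↔ z.1 = 0 := by
  have hsm := boundaryFun_mem (G := G) (r := (n : ℝ) + 1) (by positivity) z
  have hae : ∀ e, (c.maximalLift n z : G.L2 d) e =ᵐ[volume.restrict (G.edge e)]
      boundaryFun (n + 1) z e := fun e => (G.memLp_smooth hsm e).coeFn_toLp
  constructor
  · refine fun h => funext fun p => ?_
    obtain ⟨g, hg, hxg, hg0⟩ := h p.edge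
    have h1 := Measure.eqOn_of_ae_eq ((hae p.edge).symm.trans hxg)
      (hsm p.edge).1.continuous.continuousOn hg (G.edge_subset_closure_interior p.edge) p.pos_mem
    rw [hg0 _ p.coe_pos, hn.boundaryFun_pos] at h1
    exact h1
  · refine fun hz e => ⟨_, (hsm e).1.continuous.continuousOn, hae e, fun t ht => ?_⟩
    obtain ⟨p, rfl, rfl⟩ := Endpoint.exists_of_coe_eq ht
    rw [hn.boundaryFun_pos, hz, Pi.zero_apply]

end SLCoeff

/-! ### Weak derivatives on an interval -/

section DuBoisReymond

/-- Smooth real functions with compact support in `(a, b)`. -/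
def bumpSpace (a b : ℝ) : Submodule ℝ (ℝ → ℝ) where
  carrier := {ψ | ContDiff ℝ ∞ ψ ∧ HasCompactSupport ψ ∧ tsupport ψ ⊆ Ioo a b}
  add_mem' {φ ψ} hφ hψ := ⟨hφ.1.add hψ.1, hφ.2.1.add hψ.2.1,
    (tsupport_add φ ψ).trans (union_subset hφ.2.2 hψ.2.2)⟩
  zero_mem' := ⟨contDiff_const, HasCompactSupport.zero, by simp⟩
  smul_mem' r φ hφ := ⟨hφ.1.const_smul r, hφ.2.1.smul_left (f := fun _ => r),
    (tsupport_smul_subset_right (fun _ => r) φ).trans hφ.2.2⟩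

variable {a b : ℝ} {ψ : ℝ → ℝ}

theorem deriv_mem_bumpSpace (hψ : ψ ∈ bumpSpace a b) : deriv ψ ∈ bumpSpace a b :=
  ⟨hψ.1.deriv_infty, hψ.2.1.deriv, tsupport_deriv_subset.trans hψ.2.2⟩

theorem eq_zero_of_mem_bumpSpace (hψ : ψ ∈ bumpSpace a b) {t : ℝ} (ht : t ∉ Ioo a b) : ψ t = 0 :=
  image_eq_zero_of_notMem_tsupport fun h => ht (hψ.2.2 h)

theorem exists_bump_integral_eq_one (hab : a < b) :
    ∃ η ∈ bumpSpace a b, ∫ t in a..b, η t = 1 := by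
  let β : ContDiffBump ((a + b) / 2) := ⟨(b - a) / 8, (b - a) / 4, by linarith, by linarith⟩
  have hsub : tsupport (β.normed volume) ⊆ Ioo a b := by
    rw [β.tsupport_normed_eq, Real.closedBall_eq_Icc]
    intro t ht
    have h1 : β.rOut = (b - a) / 4 := rfl
    rw [h1] at ht
    exact ⟨by linarith [ht.1], by linarith [ht.2]⟩
  refine ⟨β.normed volume, ⟨β.contDiff_normed, β.hasCompactSupport_normed, hsub⟩, ?_⟩
  rw [intervalIntegral.integral_eq_integral_of_support_subset, β.integral_normed]
  exact (subset_tsupport _).trans (hsub.trans Ioo_subset_Ioc_self)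

/-- A test function of mean zero is the derivative of a test function. -/
theorem exists_deriv_eq_of_integral_eq_zero (hψ : ψ ∈ bumpSpace a b)
    (h0 : ∫ t in a..b, ψ t = 0) : ∃ φ ∈ bumpSpace a b, deriv φ = ψ := by
  have hc : Continuous ψ := hψ.1.continuous
  set φ : ℝ → ℝ := fun t => ∫ s in a..t, ψ s with hφ
  have hd : ∀ t, HasDerivAt φ (ψ t) t := fun t => (hc.integral_hasStrictDerivAt a t).hasDerivAt
  have hderiv : deriv φ = ψ := funext fun t => (hd t).deriv
  have hsm : ContDiff ℝ ∞ φ :=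
    contDiff_infty_iff_deriv.2 ⟨fun t => (hd t).differentiableAt, hderiv ▸ hψ.1⟩
  obtain ⟨a', b', ha', hb', hsub⟩ : ∃ a' b', a < a' ∧ b' < b ∧ tsupport ψ ⊆ Icc a' b' := by
    rcases (tsupport ψ).eq_empty_or_nonempty with he | hne
    · exact ⟨a + 1, b - 1, by linarith, by linarith, by simp [he]⟩
    · have hK : IsCompact (tsupport ψ) := hψ.2.1
      exact ⟨_, _, (hψ.2.2 (hK.sInf_mem hne)).1, (hψ.2.2 (hK.sSup_mem hne)).2,
        subset_Icc_csInf_csSup hK.bddBelow hK.bddAbove⟩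
  have hsupp : Function.support φ ⊆ Icc a' b' := by
    intro t ht
    by_contra hcon
    refine ht ?_
    rw [mem_Icc, not_and_or, not_le, not_le] at hcon
    rcases hcon with hlt | hlt
    · refine intervalIntegral.integral_zero_ae (ae_of_all _ fun s hs => ?_)
      refine image_eq_zero_of_notMem_tsupport fun h => ?_
      have h1 := (hsub h).1
      exact absurd (hs.2.trans_lt (max_lt ha' hlt)) h1.not_gt
    · have h1 : φ t = -∫ s in t..b, ψ s := by
        have := intervalIntegral.integral_add_adjacent_intervals
          (hc.intervalIntegrable a t) (hc.intervalIntegrable (μ := volume) t b)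
        rw [h0] at this
        exact eq_neg_of_add_eq_zero_left this
      rw [h1, neg_eq_zero]
      refine intervalIntegral.integral_zero_ae (ae_of_all _ fun s hs => ?_)
      refine image_eq_zero_of_notMem_tsupport fun h => ?_
      have h1 := (hsub h).2
      exact absurd ((lt_min hlt hb').trans hs.1) h1.not_gt
  have htsupp : tsupport φ ⊆ Icc a' b' := closure_minimal hsupp isClosed_Icc
  exact ⟨φ, ⟨hsm, isCompact_Icc.of_isClosed_subset (isClosed_tsupport φ) htsupp,
    htsupp.trans fun t ht => ⟨ha'.trans_le ht.1, ht.2.trans_lt hb'⟩⟩, hderiv⟩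

variable {F : Type*} [NormedAddCommGroup F] [InnerProductSpace ℝ F]

theorem integrable_bump_smul {f : ℝ → F} (hf : IntervalIntegrable f volume a b)
    (hψ : ψ ∈ bumpSpace a b) : IntervalIntegrable (fun t => ψ t • f t) volume a b :=
  hf.continuousOn_smul hψ.1.continuous.continuousOn

variable [CompleteSpace F]

/-- Integration by parts against the primitive of an integrable function. -/
theorem integral_bump_smul {q : ℝ → F} (hq : IntervalIntegrable q volume a b)
    (hψ : ψ ∈ bumpSpace a b) :
    ∫ t in a..b, ψ t • q t = -∫ t in a..b, deriv ψ t • ∫ s in a..t, q s := by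
  have scalar : ∀ {q : ℝ → ℝ} (_ : IntervalIntegrable q volume a b),
      ∫ t in a..b, ψ t * q t = -∫ t in a..b, deriv ψ t * ∫ s in a..t, q s := by
    intro q hq
    have h1 : AbsolutelyContinuousOnInterval ψ a b :=
      (hψ.1.of_le (by exact_mod_cast le_top)).contDiffOn.absolutelyContinuousOnInterval
    have h2 := hq.absolutelyContinuousOnInterval_intervalIntegral (c := a) left_mem_uIcc
    have h3 := h1.integral_mul_deriv_eq_deriv_mul h2
    rw [eq_zero_of_mem_bumpSpace hψ (t := a) (by simp),
      eq_zero_of_mem_bumpSpace hψ (t := b) (by simp), zero_mul, zero_mul, sub_zero, zero_sub] at h3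
    rw [← h3]
    refine intervalIntegral.integral_congr_ae ?_
    filter_upwards [hq.ae_hasDerivAt_integral] with t ht hmem
    rw [(ht (uIoc_subset_uIcc hmem) a left_mem_uIcc).deriv]
  have hG : IntervalIntegrable (fun t => deriv ψ t • ∫ s in a..t, q s) volume a b :=
    (intervalIntegral.continuousOn_primitive_interval'
      hq left_mem_uIcc).intervalIntegrable.continuousOn_smul
        hψ.1.deriv_infty.continuous.continuousOn
  refine ext_inner_left ℝ fun v => ?_
  have e1 := (innerSL ℝ v).intervalIntegral_comp_comm (integrable_bump_smul hq hψ)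
  have e2 := (innerSL ℝ v).intervalIntegral_comp_comm hG
  simp only [innerSL_apply_apply, inner_smul_right] at e1 e2
  rw [inner_neg_right, ← e1, ← e2]
  have hq' : IntervalIntegrable (fun t => ⟪v, q t⟫_ℝ) volume a b :=
    ⟨hq.1.const_inner v, hq.2.const_inner v⟩
  rw [scalar hq', neg_inj]
  refine intervalIntegral.integral_congr fun t ht => ?_
  have e3 := (innerSL ℝ v).intervalIntegral_comp_comm (a := a) (b := t) (hq.mono_set
    (uIcc_subset_uIcc left_mem_uIcc ht))
  simp only [innerSL_apply_apply] at e3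
  simp only [e3]

/-- An integrable function with vanishing weak derivative is constant. -/
theorem exists_ae_eq_const (hab : a < b) {f : ℝ → F} (hf : IntervalIntegrable f volume a b)
    (h : ∀ ψ ∈ bumpSpace a b, ∫ t in a..b, deriv ψ t • f t = 0) :
    ∃ A : F, ∀ᵐ t, t ∈ Ioo a b → f t = A := by
  obtain ⟨η, hη, hη1⟩ := exists_bump_integral_eq_one hab
  refine ⟨∫ t in a..b, η t • f t, ?_⟩
  set A := ∫ t in a..b, η t • f t with hA
  have hf' : IntervalIntegrable (fun t => f t - A) volume a b :=
    hf.sub intervalIntegrable_const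
  have key := isOpen_Ioo.ae_eq_zero_of_integral_contDiff_smul_eq_zero (f := fun t => f t - A)
    (U := Ioo a b) (μ := volume)
    (((intervalIntegrable_iff_integrableOn_Ioo_of_le hab.le).1 hf').locallyIntegrableOn) ?_
  · filter_upwards [key] with t ht hmem
    exact sub_eq_zero.1 (ht hmem)
  · intro g hg1 hg2 hg3
    have hg : g ∈ bumpSpace a b := ⟨hg1, hg2, hg3⟩
    rw [← intervalIntegral.integral_eq_integral_of_support_subset (a := a) (b := b)]
    swap
    · refine (Function.support_smul_subset_left g _).trans ((subset_tsupport g).trans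
        (hg3.trans Ioo_subset_Ioc_self))
    set r := ∫ t in a..b, g t with hr
    obtain ⟨φ, hφ, hφd⟩ := exists_deriv_eq_of_integral_eq_zero
      ((bumpSpace a b).sub_mem hg ((bumpSpace a b).smul_mem r hη)) (by
        simp only [Pi.sub_apply, Pi.smul_apply, smul_eq_mul]
        rw [intervalIntegral.integral_sub (hg1.continuous.intervalIntegrable _ _)
          ((hη.1.continuous.intervalIntegrable _ _).const_mul r),
          intervalIntegral.integral_const_mul, hη1, mul_one, ← hr, sub_self])
    have h1 := h φ hφ
    simp only [hφd, Pi.sub_apply, Pi.smul_apply, smul_eq_mul, sub_smul, mul_smul] at h1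
    have hri : IntervalIntegrable (fun t => r • η t • f t) volume a b :=
      (integrable_bump_smul hf hη).smul r
    rw [intervalIntegral.integral_sub (integrable_bump_smul hf hg) hri,
      intervalIntegral.integral_smul, ← hA] at h1
    simp only [smul_sub]
    rw [intervalIntegral.integral_sub (integrable_bump_smul hf hg)
      (integrable_bump_smul intervalIntegrable_const hg), intervalIntegral.integral_smul_const]
    exact h1

/-- An integrable function whose second weak derivative vanishes is affine. -/
theorem exists_ae_eq_affine (hab : a < b) {f : ℝ → F} (hf : IntervalIntegrable f volume a b)
    (h : ∀ ψ ∈ bumpSpace a b, ∫ t in a..b, deriv (deriv ψ) t • f t = 0) :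
    ∃ A B : F, ∀ᵐ t, t ∈ Ioo a b → f t = A + t • B := by
  obtain ⟨η, hη, hη1⟩ := exists_bump_integral_eq_one hab
  set B := ∫ t in a..b, deriv η t • f t with hB
  have hBi : IntervalIntegrable (fun t : ℝ => t • B) volume a b :=
    Continuous.intervalIntegrable (by fun_prop) _ _
  have hf' : IntervalIntegrable (fun t => f t + t • B) volume a b := hf.add hBi
  obtain ⟨A, hA⟩ := exists_ae_eq_const hab hf' fun ψ hψ => by
    set r := ∫ t in a..b, ψ t with hr
    have hψ' := deriv_mem_bumpSpace hψ
    have hη' := deriv_mem_bumpSpace hη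
    obtain ⟨φ, hφ, hφd⟩ := exists_deriv_eq_of_integral_eq_zero
      ((bumpSpace a b).sub_mem hψ ((bumpSpace a b).smul_mem r hη)) (by
        simp only [Pi.sub_apply, Pi.smul_apply, smul_eq_mul]
        rw [intervalIntegral.integral_sub (hψ.1.continuous.intervalIntegrable _ _)
          ((hη.1.continuous.intervalIntegrable _ _).const_mul r),
          intervalIntegral.integral_const_mul, hη1, mul_one, ← hr, sub_self])
    have hdd : deriv (deriv φ) = fun t => deriv ψ t - r * deriv η t := funext fun t => by
      rw [hφd]
      exact ((hψ.1.hasDerivAt_infty t).sub ((hη.1.hasDerivAt_infty t).const_mul r)).deriv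
    have h1 := h φ hφ
    simp only [hdd, sub_smul, mul_smul] at h1
    have hri : IntervalIntegrable (fun t => r • deriv η t • f t) volume a b :=
      (integrable_bump_smul hf hη').smul r
    rw [intervalIntegral.integral_sub (integrable_bump_smul hf hψ') hri,
      intervalIntegral.integral_smul, ← hB] at h1
    -- the weak derivative of the identity is `1`
    have h2 : ∫ t in a..b, deriv ψ t • t • B = -(r • B) := by
      have h3 := integral_bump_smul (q := fun _ => B) intervalIntegrable_const hψ
      have h4 : ∫ t in a..b, deriv ψ t = 0 := by
        rw [intervalIntegral.integral_eq_sub_of_hasDerivAt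
          (fun t _ => hψ.1.hasDerivAt_infty t)
          (hψ.1.deriv_infty.continuous.intervalIntegrable _ _),
          eq_zero_of_mem_bumpSpace hψ (t := a) (by simp),
          eq_zero_of_mem_bumpSpace hψ (t := b) (by simp), sub_zero]
      rw [intervalIntegral.integral_smul_const, ← hr] at h3
      simp only [intervalIntegral.integral_const, sub_smul, smul_sub] at h3
      rw [intervalIntegral.integral_sub (integrable_bump_smul hBi hψ')
        (integrable_bump_smul intervalIntegrable_const hψ'),
        intervalIntegral.integral_smul_const, h4, zero_smul, sub_zero] at h3
      rw [h3, neg_neg]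
    simp only [smul_add]
    rw [intervalIntegral.integral_add (integrable_bump_smul hf hψ')
      (integrable_bump_smul hBi hψ'), h2, ← sub_eq_add_neg]
    exact h1
  refine ⟨A, -B, ?_⟩
  filter_upwards [hA] with t ht hmem
  rw [← ht hmem, smul_neg, add_neg_cancel_right]

end DuBoisReymond

/-! ### The kernel of the maximal operator on a compact graph -/

section

theorem IntervalIntegrable.mono_right {F : Type*} [NormedAddCommGroup F] {a b t : ℝ} {f : ℝ → F}
    (hf : IntervalIntegrable f volume a b) (ht : t ∈ Icc a b) : IntervalIntegrable f volume a t :=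
  hf.mono_set (uIcc_subset_uIcc left_mem_uIcc (Icc_subset_uIcc ht))

variable {F : Type*} [NormedAddCommGroup F] [NormedSpace ℝ F] {a b : ℝ}

theorem intervalIntegrable_clm_apply (hab : a ≤ b) {N : ℝ → F →L[ℝ] F}
    (hN : ContinuousOn N (Icc a b)) {f : ℝ → F} (hf : IntervalIntegrable f volume a b) :
    IntervalIntegrable (fun t => N t (f t)) volume a b := by
  obtain ⟨C, hC⟩ := isCompact_Icc.exists_bound_of_continuousOn hN
  rw [intervalIntegrable_iff_integrableOn_Icc_of_le hab] at hf ⊢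
  refine (hf.norm.const_mul C).mono'
    ((ContinuousLinearMap.id ℝ (F →L[ℝ] F)).aestronglyMeasurable_comp₂
    (hN.aestronglyMeasurable measurableSet_Icc) hf.1) ?_
  filter_upwards [ae_restrict_mem measurableSet_Icc] with t ht
  exact (N t).le_of_opNorm_le (hC t ht) _

/-- The function `P f + ∫ₐᵗ N f - ∫ₐᵗ ∫ₐˢ M f`, which is affine if and only if `f` is a weak
solution of `(P f)'' + (N f)' - M f = 0`. -/
noncomputable def integratedExpr (P N M : ℝ → F →L[ℝ] F) (a : ℝ) (f : ℝ → F) (t : ℝ) : F :=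
  P t (f t) + (∫ s in a..t, N s (f s)) - ∫ s in a..t, ∫ r in a..s, M r (f r)

variable {P N M : ℝ → F →L[ℝ] F} {f g : ℝ → F}

theorem intervalIntegral_congr_of_ae
    (h : f =ᵐ[volume.restrict (Icc a b)] g) (L : ℝ → F →L[ℝ] F) {t : ℝ} (ht : t ∈ Icc a b) :
    ∫ s in a..t, L s (f s) = ∫ s in a..t, L s (g s) := by
  refine intervalIntegral.integral_congr_ae ?_
  rw [Filter.EventuallyEq, ae_restrict_iff' measurableSet_Icc] at h
  filter_upwards [h] with s hs hmem
  rw [uIoc_of_le ht.1] at hmem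
  rw [hs ⟨hmem.1.le, hmem.2.trans ht.2⟩]

theorem integratedExpr_congr (h : f =ᵐ[volume.restrict (Icc a b)] g) :
    integratedExpr P N M a f =ᵐ[volume.restrict (Icc a b)] integratedExpr P N M a g := by
  filter_upwards [h, ae_restrict_mem measurableSet_Icc] with t ht hmem
  rw [integratedExpr, integratedExpr, ht, intervalIntegral_congr_of_ae h N hmem]
  congr 1
  refine intervalIntegral.integral_congr fun s hs => ?_
  rw [uIcc_of_le hmem.1] at hs
  exact intervalIntegral_congr_of_ae h M ⟨hs.1, hs.2.trans hmem.2⟩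

theorem intervalIntegrable_primitive (hab : a ≤ b) (hM : ContinuousOn M (Icc a b))
    (hf : IntervalIntegrable f volume a b) :
    IntervalIntegrable (fun s => ∫ r in a..s, M r (f r)) volume a b :=
  (intervalIntegral.continuousOn_primitive_interval'
    (intervalIntegrable_clm_apply hab hM hf) left_mem_uIcc).intervalIntegrable

theorem integratedExpr_add (hab : a ≤ b) (hN : ContinuousOn N (Icc a b))
    (hM : ContinuousOn M (Icc a b)) (hf : IntervalIntegrable f volume a b)
    (hg : IntervalIntegrable g volume a b) {t : ℝ} (ht : t ∈ Icc a b) :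
    integratedExpr P N M a (f + g) t = integratedExpr P N M a f t + integratedExpr P N M a g t := by
  have hadd : ∀ (L : ℝ → F →L[ℝ] F), ContinuousOn L (Icc a b) → ∀ t ∈ Icc a b,
      ∫ s in a..t, L s ((f + g) s) = (∫ s in a..t, L s (f s)) + ∫ s in a..t, L s (g s) := by
    intro L hL t ht
    simp only [Pi.add_apply, map_add]
    exact intervalIntegral.integral_add
      ((intervalIntegrable_clm_apply hab hL hf).mono_right ht)
      ((intervalIntegrable_clm_apply hab hL hg).mono_right ht)
  have h2 : ∫ s in a..t, ∫ r in a..s, M r ((f + g) r) =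
      (∫ s in a..t, ∫ r in a..s, M r (f r)) + ∫ s in a..t, ∫ r in a..s, M r (g r) := by
    rw [← intervalIntegral.integral_add ((intervalIntegrable_primitive hab hM hf).mono_right ht)
      ((intervalIntegrable_primitive hab hM hg).mono_right ht)]
    refine intervalIntegral.integral_congr fun s hs => ?_
    rw [uIcc_of_le ht.1] at hs
    exact hadd M hM s ⟨hs.1, hs.2.trans ht.2⟩
  simp only [integratedExpr, hadd N hN t ht, h2]
  rw [Pi.add_apply, map_add]
  abel

theorem integratedExpr_smul (r : ℝ) (t : ℝ) :
    integratedExpr P N M a (r • f) t = r • integratedExpr P N M a f t := by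
  simp only [integratedExpr, Pi.smul_apply, map_smul, intervalIntegral.integral_smul, smul_add,
    smul_sub]

/-- A Volterra equation without inhomogeneity has only the trivial solution. -/
theorem ae_eq_zero_of_integratedExpr_eq_zero (hab : a ≤ b) {m : ℝ} (hm : 0 < m)
    (hP : ∀ t ∈ Icc a b, ∀ v, m * ‖v‖ ≤ ‖P t v‖) (hN : ContinuousOn N (Icc a b))
    (hM : ContinuousOn M (Icc a b)) (hf : IntervalIntegrable f volume a b)
    (h : ∀ᵐ t ∂volume.restrict (Icc a b), integratedExpr P N M a f t = 0) :
    f =ᵐ[volume.restrict (Icc a b)] 0 := by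
  obtain ⟨CN, hCN⟩ := isCompact_Icc.exists_bound_of_continuousOn hN
  obtain ⟨CM, hCM⟩ := isCompact_Icc.exists_bound_of_continuousOn hM
  have hCN0 : 0 ≤ CN := (norm_nonneg _).trans (hCN a (left_mem_Icc.2 hab))
  have hCM0 : 0 ≤ CM := (norm_nonneg _).trans (hCM a (left_mem_Icc.2 hab))
  have hfI := (intervalIntegrable_iff_integrableOn_Icc_of_le hab).1 hf
  -- Gronwall's inequality is applied to the primitive `u` of `‖f‖`
  set κ : ℝ → ℝ := (Icc a b).indicator fun t => ‖f t‖ with hκ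
  have hκ0 : ∀ t, 0 ≤ κ t := fun t => indicator_nonneg (fun s _ => norm_nonneg (f s)) t
  have hκi : Integrable κ := (integrable_indicator_iff measurableSet_Icc).2 hfI.norm
  set u : ℝ → ℝ := fun t => ∫ s in a..t, κ s with hu
  have huc : Continuous u :=
    intervalIntegral.continuous_primitive (fun _ _ => hκi.intervalIntegrable) a
  have hu0 : ∀ t, a ≤ t → 0 ≤ u t := fun t ht =>
    intervalIntegral.integral_nonneg ht fun s _ => hκ0 s
  have humono : ∀ s t, a ≤ s → s ≤ t → u s ≤ u t := fun s t has hst => by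
    have := intervalIntegral.integral_add_adjacent_intervals
      (hκi.intervalIntegrable (a := a) (b := s)) (hκi.intervalIntegrable (a := s) (b := t))
    have h2 := intervalIntegral.integral_nonneg (μ := volume) hst fun r _ => hκ0 r
    simp only [hu]
    linarith
  have hprim : ∀ (L : ℝ → F →L[ℝ] F) (C : ℝ), (∀ t ∈ Icc a b, ‖L t‖ ≤ C) → 0 ≤ C →
      ∀ t ∈ Icc a b, ‖∫ s in a..t, L s (f s)‖ ≤ C * u t := by
    intro L C hLC hC t ht
    rw [hu, ← intervalIntegral.integral_const_mul]
    refine intervalIntegral.norm_integral_le_of_norm_le ht.1 (ae_of_all _ fun s hs => ?_)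
      (hκi.intervalIntegrable.const_mul C)
    have hsm : s ∈ Icc a b := ⟨hs.1.le, hs.2.trans ht.2⟩
    rw [hκ, indicator_of_mem hsm]
    exact (L s).le_of_opNorm_le (hLC s hsm) _
  set K := m⁻¹ * (CN + CM * (b - a)) with hK
  have hK0 : 0 ≤ K := by
    have := sub_nonneg.2 hab
    positivity
  have hpt : ∀ᵐ t ∂volume.restrict (Icc a b), ‖f t‖ ≤ K * u t := by
    filter_upwards [h, ae_restrict_mem measurableSet_Icc] with t ht hmem
    have h1 : P t (f t) = (∫ s in a..t, ∫ r in a..s, M r (f r)) - ∫ s in a..t, N s (f s) := by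
      rw [integratedExpr, sub_eq_zero] at ht
      exact eq_sub_of_add_eq ht
    have h2 : ‖∫ s in a..t, ∫ r in a..s, M r (f r)‖ ≤ CM * u t * (b - a) := by
      have h3 := intervalIntegral.norm_integral_le_of_norm_le_const (a := a) (b := t)
        (f := fun s => ∫ r in a..s, M r (f r)) (C := CM * u t) fun s hs => by
          rw [uIoc_of_le hmem.1] at hs
          exact (hprim M CM hCM hCM0 s ⟨hs.1.le, hs.2.trans hmem.2⟩).trans
            (mul_le_mul_of_nonneg_left (humono s t hs.1.le hs.2) hCM0)
      refine h3.trans (mul_le_mul_of_nonneg_left ?_ (mul_nonneg hCM0 (hu0 t hmem.1)))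
      rw [abs_of_nonneg (sub_nonneg.2 hmem.1)]
      linarith [hmem.2]
    have h3 := hP t hmem (f t)
    rw [h1] at h3
    have h4 : m * ‖f t‖ ≤ (CN + CM * (b - a)) * u t := by
      refine h3.trans ((norm_sub_le _ _).trans ?_)
      have := hprim N CN hCN hCN0 t hmem
      linarith
    rw [hK, mul_assoc, inv_mul_eq_div, le_div_iff₀ hm, mul_comm]
    exact h4
  have hub : ∀ t ∈ Icc a b, u t = 0 := by
    intro t ht
    have h1 := le_mul_exp_of_le_abs_integral (u := fun t => |u t|) huc.abs (fun t => abs_nonneg _)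
      hK0 le_rfl (p := a) (q := b) (fun t ht => ?_) (t := t) (Icc_subset_uIcc ht)
    · rw [zero_mul] at h1
      exact abs_eq_zero.1 (le_antisymm h1 (abs_nonneg _))
    · rw [uIcc_of_le hab] at ht
      rw [abs_of_nonneg (hu0 t ht.1), zero_add]
      refine le_trans ?_ (mul_le_mul_of_nonneg_left (le_abs_self _) hK0)
      rw [← intervalIntegral.integral_const_mul]
      refine intervalIntegral.integral_mono_ae_restrict ht.1 hκi.intervalIntegrable
        ((huc.abs.intervalIntegrable _ _).const_mul K) ?_
      refine ae_mono (Measure.restrict_mono (Icc_subset_Icc_right ht.2) le_rfl) ?_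
      filter_upwards [hpt, ae_restrict_mem measurableSet_Icc] with s hs hmem
      rw [hκ, indicator_of_mem hmem]
      exact hs.trans (mul_le_mul_of_nonneg_left (le_abs_self _) hK0)
  filter_upwards [hpt, ae_restrict_mem measurableSet_Icc] with t ht hmem
  rw [hub t hmem, mul_zero] at ht
  exact norm_le_zero_iff.1 ht

end

namespace SLCoeff

open Filter MetricGraph Module

variable {V E : Type*} {G : MetricGraph V E} {d : ℕ} (c : SLCoeff G d)

/-- The left-hand side of the equation `ℓ k = 0`, integrated twice from `a`. -/
noncomputable def integratedEquation (e : E) (a : ℝ) (k : ℝ → EuclideanSpace ℝ (Fin d)) (t : ℝ) :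
    EuclideanSpace ℝ (Fin d) :=
  integratedExpr (c.P e) (fun t => ContinuousLinearMap.adjoint (c.coeffOne e t))
    (fun t => ContinuousLinearMap.adjoint (c.coeffZero e t)) a k t

theorem continuousOn_adjoint {N : ℝ → EuclideanSpace ℝ (Fin d) →L[ℝ] EuclideanSpace ℝ (Fin d)}
    {s : Set ℝ} (hN : ContinuousOn N s) :
    ContinuousOn (fun t => ContinuousLinearMap.adjoint (N t)) s :=
  (ContinuousLinearMap.adjoint (𝕜 := ℝ)).continuous.comp_continuousOn hN

theorem ae_eq_restrict_Icc {e : E} {a b : ℝ} (ha : G.lo e = a) (hb : G.hi e = b)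
    {f g : ℝ → EuclideanSpace ℝ (Fin d)} (h : f =ᵐ[volume.restrict (G.edge e)] g) :
    f =ᵐ[volume.restrict (Icc a b)] g := by
  rwa [G.edge_eq_Icc ha hb] at h

variable [Fintype E]

theorem intervalIntegrable_L2 {e : E} {a b : ℝ} (ha : G.lo e = a) (hb : G.hi e = b) (hab : a ≤ b)
    (x : G.L2 d) : IntervalIntegrable (x e) volume a b := by
  have hfin : IsFiniteMeasure (volume.restrict (G.edge e)) := by
    rw [G.edge_eq_Icc ha hb]
    exact ⟨by simp⟩
  have h := (Lp.memLp (x e)).integrable one_le_two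
  rw [intervalIntegrable_iff_integrableOn_Icc_of_le hab, ← G.edge_eq_Icc ha hb]
  exact h

open Classical in
/-- The weak form of `ℓ k = 0` on a bounded edge. -/
theorem weak_equation (hd : Dense (c.minimal.domain : Set (G.L2 d))) {k : c.maximal.domain}
    (hk : c.maximal k = 0) {e : E} {a b : ℝ} (ha : G.lo e = a) (hb : G.hi e = b) (hab : a ≤ b)
    {ψ : ℝ → ℝ} (hψ : ψ ∈ bumpSpace a b) :
    ∫ t in a..b, (-(deriv (deriv ψ) t • c.P e t ((k : G.L2 d) e t)) +
      deriv ψ t • ContinuousLinearMap.adjoint (c.coeffOne e t) ((k : G.L2 d) e t) +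
      ψ t • ContinuousLinearMap.adjoint (c.coeffZero e t) ((k : G.L2 d) e t)) = 0 := by
  set κ := (k : G.L2 d) e with hκ
  have hedge := G.edge_eq_Icc ha hb
  have hκi : IntervalIntegrable κ volume a b :=
    intervalIntegrable_L2 ha hb hab (k : G.L2 d)
  have hP := (c.contDiffOn_P e).continuousOn
  have h1 := c.continuousOn_coeffOne e
  have h0 := c.continuousOn_coeffZero e
  rw [hedge] at hP h1 h0
  have hint : IntervalIntegrable (fun t => -(deriv (deriv ψ) t • c.P e t (κ t)) +
      deriv ψ t • ContinuousLinearMap.adjoint (c.coeffOne e t) (κ t) +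
      ψ t • ContinuousLinearMap.adjoint (c.coeffZero e t) (κ t)) volume a b :=
    ((integrable_bump_smul (intervalIntegrable_clm_apply hab hP hκi)
      (deriv_mem_bumpSpace (deriv_mem_bumpSpace hψ))).neg.add
      (integrable_bump_smul (intervalIntegrable_clm_apply hab (continuousOn_adjoint h1) hκi)
        (deriv_mem_bumpSpace hψ))).add
      (integrable_bump_smul (intervalIntegrable_clm_apply hab (continuousOn_adjoint h0) hκi) hψ)
  refine ext_inner_left ℝ fun v => ?_
  rw [inner_zero_right]
  have e1 := (innerSL ℝ v).intervalIntegral_comp_comm hint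
  simp only [innerSL_apply_apply] at e1
  rw [← e1]
  obtain ⟨φ, hφe, hφne⟩ : ∃ φ : G.testSpace d, φ.1 e = (fun t => ψ t • v) ∧
      ∀ e', e' ≠ e → φ.1 e' = 0 := by
    refine ⟨⟨Pi.single e (fun t => ψ t • v), fun e' => ?_⟩, by simp,
      fun e' hne => by simp [hne]⟩
    rcases eq_or_ne e' e with rfl | hne
    · rw [Pi.single_eq_same, G.openEdge_eq_Ioo ha hb]
      exact ⟨hψ.1.smul contDiff_const, hψ.2.1.smul_right,
        (tsupport_smul_subset_left ψ _).trans hψ.2.2⟩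
    · rw [Pi.single_eq_of_ne hne]
      exact (G.testSpace d).zero_mem e'
  have e2 := c.inner_maximal hd k ⟨_, c.test_mem_minimal φ⟩
  have e3 : ∀ e', c.exprToL2 φ e' =ᵐ[volume.restrict (G.edge e')] c.expandedExpr e' (φ.1 e') := by
    intro e'
    rw [← c.smoothExprToL2_testToSmooth]
    exact (c.memLp_expandedExpr (testToSmooth φ).2 e').coeFn_toLp
  rw [hk, inner_zero_left, c.minimal_apply_test, PiLp.inner_apply, Finset.sum_eq_single e,
    L2.inner_def] at e2
  · rw [e2, intervalIntegral.integral_of_le hab, ← integral_Icc_eq_integral_Ioc, ← hedge]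
    refine integral_congr_ae ?_
    have hd1 : deriv (fun t => ψ t • v) = fun t => deriv ψ t • v :=
      funext fun t => ((hψ.1.hasDerivAt_infty t).smul_const v).deriv
    have hd2 : deriv (fun t => deriv ψ t • v) = fun t => deriv (deriv ψ) t • v :=
      funext fun t => ((hψ.1.deriv_infty.hasDerivAt_infty t).smul_const v).deriv
    filter_upwards [e3 e, ae_restrict_mem (G.measurableSet_edge e)] with t ht hte
    rw [ht, hφe, expandedExpr, hd1, hd2]
    simp only [inner_add_right, inner_neg_right, map_smul, inner_smul_right,
      ContinuousLinearMap.adjoint_inner_right]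
    rw [← c.symm_P e t hte]
    simp only [real_inner_comm, hκ]
  · intro e' _ hne
    have : c.exprToL2 φ e' = 0 := by
      refine Lp.ext ((e3 e').trans (EventuallyEq.trans ?_ (Lp.coeFn_zero _ _ _).symm))
      rw [hφne e' hne]
      exact ae_of_all _ fun t => by simp [expandedExpr]
    rw [this, inner_zero_right]
  · simp

/-- An element of the kernel of the maximal operator solves the equation integrated twice, with two
constants of integration on each edge. -/
theorem exists_integratedEquation_eq (hd : Dense (c.minimal.domain : Set (G.L2 d)))
    {k : c.maximal.domain} (hk : c.maximal k = 0) {e : E} {a b : ℝ} (ha : G.lo e = a)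
    (hb : G.hi e = b) (hab : a < b) : ∃ A B : EuclideanSpace ℝ (Fin d),
      ∀ᵐ t ∂volume.restrict (Icc a b),
        c.integratedEquation e a ((k : G.L2 d) e) t = A + t • B := by
  classical
  set κ := (k : G.L2 d) e with hκ
  have hedge := G.edge_eq_Icc ha hb
  have hκi : IntervalIntegrable κ volume a b :=
    intervalIntegrable_L2 ha hb hab.le (k : G.L2 d)
  have hP := (c.contDiffOn_P e).continuousOn
  have h1 := c.continuousOn_coeffOne e
  have h0 := c.continuousOn_coeffZero e
  rw [hedge] at hP h1 h0
  have iP := intervalIntegrable_clm_apply hab.le hP hκi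
  have i1 := intervalIntegrable_clm_apply hab.le (continuousOn_adjoint h1) hκi
  have i0 := intervalIntegrable_clm_apply hab.le (continuousOn_adjoint h0) hκi
  have j1 := intervalIntegrable_primitive hab.le (continuousOn_adjoint h1) hκi
  have j0 := intervalIntegrable_primitive hab.le (continuousOn_adjoint h0) hκi
  have jj0 : IntervalIntegrable (fun t => ∫ s in a..t, ∫ r in a..s,
      ContinuousLinearMap.adjoint (c.coeffZero e r) (κ r)) volume a b :=
    (intervalIntegral.continuousOn_primitive_interval' j0 left_mem_uIcc).intervalIntegrable
  obtain ⟨A, B, h⟩ := exists_ae_eq_affine hab (f := c.integratedEquation e a κ)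
    ((iP.add j1).sub jj0) fun ψ hψ => by
      have hψ' := deriv_mem_bumpSpace hψ
      have hψ'' := deriv_mem_bumpSpace hψ'
      have hw := c.weak_equation hd hk ha hb hab.le hψ
      have hn : IntervalIntegrable (fun t => -(deriv (deriv ψ) t • c.P e t (κ t))) volume a b :=
        (integrable_bump_smul iP hψ'').neg
      rw [← hκ, intervalIntegral.integral_add (hn.add (integrable_bump_smul i1 hψ'))
        (integrable_bump_smul i0 hψ), intervalIntegral.integral_add hn
        (integrable_bump_smul i1 hψ'), intervalIntegral.integral_neg,
        integral_bump_smul i1 hψ', integral_bump_smul i0 hψ, integral_bump_smul j0 hψ',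
        neg_neg] at hw
      simp only [integratedEquation, integratedExpr, smul_sub, smul_add]
      rw [intervalIntegral.integral_sub ((integrable_bump_smul iP hψ'').add
        (integrable_bump_smul j1 hψ'')) (integrable_bump_smul jj0 hψ''),
        intervalIntegral.integral_add (integrable_bump_smul iP hψ'')
        (integrable_bump_smul j1 hψ''), ← neg_eq_zero, ← hw]
      abel
  refine ⟨A, B, ?_⟩
  rw [← Measure.restrict_congr_set Ioo_ae_eq_Icc, ae_restrict_iff' measurableSet_Ioo]
  exact h

/-- The elements of the kernel of the maximal operator, together with their constants of
integration. -/
def kernelConstants {a b : E → ℝ} (ha : ∀ e, G.lo e = a e) (hb : ∀ e, G.hi e = b e)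
    (hab : ∀ e, a e < b e) : Submodule ℝ (LinearMap.ker c.maximal.toFun ×
      (E → EuclideanSpace ℝ (Fin d)) × (E → EuclideanSpace ℝ (Fin d))) where
  carrier := {z | ∀ e, ∀ᵐ t ∂volume.restrict (Icc (a e) (b e)),
    c.integratedEquation e (a e) ((z.1.1 : G.L2 d) e) t = z.2.1 e + t • z.2.2 e}
  add_mem' {z w} hz hw e := by
    have h1 := c.continuousOn_coeffOne e
    have h0 := c.continuousOn_coeffZero e
    have hi := fun x : G.L2 d => intervalIntegrable_L2 (ha e) (hb e) (hab e).le x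
    have h2 := ae_eq_restrict_Icc (ha e) (hb e)
      (Lp.coeFn_add ((z.1.1 : G.L2 d) e) ((w.1.1 : G.L2 d) e))
    rw [G.edge_eq_Icc (ha e) (hb e)] at h1 h0
    have h5 := integratedExpr_congr (P := c.P e)
      (N := fun t => ContinuousLinearMap.adjoint (c.coeffOne e t))
      (M := fun t => ContinuousLinearMap.adjoint (c.coeffZero e t)) h2
    filter_upwards [hz e, hw e, h5, ae_restrict_mem measurableSet_Icc] with t h3 h4 h5 h6
    refine h5.trans ?_
    rw [integratedExpr_add (hab e).le (continuousOn_adjoint h1) (continuousOn_adjoint h0) (hi _)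
      (hi _) h6]
    refine (congrArg₂ (· + ·) h3 h4).trans ?_
    simp only [Prod.snd_add, Prod.fst_add, Pi.add_apply, smul_add]
    abel
  zero_mem' e := by
    have h2 : ⇑(((0 : LinearMap.ker c.maximal.toFun).1 : G.L2 d) e) =ᵐ[volume.restrict
        (Icc (a e) (b e))] 0 := ae_eq_restrict_Icc (ha e) (hb e) (Lp.coeFn_zero _ _ _)
    have h5 := integratedExpr_congr (P := c.P e)
      (N := fun t => ContinuousLinearMap.adjoint (c.coeffOne e t))
      (M := fun t => ContinuousLinearMap.adjoint (c.coeffZero e t)) h2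
    filter_upwards [h5] with t h3
    refine h3.trans ?_
    simp [integratedExpr]
  smul_mem' r z hz e := by
    have h2 := ae_eq_restrict_Icc (ha e) (hb e)
      (Lp.coeFn_smul r ((z.1.1 : G.L2 d) e))
    have h5 := integratedExpr_congr (P := c.P e)
      (N := fun t => ContinuousLinearMap.adjoint (c.coeffOne e t))
      (M := fun t => ContinuousLinearMap.adjoint (c.coeffZero e t)) h2
    filter_upwards [hz e, h5] with t h3 h5
    refine h5.trans ?_
    rw [integratedExpr_smul]
    refine (congrArg (r • ·) h3).trans ?_
    simp only [Prod.smul_snd, Prod.smul_fst, Pi.smul_apply, smul_add, smul_comm r]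

theorem fst_eq_zero_of_mem_kernelConstants {a b : E → ℝ} (ha : ∀ e, G.lo e = a e)
    (hb : ∀ e, G.hi e = b e) (hab : ∀ e, a e < b e) {k : LinearMap.ker c.maximal.toFun}
    (hk : (k, 0) ∈ c.kernelConstants ha hb hab) : k = 0 := by
  refine Subtype.ext (Subtype.ext (PiLp.ext fun e => ?_))
  have h1 := c.continuousOn_coeffOne e
  have h0 := c.continuousOn_coeffZero e
  have hi := intervalIntegrable_L2 (ha e) (hb e) (hab e).le (k.1 : G.L2 d)
  obtain ⟨m, hm, hmP⟩ := c.exists_coercive (e := e) isCompact_Icc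
    (G.edge_eq_Icc (ha e) (hb e)).ge
  rw [G.edge_eq_Icc (ha e) (hb e)] at h1 h0
  have key := ae_eq_zero_of_integratedExpr_eq_zero (hab e).le hm hmP (continuousOn_adjoint h1)
    (continuousOn_adjoint h0) hi ((hk e).mono fun t ht => ht.trans (by simp))
  rw [← G.edge_eq_Icc (ha e) (hb e)] at key
  exact Lp.ext (key.trans (Lp.coeFn_zero _ _ _).symm)

/-- On a compact graph the kernel of the maximal operator has dimension at most `N_a + N_b`: its
elements are determined by two constants of integration on each edge. -/
theorem finrank_ker_maximal_le (hd : Dense (c.minimal.domain : Set (G.L2 d)))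
    (hG : ¬ G.IsNoncompact) [FiniteDimensional ℝ (LinearMap.ker c.maximal.toFun)] :
    finrank ℝ (LinearMap.ker c.maximal.toFun) ≤ G.Na d + G.Nb d := by
  classical
  have hends : ∀ e, ∃ a b : ℝ, a < b ∧ G.lo e = a ∧ G.hi e = b := by
    intro e
    rcases G.edge_cases e with h | ⟨a, -, hb⟩ | ⟨b, ha, -⟩
    · exact h
    · exact absurd ⟨e, Or.inr hb⟩ hG
    · exact absurd ⟨e, Or.inl ha⟩ hG
  choose a b hab ha hb using hends
  have hsurj : Function.Surjective
      (LinearMap.fst ℝ _ _ ∘ₗ (c.kernelConstants ha hb hab).subtype) := by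
    intro k
    have := fun e => c.exists_integratedEquation_eq hd k.2 (ha e) (hb e) (hab e)
    choose A B hAB using this
    exact ⟨⟨(k, A, B), hAB⟩, rfl⟩
  have hinj : Function.Injective
      (LinearMap.snd ℝ _ _ ∘ₗ (c.kernelConstants ha hb hab).subtype) := by
    refine (injective_iff_map_eq_zero _).2 fun z hz => ?_
    rw [LinearMap.comp_apply, LinearMap.snd_apply, Submodule.subtype_apply] at hz
    have h1 : z.1.1 = 0 := by
      refine c.fst_eq_zero_of_mem_kernelConstants ha hb hab ?_
      rw [← hz]
      exact z.2
    exact Subtype.ext (Prod.ext h1 hz)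
  have hdim : finrank ℝ ((E → EuclideanSpace ℝ (Fin d)) × (E → EuclideanSpace ℝ (Fin d))) =
      G.Na d + G.Nb d := by
    have hlo : ∀ e, G.lo e ≠ ⊥ := fun e => by rw [ha]; exact EReal.coe_ne_bot _
    have hhi : ∀ e, G.hi e ≠ ⊤ := fun e => by rw [hb]; exact EReal.coe_ne_top _
    rw [finrank_prod, finrank_pi_fintype]
    simp [MetricGraph.Na, MetricGraph.Nb, hlo, hhi]
  rw [← hdim]
  exact (LinearMap.finrank_le_finrank_of_surjective hsurj).trans
    (LinearMap.finrank_le_finrank_of_injective hinj)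

end SLCoeff

/-! ### Consequences of the Fredholm property -/

theorem finiteDimensional_of_ker_le {X Y : Type*} [AddCommGroup X] [Module ℝ X] [AddCommGroup Y]
    [Module ℝ Y] [FiniteDimensional ℝ Y] (T : X →ₗ[ℝ] Y) {S : Submodule ℝ X}
    [FiniteDimensional ℝ S] (h : LinearMap.ker T ≤ S) : FiniteDimensional ℝ X ∧
      Module.finrank ℝ X ≤ Module.finrank ℝ Y + Module.finrank ℝ S := by
  have hfk : FiniteDimensional ℝ (LinearMap.ker T) := Submodule.finiteDimensional_of_le h
  have hfq : Module.Finite ℝ (X ⧸ LinearMap.ker T) :=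
    Module.Finite.equiv T.quotKerEquivRange.symm
  have hfX : FiniteDimensional ℝ X := Module.Finite.of_submodule_quotient (LinearMap.ker T)
  refine ⟨hfX, ?_⟩
  rw [← T.finrank_range_add_finrank_ker]
  exact add_le_add (Submodule.finrank_le _) (Submodule.finrank_mono h)

namespace SLCoeff

open Filter MetricGraph Module

variable {V E : Type*} {G : MetricGraph V E} {d : ℕ} {c : SLCoeff G d} [Fintype E]

theorem omega_swap (x y : c.maximal.domain) : c.omega x y = -c.omega y x := by
  rw [omega_apply, omega_apply, real_inner_comm, real_inner_comm (c.maximal x)]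
  ring

/-- The orthogonal complement of the range of `L` is the kernel of `L*`. -/
theorem exists_mem_ker_of_mem_orthogonal (hd : Dense (c.minimal.domain : Set (G.L2 d)))
    {s : G.L2 d} (hs : s ∈ (LinearMap.range c.minimal.toFun)ᗮ) :
    ∃ k ∈ LinearMap.ker c.maximal.toFun, (k : G.L2 d) = s := by
  have h : ∀ x : c.minimal.domain, ⟪(0 : G.L2 d), (x : G.L2 d)⟫_ℝ = ⟪s, c.minimal x⟫_ℝ := by
    intro x
    rw [inner_zero_left, real_inner_comm]
    exact ((Submodule.mem_orthogonal _ _).1 hs _ ⟨x, rfl⟩).symm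
  exact ⟨⟨s, LinearPMap.mem_adjoint_domain_of_exists s ⟨0, h⟩⟩,
    LinearPMap.adjoint_apply_eq hd _ h, rfl⟩

theorem inner_ker_minimal (hd : Dense (c.minimal.domain : Set (G.L2 d))) {k : c.maximal.domain}
    (hk : c.maximal k = 0) (x : c.minimal.domain) : ⟪(k : G.L2 d), c.minimal x⟫_ℝ = 0 := by
  rw [← c.inner_maximal hd, hk, inner_zero_left]

/-- The kernel of the maximal operator is isomorphic to the cokernel of the minimal one. -/
theorem finiteDimensional_ker_maximal (hF : IsFredholmPMap c.minimal) :
    FiniteDimensional ℝ (LinearMap.ker c.maximal.toFun) ∧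
      finrank ℝ (G.L2 d ⧸ LinearMap.range c.minimal.toFun) ≤
        finrank ℝ (LinearMap.ker c.maximal.toFun) := by
  have hd := hF.dense_domain
  have := hF.finite_coker
  have hclosed := hF.isClosed_range
  set r := LinearMap.range c.minimal.toFun with hr
  let T : LinearMap.ker c.maximal.toFun →ₗ[ℝ] G.L2 d ⧸ r :=
    r.mkQ ∘ₗ c.maximal.domain.subtype ∘ₗ Submodule.subtype _
  have hinj : Function.Injective T := by
    refine (injective_iff_map_eq_zero _).2 fun k hk => ?_
    obtain ⟨x, hx⟩ : (k.1 : G.L2 d) ∈ r := (Submodule.Quotient.mk_eq_zero r).1 hk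
    have h1 := inner_ker_minimal hd k.2 x
    have h2 : c.minimal x = (k.1 : G.L2 d) := hx
    rw [h2, inner_self_eq_zero] at h1
    exact Subtype.ext (Subtype.ext h1)
  have hsurj : Function.Surjective T := by
    intro q
    obtain ⟨x, rfl⟩ := r.mkQ_surjective q
    have : CompleteSpace r := hclosed.completeSpace_coe
    obtain ⟨y, hy, z, hz, rfl⟩ := r.exists_add_mem_mem_orthogonal x
    obtain ⟨k, hk, hkz⟩ := exists_mem_ker_of_mem_orthogonal hd hz
    refine ⟨⟨k, hk⟩, ?_⟩
    change r.mkQ (k : G.L2 d) = _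
    rw [map_add, hkz, show r.mkQ y = 0 from (Submodule.Quotient.mk_eq_zero r).2 hy, zero_add]
  have hfin : FiniteDimensional ℝ (LinearMap.ker c.maximal.toFun) :=
    FiniteDimensional.of_injective T hinj
  exact ⟨hfin, LinearMap.finrank_le_finrank_of_surjective hsurj⟩

/-- `dom L*` exceeds `dom L` by at most twice the dimension of `ker L*`: modulo `ran L` the
operator `L*` maps `U` into a space of dimension `dim ker L*`, and the kernel of this map comes
from `ker L*`. -/
theorem finiteDimensional_complement (hF : IsFredholmPMap c.minimal)
    {U : Submodule ℝ c.maximal.domain} (hU : IsCompl c.minDomain U) :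
    FiniteDimensional ℝ U ∧ finrank ℝ U ≤ 2 * finrank ℝ (LinearMap.ker c.maximal.toFun) := by
  have hd := hF.dense_domain
  have := hF.finite_coker
  obtain ⟨hK, hle⟩ := finiteDimensional_ker_maximal hF
  set r := LinearMap.range c.minimal.toFun with hr
  let T : U →ₗ[ℝ] G.L2 d ⧸ r := r.mkQ ∘ₗ c.maximal.toFun ∘ₗ U.subtype
  have hker : LinearMap.ker T ≤
      (LinearMap.ker c.maximal.toFun).map (U.projectionOnto c.minDomain hU.symm) := by
    intro u hu
    obtain ⟨x, hx⟩ : c.maximal u.1 ∈ r := (Submodule.Quotient.mk_eq_zero r).1 hu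
    let x' : c.maximal.domain := ⟨x, (c.minimal_le_maximal hd).1 x.2⟩
    have hx' : x' ∈ c.minDomain := x.2
    have h1 : c.maximal x' = c.maximal u.1 := (c.maximal_eq_minimal hd hx').trans hx
    refine ⟨u.1 - x', ?_, ?_⟩
    · change c.maximal (u.1 - x') = 0
      rw [LinearPMap.map_sub, h1, sub_self]
    · rw [map_sub, (Submodule.projectionOnto_apply_eq_zero_iff hU.symm).2 hx', sub_zero,
        Submodule.projectionOnto_apply_left]
  obtain ⟨hfU, hbound⟩ := finiteDimensional_of_ker_le T hker
  rw [two_mul]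
  exact ⟨hfU, hbound.trans (add_le_add hle (Submodule.finrank_map_le _ _))⟩

/-! ### The Dirichlet subspace -/

theorem boundaryForm_eq_zero_of_fst {z z' : G.BoundaryData d} (hz : z.1 = 0) (hz' : z'.1 = 0) :
    c.boundaryForm z z' = 0 := by
  simp [boundaryForm, hz, hz']

/-- The boundary data with vanishing values are a maximal isotropic subspace, as `P` is positive
definite at the endpoints. -/
theorem fst_eq_zero_of_boundaryForm {z : G.BoundaryData d}
    (h : ∀ w, c.boundaryForm z (0, w) = 0) : z.1 = 0 := by
  classical
  have h1 := h fun p => p.sign • z.1 p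
  simp only [boundaryForm, Pi.zero_apply, map_zero, add_zero, inner_zero_right, sub_zero,
    map_smul, inner_smul_right] at h1
  have hnn : ∀ p : G.Endpoint, 0 ≤ p.sign * (p.sign * ⟪z.1 p, c.P p.edge p.pos (z.1 p)⟫_ℝ) := by
    intro p
    rw [← mul_assoc]
    refine mul_nonneg (mul_self_nonneg _) ?_
    rcases eq_or_ne (z.1 p) 0 with h0 | h0
    · simp [h0]
    · rw [real_inner_comm]
      exact (c.pos_P _ _ p.pos_mem _ h0).le
  refine funext fun p => ?_
  by_contra h0
  have h2 := (Finset.sum_eq_zero_iff_of_nonneg fun p _ => hnn p).1 h1 p (Finset.mem_univ p)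
  have h3 := c.pos_P _ _ p.pos_mem _ h0
  rw [real_inner_comm] at h3
  exact (mul_ne_zero p.sign_ne_zero (mul_ne_zero p.sign_ne_zero h3.ne')) h2

theorem mem_sup_dirichlet_iff {U : Submodule ℝ c.maximal.domain} (hU : IsCompl c.minDomain U)
    (x : c.maximal.domain) :
    x ∈ c.minDomain ⊔ (c.dirichlet U).map U.subtype ↔ (x : G.L2 d) ∈ vanishingTrace G d := by
  constructor
  · intro hx
    obtain ⟨y, hy, _, ⟨u, hu, rfl⟩, rfl⟩ := Submodule.mem_sup.1 hx
    exact (vanishingTrace G d).add_mem (c.minimal_domain_le_vanishingTrace hy) hu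
  · intro hx
    obtain ⟨y, hy, u, hu, rfl⟩ :=
      Submodule.mem_sup.1 (hU.sup_eq_top.ge (Submodule.mem_top (x := x)))
    refine Submodule.add_mem_sup hy ⟨⟨u, hu⟩, ?_, rfl⟩
    have := (vanishingTrace G d).sub_mem hx (c.minimal_domain_le_vanishingTrace hy)
    have h2 : ((y + u : c.maximal.domain) : G.L2 d) - c.maximal.domain.subtype y = u :=
      add_sub_cancel_left (y : G.L2 d) u
    rwa [h2] at this

theorem mem_sup_dirichlet_iff_fst {U : Submodule ℝ c.maximal.domain}
    (hU : IsCompl c.minDomain U) {n : ℕ} (hn : G.Separates (n + 1)) {x : c.maximal.domain}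
    {z : G.BoundaryData d} (hz : x - c.maximalLift n z ∈ c.minDomain) :
    x ∈ c.minDomain ⊔ (c.dirichlet U).map U.subtype ↔ z.1 = 0 := by
  rw [mem_sup_dirichlet_iff hU, ← c.maximalLift_mem_vanishingTrace_iff hn]
  have h1 : (x : G.L2 d) - c.maximalLift n z ∈ vanishingTrace G d :=
    c.minimal_domain_le_vanishingTrace hz
  exact ⟨fun h => by simpa using (vanishingTrace G d).sub_mem h h1,
    fun h => by simpa using (vanishingTrace G d).add_mem h1 h⟩

theorem omega_eq_boundaryForm (hd : Dense (c.minimal.domain : Set (G.L2 d))) {n : ℕ}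
    (hn : G.Separates (n + 1)) {x y : c.maximal.domain} {z w : G.BoundaryData d}
    (hx : x - c.maximalLift n z ∈ c.minDomain) (hy : y - c.maximalLift n w ∈ c.minDomain) :
    c.omega x y = c.boundaryForm z w := by
  have h1 := c.omega_eq_zero_of_mem_minDomain hd _ hx y
  have h2 := c.omega_eq_zero_of_mem_minDomain hd _ hy (c.maximalLift n z)
  rw [map_sub, LinearMap.sub_apply] at h1 h2
  rw [← c.omega_maximalLift hd hn hn, omega_swap (c.maximalLift n z), sub_eq_zero.1 h1,
    ← sub_eq_zero.1 h2, omega_swap]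

/-- `dom L + Λ_D` is its own annihilator with respect to `ω`. -/
theorem mem_sup_dirichlet_iff_forall (hd : Dense (c.minimal.domain : Set (G.L2 d)))
    {U : Submodule ℝ c.maximal.domain} (hU : IsCompl c.minDomain U) [FiniteDimensional ℝ U]
    (hdim : finrank ℝ U ≤ 2 * (G.Na d + G.Nb d)) (x : c.maximal.domain) :
    x ∈ c.minDomain ⊔ (c.dirichlet U).map U.subtype ↔
      ∀ y ∈ c.minDomain ⊔ (c.dirichlet U).map U.subtype, c.omega x y = 0 := by
  obtain ⟨n, hn⟩ := (eventually_separates G).exists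
  obtain ⟨z, hz⟩ := c.exists_eq_add_maximalLift hd hU hdim hn x
  constructor
  · intro hx y hy
    obtain ⟨w, hw⟩ := c.exists_eq_add_maximalLift hd hU hdim hn y
    rw [omega_eq_boundaryForm hd hn hz hw]
    exact boundaryForm_eq_zero_of_fst ((mem_sup_dirichlet_iff_fst hU hn hz).1 hx)
      ((mem_sup_dirichlet_iff_fst hU hn hw).1 hy)
  · intro h
    refine (mem_sup_dirichlet_iff_fst hU hn hz).2 (fst_eq_zero_of_boundaryForm (c := c) fun w => ?_)
    have h0 : c.maximalLift n (0, w) - c.maximalLift n (0, w) ∈ c.minDomain := by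
      rw [sub_self]
      exact c.minDomain.zero_mem
    rw [← omega_eq_boundaryForm hd hn hz h0]
    exact h _ ((mem_sup_dirichlet_iff_fst hU hn h0).2 rfl)

theorem isLagrangian_dirichlet (hd : Dense (c.minimal.domain : Set (G.L2 d)))
    {U : Submodule ℝ c.maximal.domain} (hU : IsCompl c.minDomain U) [FiniteDimensional ℝ U]
    (hdim : finrank ℝ U ≤ 2 * (G.Na d + G.Nb d)) :
    IsLagrangian (c.rho U) (c.dirichlet U) := by
  have key := mem_sup_dirichlet_iff_forall hd hU hdim
  have hmem : ∀ u : U, u ∈ c.dirichlet U ↔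
      (u : c.maximal.domain) ∈ c.minDomain ⊔ (c.dirichlet U).map U.subtype := fun u => by
    rw [mem_sup_dirichlet_iff hU]
    rfl
  intro u
  rw [hmem, key]
  constructor
  · exact fun h v hv => h v ((hmem v).1 hv)
  · intro h y hy
    obtain ⟨l, hl, _, ⟨v, hv, rfl⟩, rfl⟩ := Submodule.mem_sup.1 hy
    rw [map_add, omega_swap _ l, c.omega_eq_zero_of_mem_minDomain hd l hl, neg_zero, zero_add]
    exact h v hv

/-- The approximation property of the Friedrichs extension: functions with vanishing boundary values
differ from elements of `dom L` by boundary layers of arbitrarily small width. -/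
theorem exists_seq_friedrichs (hd : Dense (c.minimal.domain : Set (G.L2 d)))
    {U : Submodule ℝ c.maximal.domain} (hU : IsCompl c.minDomain U) [FiniteDimensional ℝ U]
    (hdim : finrank ℝ U ≤ 2 * (G.Na d + G.Nb d))
    (x : c.maximal.domain)
    (hx : x ∈ c.minDomain ⊔ (c.dirichlet U).map U.subtype) :
    ∃ h : ℕ → c.maximal.domain, (∀ n, x - h n ∈ c.minDomain) ∧
      Tendsto (fun n => (h n : G.L2 d)) atTop (𝓝 0) ∧
      Tendsto (fun n => ⟪c.maximal (h n), (h n : G.L2 d)⟫_ℝ) atTop (𝓝 0) := by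
  obtain ⟨N, hN⟩ := eventually_atTop.1 (eventually_separates G)
  obtain ⟨⟨v, w⟩, hz⟩ := c.exists_eq_add_maximalLift hd hU hdim (hN N le_rfl) x
  obtain rfl : v = 0 := (mem_sup_dirichlet_iff_fst hU (hN N le_rfl) hz).1 hx
  refine ⟨fun n => c.maximalLift (n + N) (0, w), fun n => ?_,
    (c.tendsto_maximalLift w).comp (tendsto_add_atTop_nat N),
    (c.tendsto_inner_maximalLift hd w).comp (tendsto_add_atTop_nat N)⟩
  have h1 := c.maximalLift_sub_maximalLift_mem hd hU hdim (hN N le_rfl)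
    (hN (n + N) (Nat.le_add_left _ _)) (0, w)
  simpa using c.minDomain.add_mem hz h1

/-- The range of the Dirichlet realization is the orthogonal complement of its kernel. It is closed,
as it contains the range of `L`, which is closed and of finite codimension. -/
theorem exists_maximal_eq_of_orthogonal (hF : IsFredholmPMap c.minimal)
    {U : Submodule ℝ c.maximal.domain} (hU : IsCompl c.minDomain U) [FiniteDimensional ℝ U]
    (hdim : finrank ℝ U ≤ 2 * (G.Na d + G.Nb d)) (x : c.maximal.domain)
    (hx : ∀ k ∈ LinearMap.ker c.maximal.toFun ⊓ (c.minDomain ⊔ (c.dirichlet U).map U.subtype),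
      ⟪c.maximal x, (k : G.L2 d)⟫_ℝ = 0) :
    ∃ y ∈ c.minDomain ⊔ (c.dirichlet U).map U.subtype, c.maximal y = c.maximal x := by
  have hd := hF.dense_domain
  have := hF.finite_coker
  set S := c.minDomain ⊔ (c.dirichlet U).map U.subtype with hS
  set r := S.map c.maximal.toFun with hr
  have hle : LinearMap.range c.minimal.toFun ≤ r := by
    rintro _ ⟨y, rfl⟩
    let y' : c.maximal.domain := ⟨y, (c.minimal_le_maximal hd).1 y.2⟩
    have hy' : y' ∈ c.minDomain := y.2
    exact ⟨y', Submodule.mem_sup_left hy', c.maximal_eq_minimal hd hy'⟩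
  have hclosed : IsClosed (r : Set (G.L2 d)) :=
    Submodule.isClosed_mono_of_finiteDimensional_quotient hF.isClosed_range hle
  have : CompleteSpace r := hclosed.completeSpace_coe
  suffices h : c.maximal x ∈ rᗮᗮ by
    rw [Submodule.orthogonal_orthogonal] at h
    exact h
  rw [Submodule.mem_orthogonal]
  intro s hs
  obtain ⟨k, hk, rfl⟩ := exists_mem_ker_of_mem_orthogonal hd (Submodule.orthogonal_le hle hs)
  have hk0 : c.maximal k = 0 := hk
  rw [real_inner_comm]
  refine hx k ⟨hk, (mem_sup_dirichlet_iff_forall hd hU hdim k).2 fun y hy => ?_⟩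
  rw [omega_apply, hk0, inner_zero_left, sub_zero, real_inner_comm]
  exact (Submodule.mem_orthogonal _ _).1 hs _ ⟨y, hy, rfl⟩

/-! ### Comparison of the Morse indices -/

theorem morseIndex_extension (U : Submodule ℝ c.maximal.domain) (Λ : Submodule ℝ U) :
    morseIndex (c.extension U Λ) = restrMorse c.maximal.domain.subtype c.maximal.toFun
      (c.minDomain ⊔ Λ.map U.subtype) := by
  let f : (c.extension U Λ).domain →ₗ[ℝ] c.maximal.domain := Submodule.inclusion inf_le_right
  have h0 : -⟪c.maximal.toFun 0, c.maximal.domain.subtype 0⟫_ℝ = 0 := by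
    rw [map_zero, inner_zero_left, neg_zero]
  refine posIndex_comp f (q := fun x => -⟪c.maximal.toFun x, c.maximal.domain.subtype x⟫_ℝ) h0
    (fun x _ => rfl) ?_
  ext x
  rw [Submodule.mem_map]
  constructor
  · rintro ⟨⟨_, ⟨y, hy, rfl⟩, -⟩, -, rfl⟩
    exact hy
  · exact fun hx => ⟨⟨x, ⟨x, hx, rfl⟩, x.2⟩, Submodule.mem_top, rfl⟩

end SLCoeff

theorem mainTheorem3 {V E : Type*} [Finite V] [Fintype E] (G : MetricGraph V E) (d : ℕ)
    (c : SLCoeff G d) (hF : IsFredholmPMap c.minimal)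
    (U : Submodule ℝ c.maximal.domain) (hU : IsCompl c.minDomain U)
    (hdim : G.IsNoncompact → Module.finrank ℝ U = 2 * (G.Na d + G.Nb d))
    (Λ : Submodule ℝ U) (hΛ : IsLagrangian (c.rho U) Λ) :
    (morseIndex (c.extension U Λ) = ⊤ ↔ morseIndex (c.extension U (c.dirichlet U)) = ⊤) ∧
    (morseIndex (c.extension U (c.dirichlet U)) ≠ ⊤ →
      ((morseIndex (c.extension U Λ)).toNat : ℤ)
          - ((morseIndex (c.extension U (c.dirichlet U))).toNat : ℤ)
        = tripleIndex (c.rho U) (c.cauchyData hU) Λ (c.dirichlet U)) := by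
  have hd := hF.dense_domain
  obtain ⟨hK, -⟩ := SLCoeff.finiteDimensional_ker_maximal hF
  obtain ⟨hfU, hle⟩ := SLCoeff.finiteDimensional_complement hF hU
  have hdim' : Module.finrank ℝ U ≤ 2 * (G.Na d + G.Nb d) := by
    by_cases hG : G.IsNoncompact
    · exact (hdim hG).le
    · exact hle.trans (Nat.mul_le_mul_left 2 (c.finrank_ker_maximal_le hd hG))
  rw [SLCoeff.morseIndex_extension, SLCoeff.morseIndex_extension]
  refine restrMorse_sub_eq_tripleIndex hU (fun x y => c.omega_apply x y)
    (c.omega_eq_zero_of_mem_minDomain hd) hΛ (SLCoeff.isLagrangian_dirichlet hd hU hdim')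
    (fun v hv => ?_) (SLCoeff.exists_maximal_eq_of_orthogonal hF hU hdim')
    (SLCoeff.exists_seq_friedrichs hd hU hdim')
  refine hd.eq_zero_of_inner_left ℝ fun x hx => ?_
  rw [real_inner_comm]
  exact hv ⟨x, (c.minimal_le_maximal hd).1 hx⟩ hx
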